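/- For a field $K$ of characteristic $0$ and $t\in K$, let $\mathcal A_t$ be the arrangement in $K^3$ of the kernels of the linear forms with coefficient vectors $(1,0,0)$, $(1,1,0)$, $(1,0,1)$, $(1,1,1)$, $(1,t,1)$, $(0,1,0)$, $(2,1,1)$, $(t+1,t,1)$, $(t+1,1,1)$, $(2t,t,1)$, $(1,-t+1,1)$, $(-3t+1,t^2-3t+1,-t)$, $(3t-1,t,t)$, $(-3t+1,-t^2,-t)$, $(3t-1,2t-1,t)$. Write $\mathcal A_t$ (with $t$ the variable) for the arrangement over $K=\mathbb Q(t)$, and $\mathcal A_\lambda$ for the arrangement in $\mathbb C^3$ given by $\lambda\in\mathbb C$. A central arrangement $\mathcal A$ in $K^3$ is free with exponents $(d_1,d_2,d_3)$ if its module of logarithmic derivations has a homogeneous basis of degrees $d_1,d_2,d_3$. It is recursively free if there are free arrangements $\emptyset=\mathcal B_0,\dots,\mathcal B_s=\mathcal A$ in $K^3$ with $|\mathcal B_i\,\triangle\,\mathcal B_{i+1}|=1$ for all $i<s$. $L(\mathcal A)$ is the lattice of all intersections of planes of $\mathcal A$, ordered by reverse inclusion. For a graded lattice $L$ of rank $r$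 with set $L_1$ of elements of rank one, the moduli space $\mathcal V_{\mathbb C}(L)$ is the quotient by $\mathrm{PGL}_r(\mathbb C)$ of the set of arrangements $\mathcal A$ of $|L_1|$ hyperplanes in $\mathbb C^r$ for which there is an isomorphism $L(\mathcal A)\cong L$ carrying $\mathcal A$ onto $L_1$. It has the quotient of the Zariski topology on the tuples of $|L_1|$ linear forms defining such arrangements, and its dimension is its Krull dimension. Let $$Z=\left\{0,\ 1,\ \tfrac12,\ \tfrac{3\pm\sqrt5}{2},\ \tfrac{-1\pm\sqrt5}{2}\right\}.$$ Then the following hold. 1. The moduli space $\mathcal V_{\mathbb C}(L(\mathcal A_t))$ is one-dimensional. More precisely, $\mathcal A_\lambda$ realizes $L(\mathcal A_t)$ for every $\lambda\in\mathbb C\setminus Z$, and $\mathcal V_{\mathbb C}(L(\mathcal A_t))$ is the set of the classes of the $\mathcal A_\lambda$ with $\lambda\in\mathbb C\setminus Z$. 2. If $\lambda\in\{0,1,\tfrac12\}$, then $|\mathcal A_\lambda|\ne|\mathcal A_t|$. 3. If $\lambda\in\{\tfrac{3\pm\sqrt5}{2},\tfrac{-1\pm\sqrt5}{2}\}$, then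 $|\mathcal A_\lambda|=|\mathcal A_t|$, the lattice $L(\mathcal A_\lambda)$ is isomorphic to that of the simplicial arrangement $A(15,1)$ of Grünbaum's catalogue (the 15 mirrors of the icosahedral reflection group $H_3$), and $\mathcal A_\lambda$ is free with exponents $(1,5,9)$. 4. $\mathcal A_t$ is free with exponents $(1,7,7)$ and not recursively free. 5. For $\lambda\in\{-1,\tfrac13,2,\tfrac{1\pm\sqrt{-1}}2,\tfrac23\}$ the arrangement $\mathcal A_\lambda$ is recursively free. For all other $\lambda\in\mathbb C\setminus Z$ the arrangement $\mathcal A_\lambda$ is free but not recursively free. 6. The group $\mathrm{Aut}(L(\mathcal A_t))$ of poset automorphisms is isomorphic to the wreath product $\mathbb Z/2\mathbb Z\wr\mathfrak S_3=(\mathbb Z/2\mathbb Z)^3\rtimes\mathfrak S_3$, and thus to the reflection group of type $B_3$. -/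

import Mathlib

noncomputable section

namespace HypArr

universe u v

/-! ### Central arrangements -/

/-- The linear subspace `{x | v₀ x₀ + ⋯ + vₙ₋₁ xₙ₋₁ = 0}` of `K ^ n`. -/
def plane {K : Type u} [Field K] {n : ℕ} (v : Fin n → K) : Submodule K (Fin n → K) :=
  LinearMap.ker (∑ i, v i • (LinearMap.proj i : (Fin n → K) →ₗ[K] K))

/-- A central arrangement in `K ^ n`: a finite set of linear hyperplanes. -/
@[ext]
structure Arrangement (K : Type u) [Field K] (n : ℕ) where
  planes : Set (Submodule K (Fin n → K))
  finite_planes : planes.Finite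
  isHyperplane : ∀ H ∈ planes, ∃ v : Fin n → K, v ≠ 0 ∧ H = plane v

/-- The arrangement of the kernels of a finite family of nonzero linear forms. -/
def ofNormals {K : Type u} [Field K] {n m : ℕ} (v : Fin m → Fin n → K)
    (hv : ∀ i, v i ≠ 0) : Arrangement K n where
  planes := Set.range fun i => plane (v i)
  finite_planes := Set.finite_range _
  isHyperplane := by
    rintro H ⟨i, rfl⟩
    exact ⟨v i, hv i, rfl⟩

namespace Arrangement

variable {K : Type u} [Field K] {n : ℕ}

/-! ### Freeness -/

/-- The linear form `v₀ x₀ + ⋯ + vₙ₋₁ xₙ₋₁` in the coordinate ring `K[x₀, …, xₙ₋₁]`. -/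
def form (v : Fin n → K) : MvPolynomial (Fin n) K :=
  ∑ i, MvPolynomial.C (v i) * MvPolynomial.X i

/-- The logarithmic derivation module `D(A)`. All linear forms with kernel `H` are proportional,
so quantifying over all of them is the same as fixing one for every `H ∈ A`. -/
def logDer (A : Arrangement K n) :
    Submodule (MvPolynomial (Fin n) K)
      (Derivation K (MvPolynomial (Fin n) K) (MvPolynomial (Fin n) K)) where
  carrier := {θ | ∀ v : Fin n → K, plane v ∈ A.planes → θ (form v) ∈ Ideal.span {form v}}
  zero_mem' := fun v _ => by simp
  add_mem' := fun {θ η} hθ hη v hv => by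
    simpa using Ideal.add_mem _ (hθ v hv) (hη v hv)
  smul_mem' := fun f θ hθ v hv => by
    simpa using Ideal.mul_mem_left _ f (hθ v hv)

/-- `A` is free with exponents `(d₀, …, dₙ₋₁)`: the module `D(A)` has a basis `θ₀, …, θₙ₋₁` such
that all coefficients `θᵢ(xⱼ)` are homogeneous of degree `dᵢ`. -/
def IsFreeWithExponents (A : Arrangement K n) (d : Fin n → ℕ) : Prop :=
  ∃ θ : Module.Basis (Fin n) (MvPolynomial (Fin n) K) A.logDer,
    ∀ i j, ((θ i : Derivation K (MvPolynomial (Fin n) K) (MvPolynomial (Fin n) K))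
      (MvPolynomial.X j)).IsHomogeneous (d i)

/-- `A` is free. -/
def IsFree (A : Arrangement K n) : Prop :=
  ∃ d : Fin n → ℕ, A.IsFreeWithExponents d

/-- A plane arrangement is recursively free if it is reached from the empty arrangement by adding
or deleting one plane at a time, through free arrangements only. -/
def IsRecursivelyFree (A : Arrangement K 3) : Prop :=
  ∃ (t : ℕ) (B : ℕ → Arrangement K 3),
    (B 0).planes = ∅ ∧ B t = A ∧
    (∀ i < t, (symmDiff (B i).planes (B (i + 1)).planes).ncard = 1) ∧
    ∀ i ≤ t, (B i).IsFree

/-! ### The intersection lattice -/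

/-- The intersection lattice: all intersections of subsets of `A` (the empty intersection being
the whole space), ordered by reverse inclusion. -/
abbrev Lattice (A : Arrangement K n) : Type u :=
  {X : (Submodule K (Fin n → K))ᵒᵈ // ∃ B ⊆ A.planes, OrderDual.ofDual X = sInf B}

/-- The whole space is the least element of the intersection lattice. -/
instance (A : Arrangement K n) : OrderBot A.Lattice where
  bot := ⟨OrderDual.toDual ⊤, ∅, by simp, by simp⟩
  bot_le := fun X => show OrderDual.ofDual X.1 ≤ ⊤ from le_top

end Arrangement

/-! ### The moduli space of a lattice -/

section Moduli

variable (K : Type u) [Field K] (L : Type v) [PartialOrder L] [OrderBot L] (r : ℕ)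

/-- For a graded lattice `L` of rank `r`, the set `U(L)` of the arrangements in `K ^ r` with `|L₁|`
hyperplanes whose intersection lattice is isomorphic to `L` by an isomorphism carrying the
hyperplanes to `L₁`, the set of elements of rank one, which are the atoms of `L`. -/
def Realizations : Set (Arrangement K r) :=
  {A | A.planes.ncard = {x : L | IsAtom x}.ncard ∧
    ∃ φ : A.Lattice ≃o L,
      φ '' {X | OrderDual.ofDual X.1 ∈ A.planes} = {x : L | IsAtom x}}

/-- Projective equivalence on `U(L)`. Scalars act trivially on the set of linear subspaces, so the
orbits of `GL_r(K)` are the orbits of `PGL_r(K)`. -/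
def projSetoid : Setoid (Realizations K L r) where
  r A B := ∃ g : (Fin r → K) ≃ₗ[K] (Fin r → K),
    B.1.planes = (Submodule.map (g : (Fin r → K) →ₗ[K] (Fin r → K))) '' A.1.planes
  iseqv :=
    { refl := fun A => ⟨LinearEquiv.refl K _, by simp⟩
      symm := by
        rintro A B ⟨g, hg⟩
        refine ⟨g.symm, ?_⟩
        rw [hg, Set.image_image]
        simp [← Submodule.map_comp]
      trans := by
        rintro A B C ⟨g, hg⟩ ⟨h, hh⟩
        refine ⟨g.trans h, ?_⟩
        rw [hh, hg, Set.image_image]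
        simp [← Submodule.map_comp] }

/-- The moduli space `V(L) = U(L) / PGL_r(K)`. -/
def Moduli : Type u := Quotient (projSetoid K L r)

/-- The class of an arrangement in the moduli space. -/
def Moduli.mk {K : Type u} [Field K] {L : Type v} [PartialOrder L] [OrderBot L] {r : ℕ}
    (A : Arrangement K r) (hA : A ∈ Realizations K L r) : Moduli K L r :=
  Quotient.mk (projSetoid K L r) ⟨A, hA⟩

/-- The Zariski topology on the affine space `K ^ σ`: the closed sets are the zero loci of sets of
polynomials. -/
abbrev zariski (σ : Type v) : TopologicalSpace (σ → K) :=
  TopologicalSpace.induced (MvPolynomial.pointToPoint (k := K) (K := K)) inferInstance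

/-- The tuples of `|L₁|` linear forms that define an arrangement in `U(L)`, as a subset of the
affine space of all `|L₁| × r` matrices. -/
def FormTuples : Type u :=
  {M : Fin {x : L | IsAtom x}.ncard × Fin r → K //
    ∃ h : ∀ i, (fun j => M (i, j)) ≠ 0, ofNormals (fun i j => M (i, j)) h ∈ Realizations K L r}

/-- The moduli space carries the quotient of the Zariski topology on the tuples of linear forms. -/
instance : TopologicalSpace (Moduli K L r) :=
  TopologicalSpace.coinduced
    (fun M : FormTuples K L r => Moduli.mk (ofNormals _ M.2.choose) M.2.choose_spec)
    (TopologicalSpace.induced Subtype.val (zariski K _))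

end Moduli

/-! ### The arrangement with 15 planes -/

/-- The 15 vectors of `ℤ[t] ^ 3` that define the arrangement, evaluated at `t`. -/
def normals15 {K : Type u} [Field K] (t : K) : Fin 15 → Fin 3 → K :=
  ![![1, 0, 0], ![1, 1, 0], ![1, 0, 1], ![1, 1, 1], ![1, t, 1], ![0, 1, 0], ![2, 1, 1],
    ![t + 1, t, 1], ![t + 1, 1, 1], ![2 * t, t, 1], ![1, -t + 1, 1],
    ![-3 * t + 1, t ^ 2 - 3 * t + 1, -t], ![3 * t - 1, t, t],
    ![-3 * t + 1, -t ^ 2, -t], ![3 * t - 1, 2 * t - 1, t]]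

theorem normals15_ne_zero {K : Type u} [Field K] (t : K) (i : Fin 15) : normals15 t i ≠ 0 := by
  intro h
  have h0 := congrFun h 0
  have h1 := congrFun h 1
  have h2 := congrFun h 2
  fin_cases i <;> simp [normals15] at h0 h1 h2 <;> simp [h2] at h0

/-- The arrangement `A_t` in `K ^ 3`, for an element `t` of a field `K`. -/
def arr15 {K : Type u} [Field K] (t : K) : Arrangement K 3 :=
  ofNormals (normals15 t) (normals15_ne_zero t)

/-- The generic arrangement, over `ℚ(t)`. -/
def genericArr15 : Arrangement (RatFunc ℚ) 3 :=
  arr15 (RatFunc.X : RatFunc ℚ)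

/-- The finite set `Z` of excluded parameters. -/
def excludedParams : Set ℂ :=
  {0, 1, 1 / 2, (3 + ((Real.sqrt 5 : ℝ) : ℂ)) / 2, (3 - ((Real.sqrt 5 : ℝ) : ℂ)) / 2,
    (-1 + ((Real.sqrt 5 : ℝ) : ℂ)) / 2, (-1 - ((Real.sqrt 5 : ℝ) : ℂ)) / 2}

/-- The parameters of the recursively free specializations. -/
def recursivelyFreeParams : Set ℂ :=
  {-1, 1 / 3, 2, (1 + Complex.I) / 2, (1 - Complex.I) / 2, 2 / 3}

/-! ### The icosahedral arrangement -/

/-- Normal vectors of the 15 mirrors of the icosahedral reflection group `H₃`: the coordinate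
vectors and the cyclic permutations of `(1, ±τ, ±τ⁻¹)`, where `τ` is the golden ratio. -/
def icosahedralNormals : Fin 15 → Fin 3 → ℝ :=
  ![![1, 0, 0], ![0, 1, 0], ![0, 0, 1],
    ![1, Real.goldenRatio, Real.goldenRatio⁻¹], ![1, Real.goldenRatio, -Real.goldenRatio⁻¹],
    ![1, -Real.goldenRatio, Real.goldenRatio⁻¹], ![1, -Real.goldenRatio, -Real.goldenRatio⁻¹],
    ![Real.goldenRatio⁻¹, 1, Real.goldenRatio], ![-Real.goldenRatio⁻¹, 1, Real.goldenRatio],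
    ![Real.goldenRatio⁻¹, 1, -Real.goldenRatio], ![-Real.goldenRatio⁻¹, 1, -Real.goldenRatio],
    ![Real.goldenRatio, Real.goldenRatio⁻¹, 1], ![Real.goldenRatio, -Real.goldenRatio⁻¹, 1],
    ![-Real.goldenRatio, Real.goldenRatio⁻¹, 1], ![-Real.goldenRatio, -Real.goldenRatio⁻¹, 1]]

theorem icosahedralNormals_ne_zero (i : Fin 15) : icosahedralNormals i ≠ 0 := by
  intro h
  have h0 := congrFun h 0
  have h1 := congrFun h 1
  have h2 := congrFun h 2
  fin_cases i <;> simp [icosahedralNormals] at h0 h1 h2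

/-- The simplicial arrangement `A(15,1)` of Grünbaum's catalogue: the 15 mirrors of `H₃`. -/
def icosahedralArr : Arrangement ℝ 3 :=
  ofNormals icosahedralNormals icosahedralNormals_ne_zero

/-! ### The symmetry group -/

/-- The wreath product `ℤ/2ℤ ≀ S₃ = (ℤ/2ℤ)³ ⋊ S₃`, where `S₃` permutes the three factors. -/
abbrev WreathZ2S3 : Type :=
  (Fin 3 → Multiplicative (ZMod 2)) ⋊[mulAutArrow] (Equiv.Perm (Fin 3))

/-- The vectors `eᵢ`, `eᵢ + eⱼ` and `eᵢ - eⱼ` with `i ≠ j`: the roots of type `B₃`, some of them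
up to sign. -/
def rootsB3 : Set (EuclideanSpace ℝ (Fin 3)) :=
  {x | ∃ i, x = EuclideanSpace.single i 1} ∪
  {x | ∃ i j, i ≠ j ∧ (x = EuclideanSpace.single i 1 + EuclideanSpace.single j 1 ∨
    x = EuclideanSpace.single i 1 - EuclideanSpace.single j 1)}

/-- The finite reflection group of type `B₃`: the group of isometries of Euclidean three-space
generated by the reflections in the planes orthogonal to the roots. -/
def reflectionGroupB3 :
    Subgroup (EuclideanSpace ℝ (Fin 3) ≃ₗᵢ[ℝ] EuclideanSpace ℝ (Fin 3)) :=
  Subgroup.closure {g | ∃ x ∈ rootsB3, g = (ℝ ∙ x)ᗮ.reflection}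

end HypArr

end

/-!
Over any field of characteristic `0`, the arrangement `A_t` with `t ≠ 1` is projectively equivalent
to a symmetric model, the standard arrangement with parameter `c = 2 t - 1` (`planes_arr15`). In the
projective plane the model consists of the 15 lines that join the six points `(0, 1, ±1)`,
`(±1, 0, 1)`, `(1, ±c, 0)`. All parts of the theorem are read off from this model; the excluded
parameters `Z` correspond to `c = 0`, `c = ±1` and `c² ± 4 c - 1 = 0` (`isGood_iff`), and for the
other `c` the dependent triples of lines do not depend on `c` (`det3_std_eq_zero_iff`).

*Freeness.* Two derivations `y q(x², y², z²) ∂_y + z r(x², y², z²) ∂_z` of degree 7 with explicit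
cubics `q`, `r` are logarithmic, and together with the Euler derivation they satisfy Saito's
criterion (`hasExps_std`). The free arrangements that occur here can be modified one plane at a
time: a plane that meets the others in `1 + a` lines may be added to a free arrangement with
exponents `(1, a, b)`, giving `(1, a, b + 1)` (`HasExps.insert_plane`).

*Recursive freeness.* For a free arrangement with exponents `(1, 7, 7)`, the numbers of traces on a
plane restrict which planes can be deleted or added without losing freeness
(`HasExps.not_isFree_erase`, `HasExps.not_isFree_insert`). Every plane of the standard arrangement
has at most 7 traces, so none can be deleted. Any other plane has at least 9 traces unless
`c ∈ {±3, ±1/3, ±√-1}` (`exists_nine_traces`), so none can be added. Hence for the other parameters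
the arrangement is isolated among the free arrangements and is not recursively free
(`not_isRecursivelyFree_of_isolated`). For the special parameters there is an additional plane such
that the 16 planes can be built up one by one by the addition theorem; deleting the additional
plane again leads to the standard arrangement (`isRecursivelyFree_std`).

*The golden parameters.* At the roots of `c² ± 4 c - 1` the dependent triples agree, after a
permutation, with those of the mirrors of the icosahedral group, and the addition theorem gives the
exponents `(1, 5, 9)` (`arr15_of_golden`).

*The moduli space.* For pairwise independent normals in dimension 3, the intersection lattice and
the set of dependent triples determine each other (`flatIso`, `exists_normals_of_latticeIso`). A
family with the dependent triples of `A_t` can be moved to `(1, 0, 0)`, `(0, 1, 0)`, `(0, 0, 1)`,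
`(1, 1, 1)` in four places, and then the dependences leave one free parameter, which is `c`
(`exists_std_of_isDepTable`). So the moduli space is a quotient of the line of good parameters. A
closed set pulls back to the zeros of polynomials in `c`, so it is finite or everything
(`finite_of_isClosed`); points are closed because `c` is recovered from a cross ratio, up to the
finitely many orders of the planes (`isClosed_singleton_moduli`). An infinite space with these
closed sets has dimension one (`topologicalKrullDim_eq_one`).

*The symmetry group.* Lattice automorphisms are the permutations of the planes that preserve
dependence (`latticeAutEquiv`). The six points above are the points on five of the 15 lines, so they
are permuted, and the three lines that join the points of a pair are distinguished from the others
by a count. This leaves the permutations of the six points that respect the three pairs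
(`depAutEquiv`). They act on `ℝ³` as the signed permutations of coordinates, which form the
reflection group of type `B₃` (`wreathEquivReflectionGroup`).
-/

noncomputable section

namespace HypArr

universe u v

open MvPolynomial Arrangement

/-! ### Linear forms and logarithmic vector fields -/

section Forms

variable {K : Type u} [Field K] {n : ℕ}

theorem mem_plane {v x : Fin n → K} : x ∈ plane v ↔ ∑ i, v i * x i = 0 := by
  simp [plane]

theorem plane_le_plane_iff {v w : Fin n → K} (hv : v ≠ 0) :
    plane v ≤ plane w ↔ ∃ k : K, w = k • v := by
  constructor
  · intro h
    obtain ⟨k, hk⟩ := Function.ne_iff.mp hv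
    have hk' : v k ≠ 0 := hk
    refine ⟨w k / v k, ?_⟩
    ext j
    have hx : v k • Pi.single j 1 - v j • Pi.single k 1 ∈ plane v := by
      rw [mem_plane]
      simp [mul_sub, Finset.sum_sub_distrib, Pi.single_apply]
      ring
    have h2 := mem_plane.mp (h hx)
    simp [mul_sub, Finset.sum_sub_distrib, Pi.single_apply] at h2
    simp only [Pi.smul_apply, smul_eq_mul]
    field_simp
    linear_combination h2
  · rintro ⟨k, rfl⟩ x hx
    rw [mem_plane] at hx ⊢
    simp [mul_assoc, ← Finset.mul_sum, hx]

theorem plane_eq_plane_iff {v w : Fin n → K} (hv : v ≠ 0) (hw : w ≠ 0) :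
    plane v = plane w ↔ ∃ k : K, w = k • v := by
  rw [← plane_le_plane_iff hv]
  refine ⟨fun h => h.le, fun h => le_antisymm h ?_⟩
  obtain ⟨k, rfl⟩ := (plane_le_plane_iff hv).mp h
  have hk : k ≠ 0 := by rintro rfl; simp at hw
  exact (plane_le_plane_iff hw).mpr ⟨k⁻¹, by simp [smul_smul, hk]⟩

theorem plane_smul {v : Fin n → K} {k : K} (hk : k ≠ 0) : plane (k • v) = plane v := by
  ext x
  simp [mem_plane, mul_assoc, ← Finset.mul_sum, hk]

theorem plane_ne_top {v : Fin n → K} (hv : v ≠ 0) : plane v ≠ ⊤ := by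
  intro h
  apply hv
  ext j
  have : (Pi.single j 1 : Fin n → K) ∈ plane v := h ▸ Submodule.mem_top
  simpa [mem_plane, Pi.single_apply] using this

/-- The polynomial `∑ vᵢ Pᵢ`: the value on the linear form with coefficients `v` of the
derivation with coefficients `Pᵢ`. -/
def pairing (v : Fin n → K) (P : Fin n → MvPolynomial (Fin n) K) : MvPolynomial (Fin n) K :=
  ∑ i, C (v i) * P i

theorem pairing_X (v : Fin n → K) : pairing v X = form v := rfl

theorem derivation_form
    (θ : Derivation K (MvPolynomial (Fin n) K) (MvPolynomial (Fin n) K)) (v : Fin n → K) :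
    θ (form v) = pairing v fun i => θ (X i) := by
  simp [form, pairing, map_sum, C_mul', Derivation.map_smul]

theorem pairing_smul (v : Fin n → K) (f : MvPolynomial (Fin n) K)
    (P : Fin n → MvPolynomial (Fin n) K) : pairing v (f • P) = f * pairing v P := by
  simp only [pairing, Finset.mul_sum, Pi.smul_apply, smul_eq_mul]
  exact Finset.sum_congr rfl fun i _ => by ring

theorem pairing_sub (v : Fin n → K) (P Q : Fin n → MvPolynomial (Fin n) K) :
    pairing v (P - Q) = pairing v P - pairing v Q := by
  simp [pairing, mul_sub, Finset.sum_sub_distrib]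

theorem smul_pairing (k : K) (v : Fin n → K) (P : Fin n → MvPolynomial (Fin n) K) :
    pairing (k • v) P = C k * pairing v P := by
  simp only [pairing, Finset.mul_sum, Pi.smul_apply, smul_eq_mul, C_mul, mul_assoc]

theorem add_pairing (v w : Fin n → K) (P : Fin n → MvPolynomial (Fin n) K) :
    pairing (v + w) P = pairing v P + pairing w P := by
  simp [pairing, add_mul, Finset.sum_add_distrib]

theorem form_smul (k : K) (v : Fin n → K) : form (k • v) = C k * form v := smul_pairing k v X

theorem form_add (v w : Fin n → K) : form (v + w) = form v + form w := add_pairing v w X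

theorem eval_form (v x : Fin n → K) : eval x (form v) = ∑ i, v i * x i := by
  simp [form]

theorem form_isHomogeneous (v : Fin n → K) : (form v).IsHomogeneous 1 :=
  IsHomogeneous.sum _ _ _ fun i _ => by
    simpa using (isHomogeneous_C _ (v i)).mul (isHomogeneous_X K i)

theorem pairing_isHomogeneous {v : Fin n → K} {P : Fin n → MvPolynomial (Fin n) K} {d : ℕ}
    (h : ∀ i, (P i).IsHomogeneous d) : (pairing v P).IsHomogeneous d :=
  IsHomogeneous.sum _ _ _ fun i _ => by
    simpa using (isHomogeneous_C _ (v i)).mul (h i)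

theorem form_ne_zero {v : Fin n → K} (hv : v ≠ 0) : form v ≠ 0 := by
  intro h
  apply hv
  ext j
  simpa [eval_form, Pi.single_apply] using congrArg (eval (Pi.single j 1)) h

theorem form_prime {v : Fin n → K} (hv : v ≠ 0) : Prime (form v) := by
  have h1 : (form v).totalDegree = 1 := (form_isHomogeneous v).totalDegree (form_ne_zero hv)
  refine (irreducible_of_totalDegree_eq_one h1 fun x hx => ?_).prime
  obtain ⟨d, hd⟩ := ne_zero_iff.mp (form_ne_zero hv)
  rw [isUnit_iff_ne_zero]
  rintro rfl
  exact hd (zero_dvd_iff.mp (hx d))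

theorem form_dvd_form_iff {v w : Fin n → K} (hv : v ≠ 0) :
    form v ∣ form w ↔ ∃ k : K, w = k • v := by
  constructor
  · rintro ⟨q, hq⟩
    refine (plane_le_plane_iff hv).mp fun x hx => ?_
    rw [mem_plane, ← eval_form] at hx ⊢
    rw [hq, map_mul, hx, zero_mul]
  · rintro ⟨k, rfl⟩
    exact ⟨C k, by rw [form_smul, mul_comm]⟩

/-- The vector field with coefficients `Pᵢ` is tangent to the planes with normals `wᵢ`,
`i ∈ s`. -/
def IsLog {ι : Type v} (w : ι → Fin n → K) (s : Finset ι)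
    (P : Fin n → MvPolynomial (Fin n) K) : Prop :=
  ∀ i ∈ s, form (w i) ∣ pairing (w i) P

/-- The vectors `wᵢ`, `i ∈ s`, are nonzero and pairwise non-proportional. -/
def PairwiseIndep {ι : Type v} (w : ι → Fin n → K) (s : Finset ι) : Prop :=
  (∀ i ∈ s, w i ≠ 0) ∧ ∀ i ∈ s, ∀ j ∈ s, i ≠ j → ∀ k : K, w j ≠ k • w i

variable {ι : Type v} {w : ι → Fin n → K} {s : Finset ι}

theorem PairwiseIndep.mono {t : Finset ι} (h : PairwiseIndep w s) (hts : t ⊆ s) :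
    PairwiseIndep w t :=
  ⟨fun i hi => h.1 i (hts hi), fun i hi j hj => h.2 i (hts hi) j (hts hj)⟩

theorem IsLog.mono {t : Finset ι} {P : Fin n → MvPolynomial (Fin n) K}
    (h : IsLog w s P) (hts : t ⊆ s) : IsLog w t P := fun i hi => h i (hts hi)

theorem isLog_X : IsLog w s X := fun _ _ => dvd_rfl

theorem PairwiseIndep.prod_dvd (h : PairwiseIndep w s) {f : MvPolynomial (Fin n) K}
    (hf : ∀ i ∈ s, form (w i) ∣ f) : ∏ i ∈ s, form (w i) ∣ f := by
  refine Finset.prod_dvd_of_isRelPrime (fun i hi j hj hij => ?_) hf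
  rw [Function.onFun, (form_prime (h.1 i hi)).irreducible.isRelPrime_iff_not_dvd,
    form_dvd_form_iff (h.1 i hi)]
  rintro ⟨k, hk⟩
  exact h.2 i hi j hj hij k hk

theorem prod_form_isHomogeneous (w : ι → Fin n → K) (s : Finset ι) :
    (∏ i ∈ s, form (w i)).IsHomogeneous s.card := by
  simpa using IsHomogeneous.prod s _ (fun _ => 1) fun i _ => form_isHomogeneous (w i)

theorem PairwiseIndep.prod_ne_zero (h : PairwiseIndep w s) : ∏ i ∈ s, form (w i) ≠ 0 :=
  Finset.prod_ne_zero_iff.mpr fun i hi => form_ne_zero (h.1 i hi)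

/-- A homogeneous multiple of a homogeneous polynomial has a homogeneous cofactor. -/
theorem exists_homogeneous_cofactor {σ : Type*} {f g : MvPolynomial σ K} {a b : ℕ}
    (hf : f.IsHomogeneous a) (hg : g.IsHomogeneous b) (hgf : g ∣ f) :
    ∃ q : MvPolynomial σ K, q.IsHomogeneous (a - b) ∧ f = g * q ∧ (a < b → q = 0) := by
  by_cases hf0 : f = 0
  · exact ⟨0, isHomogeneous_zero _ _ _, by simp [hf0], fun _ => rfl⟩
  obtain ⟨q, rfl⟩ := hgf
  have hg0 : g ≠ 0 := left_ne_zero_of_mul hf0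
  have hq0 : q ≠ 0 := right_ne_zero_of_mul hf0
  have hdeg := hf.totalDegree hf0
  rw [totalDegree_mul_of_isDomain hg0 hq0, hg.totalDegree hg0] at hdeg
  have hab : b + (a - b) = a := by omega
  refine ⟨homogeneousComponent (a - b) q, homogeneousComponent_isHomogeneous _ _, ?_,
    fun h => by omega⟩
  have h1 : g * q = ∑ i ∈ Finset.range (q.totalDegree + 1), g * homogeneousComponent i q := by
    rw [← Finset.mul_sum, sum_homogeneousComponent]
  have h2 := congrArg (homogeneousComponent a) h1
  rw [homogeneousComponent_of_mem hf, if_pos rfl, map_sum] at h2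
  rw [h2]
  rw [Finset.sum_eq_single (a - b)]
  · rw [homogeneousComponent_of_mem (hg.mul (homogeneousComponent_isHomogeneous _ _)),
      if_pos hab.symm]
  · intro i _ hi
    rw [homogeneousComponent_of_mem (hg.mul (homogeneousComponent_isHomogeneous _ _)),
      if_neg (by omega)]
  · intro h
    exfalso; apply h
    simp; omega

/-- A homogeneous polynomial vanishes if it is divisible by one of larger degree. -/
theorem eq_zero_of_dvd_of_degree_lt {σ : Type*} {f g : MvPolynomial σ K} {a b : ℕ}
    (hf : f.IsHomogeneous a) (hg : g.IsHomogeneous b) (hgf : g ∣ f) (hab : a < b) : f = 0 := by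
  obtain ⟨q, -, h, hq⟩ := exists_homogeneous_cofactor hf hg hgf
  rw [h, hq hab, mul_zero]

theorem isHomogeneous_det {M : Matrix (Fin n) (Fin n) (MvPolynomial (Fin n) K)} {d : Fin n → ℕ}
    (h : ∀ i j, (M i j).IsHomogeneous (d i)) : M.det.IsHomogeneous (∑ i, d i) := by
  rw [← Matrix.det_transpose, Matrix.det_apply']
  refine IsHomogeneous.sum _ _ _ fun σ _ => ?_
  rw [← zero_add (∑ i, d i)]
  refine IsHomogeneous.mul ?_ (IsHomogeneous.prod _ _ _ fun i _ => ?_)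
  · simpa using isHomogeneous_C (Fin n) ((σ.sign : ℤ) : K)
  · exact h i (σ i)

/-- The determinant of `n` vector fields tangent to a plane is divisible by its linear form. -/
theorem form_dvd_det {v : Fin n → K} (hv : v ≠ 0)
    {M : Matrix (Fin n) (Fin n) (MvPolynomial (Fin n) K)}
    (h : ∀ k, form v ∣ pairing v (M k)) : form v ∣ M.det := by
  obtain ⟨k, hk⟩ := Function.ne_iff.mp hv
  choose q hq using h
  have h1 : M.mulVec (fun i => C (v i)) = form v • q := by
    ext1 i
    simp only [Matrix.mulVec, dotProduct, Pi.smul_apply, smul_eq_mul, ← hq, pairing]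
    exact Finset.sum_congr rfl fun j _ => mul_comm _ _
  have h2 := congrArg (fun x => M.adjugate.mulVec x k) h1
  simp only [Matrix.mulVec_mulVec, Matrix.adjugate_mul, Matrix.smul_mulVec, Matrix.one_mulVec,
    Matrix.mulVec_smul, Pi.smul_apply, smul_eq_mul] at h2
  have h3 : M.det = form v * (C (v k)⁻¹ * (M.adjugate.mulVec q) k) := by
    have : C (v k)⁻¹ * C (v k) = (1 : MvPolynomial (Fin n) K) := by
      rw [← C_mul, inv_mul_cancel₀ hk, C_1]
    linear_combination C (v k)⁻¹ * h2 - M.det * this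
  exact ⟨_, h3⟩

theorem PairwiseIndep.prod_dvd_det (h : PairwiseIndep w s)
    {M : Matrix (Fin n) (Fin n) (MvPolynomial (Fin n) K)} (hM : ∀ k, IsLog w s (M k)) :
    ∏ i ∈ s, form (w i) ∣ M.det :=
  h.prod_dvd fun i hi => form_dvd_det (h.1 i hi) fun k => hM k i hi

theorem mem_logDer_iff {A : Arrangement K n} (hw : PairwiseIndep w s)
    (hA : A.planes = (fun i => plane (w i)) '' s)
    {θ : Derivation K (MvPolynomial (Fin n) K) (MvPolynomial (Fin n) K)} :
    θ ∈ A.logDer ↔ IsLog w s fun i => θ (X i) := by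
  constructor
  · intro h i hi
    rw [← derivation_form, ← Ideal.mem_span_singleton]
    exact h _ (hA ▸ ⟨i, hi, rfl⟩)
  · intro h v hv
    rw [hA] at hv
    obtain ⟨i, hi, hiv⟩ := hv
    rw [Ideal.mem_span_singleton, derivation_form]
    have hv' := hiv
    obtain ⟨k, rfl⟩ := (plane_le_plane_iff (hw.1 i hi)).mp hiv.le
    by_cases hk : k = 0
    · subst hk
      simp [pairing]
    rw [form_smul, smul_pairing]
    exact mul_dvd_mul_left _ (h i hi)

theorem logDer_sum_apply {A : Arrangement K n} {κ : Type*} (t : Finset κ)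
    (g : κ → MvPolynomial (Fin n) K) (b : κ → A.logDer) (f : MvPolynomial (Fin n) K) :
    ((∑ k ∈ t, g k • b k : A.logDer) : Derivation K (MvPolynomial (Fin n) K)
      (MvPolynomial (Fin n) K)) f = ∑ k ∈ t, g k * (b k : Derivation K (MvPolynomial (Fin n) K)
      (MvPolynomial (Fin n) K)) f := by
  classical
  induction t using Finset.induction_on with
  | empty => simp
  | insert a t ha ih => simp [Finset.sum_insert ha, ← ih]

/-- Saito's criterion: homogeneous logarithmic vector fields with nonzero determinant whose degrees
sum up to the number of hyperplanes form a basis. -/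
theorem isFreeWithExponents_of_det_ne_zero {A : Arrangement K n} (hw : PairwiseIndep w s)
    (hA : A.planes = (fun i => plane (w i)) '' s)
    {P : Matrix (Fin n) (Fin n) (MvPolynomial (Fin n) K)} (hP : ∀ k, IsLog w s (P k))
    {d : Fin n → ℕ} (hd : ∀ k j, (P k j).IsHomogeneous (d k)) (hdet : P.det ≠ 0)
    (hsum : ∑ k, d k = s.card) : A.IsFreeWithExponents d := by
  set Q := ∏ i ∈ s, form (w i) with hQ
  obtain ⟨c, hc, hcdet⟩ : ∃ c : K, c ≠ 0 ∧ P.det = Q * C c := by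
    obtain ⟨q, hq, h, -⟩ := exists_homogeneous_cofactor (isHomogeneous_det hd)
      (prod_form_isHomogeneous w s) (hw.prod_dvd_det hP)
    rw [hsum, Nat.sub_self] at hq
    have hq' := totalDegree_eq_zero_iff_eq_C.mp (Nat.le_zero.mp hq.totalDegree_le)
    refine ⟨coeff 0 q, ?_, by rw [h, ← hq']⟩
    intro h0
    rw [h0, C_0] at hq'
    rw [h, hq', mul_zero] at hdet
    exact hdet rfl
  let b : Fin n → A.logDer := fun k => ⟨mkDerivation K (P k),
    (mem_logDer_iff hw hA).mpr (by simpa using hP k)⟩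
  have hb : ∀ k j, ((b k : A.logDer) : Derivation K (MvPolynomial (Fin n) K)
      (MvPolynomial (Fin n) K)) (X j) = P k j := fun k j => mkDerivation_X K (P k) j
  have hli : LinearIndependent (MvPolynomial (Fin n) K) b := by
    rw [Fintype.linearIndependent_iffₛ]
    intro f g hfg
    have : Matrix.vecMul (f - g) P = 0 := by
      ext1 j
      have h := congrArg (fun θ : A.logDer =>
        (θ : Derivation K (MvPolynomial (Fin n) K) (MvPolynomial (Fin n) K)) (X j)) hfg
      simp only [logDer_sum_apply, hb] at h
      simpa [Matrix.vecMul, dotProduct, sub_mul, Finset.sum_sub_distrib, sub_eq_zero] using h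
    exact fun i => sub_eq_zero.mp (congrFun (Matrix.eq_zero_of_vecMul_eq_zero hdet this) i)
  have hspan : ⊤ ≤ Submodule.span (MvPolynomial (Fin n) K) (Set.range b) := by
    rintro ⟨ψ, hψ⟩ -
    set p : Fin n → MvPolynomial (Fin n) K := fun i => ψ (X i) with hp
    have hlog : IsLog w s p := (mem_logDer_iff hw hA).mp hψ
    have hdvd : ∀ k, Q ∣ (P.updateRow k p).det := fun k => hw.prod_dvd_det fun l => by
      by_cases hl : l = k
      · subst hl; simpa using hlog
      · simpa [hl] using hP l
    choose g hg using hdvd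
    have hcr := Matrix.mulVec_cramer P.transpose p
    have key : ∀ j, ψ (X j) = ∑ k, (C c⁻¹ * g k) * P k j := by
      intro j
      have h1 := congrFun hcr j
      simp only [Matrix.mulVec, dotProduct, Matrix.transpose_apply, Matrix.cramer_transpose_apply,
        Matrix.det_transpose, Pi.smul_apply, smul_eq_mul, hg, hcdet] at h1
      have hcc : C c⁻¹ * C c = (1 : MvPolynomial (Fin n) K) := by
        rw [← C_mul, inv_mul_cancel₀ hc, C_1]
      refine mul_left_cancel₀ (hw.prod_ne_zero) ?_
      calc Q * ψ (X j) = C c⁻¹ * (Q * C c * p j) := by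
            rw [hp]; linear_combination (-Q * ψ (X j)) * hcc
        _ = C c⁻¹ * ∑ k, P k j * (Q * g k) := by rw [h1]
        _ = Q * ∑ k, (C c⁻¹ * g k) * P k j := by
            simp only [Finset.mul_sum]
            exact Finset.sum_congr rfl fun k _ => by ring
    have : (⟨ψ, hψ⟩ : A.logDer) = ∑ k, (C c⁻¹ * g k) • b k := by
      apply Subtype.ext
      refine derivation_ext fun j => ?_
      rw [logDer_sum_apply]
      simpa only [hb] using key j
    rw [this]
    exact Submodule.sum_mem _ fun k _ => Submodule.smul_mem _ _ (Submodule.subset_span ⟨k, rfl⟩)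
  refine ⟨Module.Basis.mk hli hspan, fun i j => ?_⟩
  rw [Module.Basis.mk_apply, hb]
  exact hd i j

end Forms

/-! ### The converse of Saito's criterion -/

section SaitoConverse

variable {K : Type u} [Field K] {n : ℕ} {ι : Type v} {w : ι → Fin n → K} {s : Finset ι}

/-- A nonzero vector is a row of an invertible matrix. -/
theorem exists_matrix_row {v : Fin n → K} (hv : v ≠ 0) :
    ∃ (k : Fin n) (M : Matrix (Fin n) (Fin n) K), M k = v ∧ M.det ≠ 0 := by
  obtain ⟨k, hk⟩ := Function.ne_iff.mp hv
  refine ⟨k, (1 : Matrix (Fin n) (Fin n) K).updateRow k v, by simp, ?_⟩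
  have := Matrix.cramer_transpose_apply (1 : Matrix (Fin n) (Fin n) K) v k
  rw [← this]
  simpa using hk

/-- Around a hyperplane of the arrangement, there are logarithmic vector fields whose determinant
involves the form of that hyperplane only once. -/
theorem exists_isLog_det [DecidableEq ι] (hw : PairwiseIndep w s) {i : ι} (hi : i ∈ s) :
    ∃ R : Matrix (Fin n) (Fin n) (MvPolynomial (Fin n) K), (∀ k, IsLog w s (R k)) ∧
      ∃ c : K, c ≠ 0 ∧ R.det =
        (∏ j ∈ s, form (w j)) * (∏ j ∈ s.erase i, form (w j)) ^ (n - 1) * C c := by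
  obtain ⟨k, M, hMk, hM⟩ := exists_matrix_row (hw.1 i hi)
  set Q := ∏ j ∈ s, form (w j)
  set Q' := ∏ j ∈ s.erase i, form (w j)
  set e : Fin n → MvPolynomial (Fin n) K := fun j => if j = k then Q else Q'
  have hunit : IsUnit M.det := isUnit_iff_ne_zero.mpr hM
  refine ⟨Matrix.diagonal e * (M⁻¹.transpose.map C), fun j l hl => ?_, M⁻¹.det, ?_, ?_⟩
  · have hrow : (Matrix.diagonal e * (M⁻¹.transpose.map C) :
        Matrix (Fin n) (Fin n) (MvPolynomial (Fin n) K)) j = e j • fun a => C (M⁻¹ a j) := by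
      ext1 a
      simp [Matrix.diagonal_mul]
    rw [hrow, pairing_smul]
    by_cases hjk : j = k
    · simp only [e, hjk, if_pos]
      exact Dvd.dvd.mul_right (Finset.dvd_prod_of_mem _ hl) _
    · simp only [e, hjk, if_neg, not_false_iff]
      by_cases hli : l = i
      · have h0 : pairing (w l) (fun a => C (M⁻¹ a j)) = 0 := by
          have := congrFun (congrFun (Matrix.mul_nonsing_inv M hunit) k) j
          rw [Matrix.mul_apply, Matrix.one_apply_ne (Ne.symm hjk)] at this
          rw [hli, ← hMk]
          simp only [pairing, ← C_mul]
          rw [← map_sum, this, C_0]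
        rw [h0, mul_zero]
        exact dvd_zero _
      · exact Dvd.dvd.mul_right (Finset.dvd_prod_of_mem _ (Finset.mem_erase.mpr ⟨hli, hl⟩)) _
  · rw [Matrix.det_nonsing_inv]
    exact (hunit.ringInverse).ne_zero
  · have h1 : (M⁻¹.transpose.map C : Matrix _ _ (MvPolynomial (Fin n) K)).det = C M⁻¹.det := by
      rw [← Matrix.det_transpose M⁻¹]
      exact (RingHom.map_det (C : K →+* MvPolynomial (Fin n) K) _).symm
    rw [Matrix.det_mul, Matrix.det_diagonal, h1]
    congr 1
    rw [← Finset.mul_prod_erase Finset.univ e (Finset.mem_univ k)]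
    congr 1
    · simp [e]
    · rw [Finset.prod_congr rfl (g := fun _ => Q')]
      · simp
      · intro j hj
        simp [e, (Finset.mem_erase.mp hj).1]

/-- The degrees of a homogeneous basis of the module of logarithmic derivations sum up to the
number of hyperplanes. -/
theorem exists_isLog_of_isFree {A : Arrangement K n} (hw : PairwiseIndep w s)
    (hA : A.planes = (fun i => plane (w i)) '' s) (hs : s.Nonempty) (hfree : A.IsFree) :
    ∃ (P : Matrix (Fin n) (Fin n) (MvPolynomial (Fin n) K)) (d : Fin n → ℕ),
      (∀ k, IsLog w s (P k)) ∧ (∀ k j, (P k j).IsHomogeneous (d k)) ∧ P.det ≠ 0 ∧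
      ∑ k, d k = s.card := by
  classical
  obtain ⟨d, θ, hd⟩ := hfree
  set P : Matrix (Fin n) (Fin n) (MvPolynomial (Fin n) K) := Matrix.of fun k j =>
    (θ k : Derivation K (MvPolynomial (Fin n) K) (MvPolynomial (Fin n) K)) (X j) with hPdef
  have hP : ∀ k, IsLog w s (P k) := fun k => (mem_logDer_iff hw hA).mp (θ k).2
  have hdvd : ∀ R : Matrix (Fin n) (Fin n) (MvPolynomial (Fin n) K), (∀ k, IsLog w s (R k)) →
      P.det ∣ R.det := by
    intro R hR
    let r : Fin n → A.logDer := fun k => ⟨mkDerivation K (R k),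
      (mem_logDer_iff hw hA).mpr (by simpa using hR k)⟩
    have : R = Matrix.of (fun k i => θ.repr (r k) i) * P := by
      ext1 k j
      have h := congrArg (fun θ : A.logDer =>
        (θ : Derivation K (MvPolynomial (Fin n) K) (MvPolynomial (Fin n) K)) (X j))
        (θ.sum_repr (r k))
      simp only [logDer_sum_apply] at h
      rw [Matrix.mul_apply]
      simp only [Matrix.of_apply, hPdef]
      rw [h]
      exact (mkDerivation_X K (R k) j).symm
    rw [this, Matrix.det_mul]
    exact dvd_mul_left _ _
  have hQ0 := hw.prod_ne_zero
  obtain ⟨g, hg⟩ := hw.prod_dvd_det hP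
  have hgd : ∀ i ∈ s, g ∣ (∏ j ∈ s.erase i, form (w j)) ^ (n - 1) ∧ g ≠ 0 := by
    intro i hi
    obtain ⟨R, hR, c, hc, hdet⟩ := exists_isLog_det hw hi
    have h := hdvd R hR
    have hcu : IsUnit (C c : MvPolynomial (Fin n) K) := (isUnit_iff_ne_zero.mpr hc).map C
    rw [hdet, hg, mul_assoc] at h
    have h' := (mul_dvd_mul_iff_left hQ0).mp h
    refine ⟨(hcu.dvd_mul_right).mp h', fun h0 => ?_⟩
    rw [h0, zero_dvd_iff] at h'
    exact mul_ne_zero (pow_ne_zero _ (hw.mono (Finset.erase_subset i s)).prod_ne_zero)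
      hcu.ne_zero h'
  obtain ⟨i₀, hi₀⟩ := hs
  have hg0 := (hgd i₀ hi₀).2
  have hgu : IsUnit g := by
    by_contra hnu
    obtain ⟨p, hp, hpg⟩ := WfDvdMonoid.exists_irreducible_factor hnu hg0
    have hp' := hp.prime
    obtain ⟨i₁, hi₁, h1⟩ := hp'.exists_mem_finset_dvd
      (hp'.dvd_of_dvd_pow (hpg.trans (hgd i₀ hi₀).1))
    have hi₁s := Finset.mem_of_mem_erase hi₁
    obtain ⟨i₂, hi₂, h2⟩ := hp'.exists_mem_finset_dvd
      (hp'.dvd_of_dvd_pow (hpg.trans (hgd i₁ hi₁s).1))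
    have hass := hp.associated_of_dvd (form_prime (hw.1 i₁ hi₁s)).irreducible h1
    obtain ⟨k, hk⟩ := (form_dvd_form_iff (hw.1 i₁ hi₁s)).mp (hass.symm.dvd.trans h2)
    exact hw.2 i₁ hi₁s i₂ (Finset.mem_of_mem_erase hi₂) (Finset.ne_of_mem_erase hi₂).symm k hk
  have hdet0 : P.det ≠ 0 := by rw [hg]; exact mul_ne_zero hQ0 hg0
  refine ⟨P, d, hP, fun k j => hd k j, hdet0, ?_⟩
  have h1 : P.det.totalDegree = ∑ k, d k :=
    (isHomogeneous_det (M := P) (d := d) fun k j => hd k j).totalDegree hdet0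
  have h2 : P.det.totalDegree = s.card := by
    rw [hg, totalDegree_mul_of_isDomain hQ0 hg0,
      (prod_form_isHomogeneous w s).totalDegree hQ0,
      (isUnit_iff_totalDegree_of_isReduced.mp hgu).2, add_zero]
  rw [← h1, h2]

end SaitoConverse

/-! ### Determinants of three vectors -/

section Det3

/-- The determinant of the matrix with rows `u`, `v`, `w`, written out so that it can be evaluated
in the kernel. -/
def det3 {R : Type*} [CommRing R] (u v w : Fin 3 → R) : R :=
  u 0 * (v 1 * w 2 - v 2 * w 1) - u 1 * (v 0 * w 2 - v 2 * w 0) + u 2 * (v 0 * w 1 - v 1 * w 0)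

theorem det_of_fin_three {R : Type*} [CommRing R] (M : Matrix (Fin 3) (Fin 3) R) :
    M.det = det3 (M 0) (M 1) (M 2) := by
  rw [Matrix.det_fin_three, det3]; ring

theorem map_det3 {R S : Type*} [CommRing R] [CommRing S] (f : R →+* S) (u v w : Fin 3 → R) :
    det3 (fun i => f (u i)) (fun i => f (v i)) (fun i => f (w i)) = f (det3 u v w) := by
  simp [det3]

variable {K : Type u} [Field K]

/-- A vector in the span of two independent vectors is detected by a determinant. -/
theorem exists_eq_add_of_det3_eq_zero {u v w : Fin 3 → K} (hu : u ≠ 0)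
    (huv : ∀ k : K, v ≠ k • u) (h : det3 u v w = 0) : ∃ a b : K, w = a • u + b • v := by
  have key : ∃ i j : Fin 3, u i * v j - u j * v i ≠ 0 := by
    by_contra! hc
    obtain ⟨i, hi⟩ := Function.ne_iff.mp hu
    have hi' : u i ≠ 0 := hi
    apply huv (v i / u i)
    ext j
    simp only [Pi.smul_apply, smul_eq_mul]
    field_simp
    linear_combination hc i j
  obtain ⟨i, j, hij⟩ := key
  refine ⟨(w i * v j - w j * v i) / (u i * v j - u j * v i),
    (u i * w j - u j * w i) / (u i * v j - u j * v i), ?_⟩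
  have hd : ∀ l : Fin 3, w l * (u i * v j - u j * v i) =
      (w i * v j - w j * v i) * u l + (u i * w j - u j * w i) * v l := by
    intro l
    simp only [det3] at h
    fin_cases i <;> fin_cases j <;> fin_cases l <;> simp at hij ⊢ <;>
      first | ring1 | linear_combination h | linear_combination -h
  ext l
  have := hd l
  simp only [Pi.add_apply, Pi.smul_apply, smul_eq_mul]
  rw [div_mul_eq_mul_div, div_mul_eq_mul_div, ← add_div, eq_div_iff hij]
  exact this

theorem det3_ne_zero_left {u v w : Fin 3 → K} (h : det3 u v w ≠ 0) : u ≠ 0 := by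
  rintro rfl; simp [det3] at h

theorem exists_det3_ne_zero {v : Fin 3 → K} (hv : v ≠ 0) : ∃ p q, det3 p q v ≠ 0 := by
  by_contra! h
  apply hv
  have h0 := h ![0, 1, 0] ![0, 0, 1]
  have h1 := h ![0, 0, 1] ![1, 0, 0]
  have h2 := h ![1, 0, 0] ![0, 1, 0]
  simp [det3] at h0 h1 h2
  ext i
  fin_cases i <;> simp [h0, h1, h2]

end Det3

/-! ### Restriction to a plane -/

section Restriction

variable {K : Type u} [Field K] (p q v : Fin 3 → K)

/-- The coordinates of the restriction of the linear form `w` to the plane of `v`, with respect to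
the restrictions of `p` and `q`. -/
def resVec (w : Fin 3 → K) : Fin 2 → K :=
  ![(det3 p q v)⁻¹ * det3 w q v, (det3 p q v)⁻¹ * det3 p w v]

/-- Restriction of polynomials to the plane of `v`, where `p` and `q` serve as coordinates. -/
def res : MvPolynomial (Fin 3) K →ₐ[K] MvPolynomial (Fin 2) K :=
  aeval fun j => form (resVec p q v (Pi.single j 1))

/-- The section of the restriction map that is defined by the coordinates `p` and `q`. -/
def resLift : MvPolynomial (Fin 2) K →ₐ[K] MvPolynomial (Fin 3) K :=
  aeval ![form p, form q]

variable {p q v}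

theorem res_form (w : Fin 3 → K) : res p q v (form w) = form (resVec p q v w) := by
  simp only [form, res, Fin.sum_univ_three,
    Fin.sum_univ_two, resVec, det3]
  simp [Pi.single_apply]
  ring

theorem eq_add_of_resVec (h : det3 p q v ≠ 0) (w : Fin 3 → K) :
    w = resVec p q v w 0 • p + resVec p q v w 1 • q + ((det3 p q v)⁻¹ * det3 p q w) • v := by
  ext i
  simp only [resVec, Pi.add_apply, Pi.smul_apply, smul_eq_mul, Matrix.cons_val_zero,
    Matrix.cons_val_one]
  have : det3 p q v * w i = det3 w q v * p i + det3 p w v * q i + det3 p q w * v i := by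
    simp only [det3]; fin_cases i <;> simp <;> ring
  field_simp
  linear_combination this

theorem resVec_minor (h : det3 p q v ≠ 0) (w w' : Fin 3 → K) :
    resVec p q v w 0 * resVec p q v w' 1 - resVec p q v w 1 * resVec p q v w' 0 =
      (det3 p q v)⁻¹ * det3 v w w' := by
  simp only [resVec, Matrix.cons_val_zero, Matrix.cons_val_one]
  field_simp
  simp only [det3]; ring

theorem resVec_ne_zero (h : det3 p q v ≠ 0) {w : Fin 3 → K} (hw : ∀ k : K, w ≠ k • v) :
    resVec p q v w ≠ 0 := by
  intro h0
  have := eq_add_of_resVec h w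
  rw [h0] at this
  simp only [Pi.zero_apply, zero_smul, zero_add] at this
  exact hw _ this

theorem res_isHomogeneous {f : MvPolynomial (Fin 3) K} {d : ℕ} (hf : f.IsHomogeneous d) :
    (res p q v f).IsHomogeneous d := by
  have := hf.aeval (n := 1) (fun j => form (resVec p q v (Pi.single j 1)))
    fun i => form_isHomogeneous _
  rwa [one_mul] at this

theorem resLift_isHomogeneous {f : MvPolynomial (Fin 2) K} {d : ℕ} (hf : f.IsHomogeneous d) :
    (resLift p q f).IsHomogeneous d := by
  have := hf.aeval (n := 1) ![form p, form q] fun i => by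
    fin_cases i
    · exact form_isHomogeneous p
    · exact form_isHomogeneous q
  rwa [one_mul] at this

theorem resLift_form (x : Fin 2 → K) :
    resLift p q (form x) = form (x 0 • p + x 1 • q) := by
  have h : form x = C (x 0) * X 0 + C (x 1) * X 1 := by simp [form]
  rw [h, form_add, form_smul, form_smul]
  simp [resLift, algHom_C]

theorem form_dvd_sub_resLift (h : det3 p q v ≠ 0) (f : MvPolynomial (Fin 3) K) :
    form v ∣ f - resLift p q (res p q v f) := by
  induction f using MvPolynomial.induction_on with
  | C a => simp [algHom_C]
  | add f g hf hg =>
    simp only [map_add]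
    have := dvd_add hf hg
    convert this using 1; ring
  | mul_X f j hf =>
    have hj : (X j : MvPolynomial (Fin 3) K) - resLift p q (res p q v (X j)) =
        C ((det3 p q v)⁻¹ * det3 p q (Pi.single j 1)) * form v := by
      have hX : (X j : MvPolynomial (Fin 3) K) = form (Pi.single j 1) := by
        simp [form, Pi.single_apply]
      have h2 := congrArg form (eq_add_of_resVec h (Pi.single j 1))
      rw [hX, res_form, ← form_smul, resLift_form]
      nth_rewrite 1 [h2]
      rw [form_add]
      ring
    have : f * X j - resLift p q (res p q v (f * X j)) =
        (f - resLift p q (res p q v f)) * X j +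
        resLift p q (res p q v f) * (X j - resLift p q (res p q v (X j))) := by
      simp only [map_mul]; ring
    rw [this, hj]
    exact dvd_add (Dvd.dvd.mul_right hf _) ((dvd_mul_left _ _).mul_left _)

theorem resVec_self : resVec p q v v = 0 := by
  ext i
  fin_cases i
  · simp [resVec, det3]; right; ring
  · simp [resVec, det3]; right; ring

theorem res_form_self : res p q v (form v) = 0 := by
  rw [res_form, resVec_self]; simp [form]

theorem res_eq_zero_iff (h : det3 p q v ≠ 0) {f : MvPolynomial (Fin 3) K} :
    res p q v f = 0 ↔ form v ∣ f := by
  constructor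
  · intro hf
    simpa [hf] using form_dvd_sub_resLift h f
  · rintro ⟨g, rfl⟩
    rw [map_mul, res_form_self, zero_mul]

theorem res_resLift (h : det3 p q v ≠ 0) (f : MvPolynomial (Fin 2) K) :
    res p q v (resLift p q f) = f := by
  have : (res p q v).comp (resLift p q) = AlgHom.id K _ := by
    refine algHom_ext fun i => ?_
    have hp : resVec p q v p = ![1, 0] := by
      simp only [resVec]
      rw [inv_mul_cancel₀ h]; simp [det3]; right; ring
    have hq : resVec p q v q = ![0, 1] := by
      simp only [resVec]
      rw [inv_mul_cancel₀ h]; simp [det3]; right; ring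
    fin_cases i
    · have : resLift p q (X 0) = form p := by simp [resLift]
      simp only [AlgHom.comp_apply, Fin.zero_eta, this, res_form, hp, AlgHom.id_apply]
      simp [form]
    · have : resLift p q (X 1) = form q := by simp [resLift]
      simp only [AlgHom.comp_apply, Fin.mk_one, this, res_form, hq, AlgHom.id_apply]
      simp [form]
  exact congrArg (fun g => g f) this

theorem isRelPrime_res (h : det3 p q v ≠ 0) {w w' : Fin 3 → K} (hww : det3 v w w' ≠ 0) :
    IsRelPrime (form (resVec p q v w)) (form (resVec p q v w')) := by
  have hw0 : resVec p q v w ≠ 0 := by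
    intro h0
    have := resVec_minor h w w'
    rw [h0] at this
    simp [h, hww] at this
  rw [(form_prime hw0).irreducible.isRelPrime_iff_not_dvd, form_dvd_form_iff hw0]
  rintro ⟨k, hk⟩
  have := resVec_minor h w w'
  rw [hk] at this
  have h2 : (det3 p q v)⁻¹ * det3 v w w' ≠ 0 := mul_ne_zero (inv_ne_zero h) hww
  apply h2
  rw [← this]
  simp only [Pi.smul_apply, smul_eq_mul]; ring

/-- The coefficient of the wedge product of the Euler field and `P`, restricted to the plane
of `v`. -/
def resWedge (p q v : Fin 3 → K) (P : Fin 3 → MvPolynomial (Fin 3) K) : MvPolynomial (Fin 2) K :=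
  X 0 * res p q v (pairing q P) - X 1 * res p q v (pairing p P)

theorem resWedge_isHomogeneous {P : Fin 3 → MvPolynomial (Fin 3) K} {d : ℕ}
    (hP : ∀ i, (P i).IsHomogeneous d) : (resWedge p q v P).IsHomogeneous (1 + d) :=
  ((isHomogeneous_X K 0).mul (res_isHomogeneous (pairing_isHomogeneous hP))).sub
    ((isHomogeneous_X K 1).mul (res_isHomogeneous (pairing_isHomogeneous hP)))

theorem form_dvd_resWedge (h : det3 p q v ≠ 0) {w : Fin 3 → K} (hw : ∀ k : K, w ≠ k • v)
    {P : Fin 3 → MvPolynomial (Fin 3) K} (hv : form v ∣ pairing v P)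
    (hwP : form w ∣ pairing w P) : form (resVec p q v w) ∣ resWedge p q v P := by
  have hne := resVec_ne_zero h hw
  obtain ⟨t, ht⟩ := hwP
  have h1 := congrArg (res p q v) ht
  have h2 := congrArg (fun x => res p q v (pairing x P)) (eq_add_of_resVec h w)
  simp only [add_pairing, smul_pairing, map_add, map_mul, algHom_C, algebraMap_eq,
    (res_eq_zero_iff h).mpr hv, mul_zero, add_zero] at h2
  rw [h2, map_mul, res_form] at h1
  set a := resVec p q v w 0
  set b := resVec p q v w 1
  have hform : form (resVec p q v w) = C a * X 0 + C b * X 1 := by simp [form, a, b]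
  set A := res p q v (pairing p P)
  set B := res p q v (pairing q P)
  have ha : form (resVec p q v w) ∣ C a * resWedge p q v P :=
    ⟨B - X 1 * res p q v t, by
      rw [hform] at h1 ⊢; simp only [resWedge]; linear_combination (-X 1) * h1⟩
  have hb : form (resVec p q v w) ∣ C b * resWedge p q v P :=
    ⟨X 0 * res p q v t - A, by
      rw [hform] at h1 ⊢; simp only [resWedge]; linear_combination (X 0) * h1⟩
  obtain ⟨i, hi⟩ := Function.ne_iff.mp hne
  have hcu : ∀ c : K, c ≠ 0 → IsUnit (C c : MvPolynomial (Fin 2) K) := fun c hc =>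
    (isUnit_iff_ne_zero.mpr hc).map C
  fin_cases i
  · exact ((hcu a hi).dvd_mul_left).mp ha
  · exact ((hcu b hi).dvd_mul_left).mp hb

/-- A vector field that is tangent to a plane and has low degree is proportional to the Euler field
on that plane if it is tangent to many planes with distinct traces. -/
theorem resWedge_eq_zero {ι : Type v} (h : det3 p q v ≠ 0) {w : ι → Fin 3 → K} {s : Finset ι}
    {P : Fin 3 → MvPolynomial (Fin 3) K} {d : ℕ} (hd : ∀ i, (P i).IsHomogeneous d)
    (hv : form v ∣ pairing v P) (hP : IsLog w s P) (hw : ∀ i ∈ s, ∀ k : K, w i ≠ k • v)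
    (hpair : ∀ i ∈ s, ∀ j ∈ s, i ≠ j → det3 v (w i) (w j) ≠ 0) (hs : 1 + d < s.card) :
    resWedge p q v P = 0 := by
  refine eq_zero_of_dvd_of_degree_lt (resWedge_isHomogeneous hd)
    (prod_form_isHomogeneous (fun i => resVec p q v (w i)) s) ?_ hs
  refine Finset.prod_dvd_of_isRelPrime (fun i hi j hj hij => isRelPrime_res h (hpair i hi j hj hij))
    fun i hi => form_dvd_resWedge h (hw i hi) hv (hP i hi)

/-- Multiplicativity of determinants: the three derivations `E`, `P`, `Q` are evaluated on the forms
of the basis `p`, `q`, `v`. -/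
theorem C_det3_mul_det3 (p q v : Fin 3 → K) (E P Q : Fin 3 → MvPolynomial (Fin 3) K) :
    C (det3 p q v) * det3 E P Q = det3 ![pairing p E, pairing q E, pairing v E]
      ![pairing p P, pairing q P, pairing v P] ![pairing p Q, pairing q Q, pairing v Q] := by
  simp only [det3, pairing, Fin.sum_univ_three, Matrix.cons_val_zero, Matrix.cons_val_one,
    Matrix.cons_val, map_add, map_mul, map_sub]
  ring

theorem form_dvd_det3_of_resWedge (h : det3 p q v ≠ 0) {P : Fin 3 → MvPolynomial (Fin 3) K}
    (hv : form v ∣ pairing v P) (hP : resWedge p q v P = 0)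
    (Q : Fin 3 → MvPolynomial (Fin 3) K) : form v ∣ det3 X P Q := by
  have hcu : IsUnit (C (det3 p q v) : MvPolynomial (Fin 3) K) :=
    (isUnit_iff_ne_zero.mpr h).map C
  rw [← hcu.dvd_mul_left, C_det3_mul_det3, ← res_eq_zero_iff h]
  have hp : res p q v (form p) = X 0 := by
    simpa [resLift] using res_resLift h (X 0)
  have hq : res p q v (form q) = X 1 := by
    simpa [resLift] using res_resLift h (X 1)
  rw [resWedge] at hP
  simp only [det3, Matrix.cons_val_zero, Matrix.cons_val_one, Matrix.cons_val, map_add, map_mul,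
    map_sub, pairing_X, hp, hq, res_form_self, (res_eq_zero_iff h).mpr hv]
  linear_combination res p q v (pairing v Q) * hP

end Restriction

/-! ### Adding and deleting planes -/

section AddDelete

variable {K : Type u} [Field K] {ι : Type v} {w : ι → Fin 3 → K} {s : Finset ι}

/-- The arrangement with normals `wᵢ`, `i ∈ s`, is free with exponents `(1, a, b)`, where the Euler
field is one of the basis elements. -/
def HasExps (w : ι → Fin 3 → K) (s : Finset ι) (a b : ℕ) : Prop :=
  ∃ P Q : Fin 3 → MvPolynomial (Fin 3) K, IsLog w s P ∧ IsLog w s Q ∧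
    (∀ i, (P i).IsHomogeneous a) ∧ (∀ i, (Q i).IsHomogeneous b) ∧ det3 X P Q ≠ 0 ∧
    s.card = 1 + a + b

theorem det3_swap {R : Type*} [CommRing R] (u v w : Fin 3 → R) : det3 u w v = -det3 u v w := by
  simp only [det3]; ring

theorem HasExps.symm {a b : ℕ} (h : HasExps w s a b) : HasExps w s b a := by
  obtain ⟨P, Q, hP, hQ, hPa, hQb, h0, hc⟩ := h
  exact ⟨Q, P, hQ, hP, hQb, hPa, by rw [det3_swap]; exact neg_ne_zero.mpr h0, by omega⟩

theorem isHomogeneous_det3 {E P Q : Fin 3 → MvPolynomial (Fin 3) K} {a b c : ℕ}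
    (hE : ∀ i, (E i).IsHomogeneous a) (hP : ∀ i, (P i).IsHomogeneous b)
    (hQ : ∀ i, (Q i).IsHomogeneous c) : (det3 E P Q).IsHomogeneous (a + b + c) := by
  have h := isHomogeneous_det (M := Matrix.of ![E, P, Q]) (d := ![a, b, c]) (by
    intro i j
    fin_cases i
    · exact hE j
    · exact hP j
    · exact hQ j)
  rw [det_of_fin_three] at h
  have hs : ∑ i, ![a, b, c] i = a + b + c := by simp [Fin.sum_univ_three]
  rwa [hs] at h

theorem PairwiseIndep.prod_dvd_det3 (h : PairwiseIndep w s)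
    {E P Q : Fin 3 → MvPolynomial (Fin 3) K} (hE : IsLog w s E) (hP : IsLog w s P)
    (hQ : IsLog w s Q) : ∏ i ∈ s, form (w i) ∣ det3 E P Q := by
  have := h.prod_dvd_det (M := Matrix.of ![E, P, Q]) (by
    intro k
    fin_cases k
    · exact hE
    · exact hP
    · exact hQ)
  rwa [det_of_fin_three] at this

theorem form_dvd_det3 {v : Fin 3 → K} (hv : v ≠ 0)
    {E P Q : Fin 3 → MvPolynomial (Fin 3) K} (hE : form v ∣ pairing v E)
    (hP : form v ∣ pairing v P) (hQ : form v ∣ pairing v Q) : form v ∣ det3 E P Q := by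
  have := form_dvd_det hv (M := Matrix.of ![E, P, Q]) (by
    intro k
    fin_cases k
    · exact hE
    · exact hP
    · exact hQ)
  rwa [det_of_fin_three] at this

theorem HasExps.isFreeWithExponents {a b : ℕ} (h : HasExps w s a b) (hw : PairwiseIndep w s)
    {A : Arrangement K 3} (hA : A.planes = (fun i => plane (w i)) '' s) :
    A.IsFreeWithExponents ![1, a, b] := by
  obtain ⟨P, Q, hP, hQ, hPa, hQb, h0, hc⟩ := h
  refine isFreeWithExponents_of_det_ne_zero hw hA (P := Matrix.of ![X, P, Q]) ?_ ?_ ?_ ?_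
  · intro k
    fin_cases k
    · exact isLog_X
    · exact hP
    · exact hQ
  · intro k j
    fin_cases k
    · exact isHomogeneous_X K j
    · exact hPa j
    · exact hQb j
  · rw [det_of_fin_three]; exact h0
  · simp [Fin.sum_univ_three, hc]

/-- The form of a new plane is prime to the product of the forms of the arrangement. -/
theorem form_mul_prod_dvd {v : Fin 3 → K} (hv : v ≠ 0)
    (hvs : ∀ i ∈ s, ∀ k : K, w i ≠ k • v) {f : MvPolynomial (Fin 3) K} (h1 : form v ∣ f)
    (h2 : ∏ i ∈ s, form (w i) ∣ f) : form v * ∏ i ∈ s, form (w i) ∣ f := by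
  refine IsRelPrime.mul_dvd ?_ h1 h2
  refine IsRelPrime.prod_right fun i hi => ?_
  rw [(form_prime hv).irreducible.isRelPrime_iff_not_dvd, form_dvd_form_iff hv]
  rintro ⟨k, hk⟩
  exact hvs i hi k hk

/-- Traces on the plane of `v`: a choice `r` of a representative for every trace of a plane of the
arrangement. -/
structure IsTraceChoice (w : ι → Fin 3 → K) (s : Finset ι) (v : Fin 3 → K) (r : ι → ι) :
    Prop where
  mem : ∀ i ∈ s, r i ∈ s
  rel : ∀ i ∈ s, det3 v (w i) (w (r i)) = 0
  idem : ∀ i ∈ s, r (r i) = r i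
  sep : ∀ i ∈ s, ∀ j ∈ s, r i ≠ r j → det3 v (w (r i)) (w (r j)) ≠ 0

variable {v : Fin 3 → K} {r : ι → ι}

theorem IsTraceChoice.det3_ne_zero {p q : Fin 3 → K} (hr : IsTraceChoice w s v r)
    (h : det3 p q v ≠ 0) (hvs : ∀ i ∈ s, ∀ k : K, w i ≠ k • v) {i j : ι} (hi : i ∈ s) (hj : j ∈ s)
    (hij : r i ≠ r j) : det3 v (w i) (w j) ≠ 0 := by
  -- the restrictions of `w i` and `w (r i)` are proportional
  have hprop : ∀ i ∈ s, ∃ k : K, resVec p q v (w (r i)) = k • resVec p q v (w i) := by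
    intro i hi
    have hne := resVec_ne_zero h (hvs i hi)
    have hm := resVec_minor h (w i) (w (r i))
    rw [hr.rel i hi, mul_zero] at hm
    obtain ⟨l, hl⟩ := Function.ne_iff.mp hne
    have hl' : resVec p q v (w i) l ≠ 0 := hl
    refine ⟨resVec p q v (w (r i)) l / resVec p q v (w i) l, ?_⟩
    ext m
    simp only [Pi.smul_apply, smul_eq_mul]
    rw [div_mul_eq_mul_div, eq_div_iff hl']
    fin_cases l <;> fin_cases m <;> simp only [Fin.zero_eta, Fin.mk_one] <;>
      first | ring1 | linear_combination hm | linear_combination -hm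
  obtain ⟨k, hk⟩ := hprop i hi
  obtain ⟨l, hl⟩ := hprop j hj
  intro h0
  have hm := resVec_minor h (w (r i)) (w (r j))
  have hm' := resVec_minor h (w i) (w j)
  rw [h0, mul_zero] at hm'
  rw [hk, hl] at hm
  apply mul_ne_zero (inv_ne_zero h) (hr.sep i hi j hj hij)
  rw [← hm]
  simp only [Pi.smul_apply, smul_eq_mul]
  linear_combination k * l * hm'

/-- Terao's polynomial: on the plane of `v`, the value on `v` of a vector field that is tangent to
the arrangement is divisible by the traces that do not represent their class. -/
theorem IsTraceChoice.prod_dvd_res [DecidableEq ι] {p q : Fin 3 → K}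
    (hr : IsTraceChoice w s v r) (hw : PairwiseIndep w s) (h : det3 p q v ≠ 0) (hv : v ≠ 0)
    (hvs : ∀ i ∈ s, ∀ k : K, w i ≠ k • v) {P : Fin 3 → MvPolynomial (Fin 3) K}
    (hP : IsLog w s P) :
    ∏ i ∈ s with r i ≠ i, form (resVec p q v (w i)) ∣ res p q v (pairing v P) := by
  rw [← Finset.prod_fiberwise_of_maps_to (t := s.image r) (g := r)
    fun i hi => Finset.mem_image_of_mem r (Finset.mem_of_mem_filter i hi)]
  refine Finset.prod_dvd_of_isRelPrime ?_ ?_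
  · intro t _ t' _ htt
    refine IsRelPrime.prod_left fun i hi => IsRelPrime.prod_right fun j hj => ?_
    simp only [Finset.mem_filter] at hi hj
    exact isRelPrime_res h
      (hr.det3_ne_zero h hvs hi.1.1 hj.1.1 (by rw [hi.2, hj.2]; exact htt))
  · intro t ht
    obtain ⟨i₀, hi₀, rfl⟩ := Finset.mem_image.mp ht
    set t := r i₀
    have hts : t ∈ s := hr.mem _ hi₀
    obtain ⟨f, hf⟩ := hP t hts
    -- all planes of the class divide `pairing v P - f * form v`
    have hdvd : ∏ i ∈ (s.filter fun i => r i ≠ i).filter (fun i => r i = t), form (w i) ∣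
        pairing v P - f * form v := by
      refine (hw.mono ((Finset.filter_subset _ _).trans (Finset.filter_subset _ _))).prod_dvd
        fun i hi => ?_
      simp only [Finset.mem_filter] at hi
      obtain ⟨⟨his, hri⟩, hit⟩ := hi
      have hrel : det3 v (w t) (w i) = 0 := by
        have := hr.rel i his
        rw [hit] at this
        rw [det3_swap, this, neg_zero]
      obtain ⟨b, a, hab⟩ := exists_eq_add_of_det3_eq_zero hv (hvs t hts) hrel
      have hb : b ≠ 0 := by
        rintro rfl
        rw [zero_smul, zero_add] at hab
        exact hw.2 t hts i his (by rintro rfl; exact hri hit) a hab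
      have h1 := hP i his
      have h2 : C b * (pairing v P - f * form v) =
          pairing (w i) P - f * form (w i) := by
        rw [hab, add_pairing, smul_pairing, smul_pairing, hf, form_add, form_smul, form_smul]
        ring
      have hcu : IsUnit (C b : MvPolynomial (Fin 3) K) := (isUnit_iff_ne_zero.mpr hb).map C
      rw [← hcu.dvd_mul_left, h2]
      exact dvd_sub h1 (dvd_mul_left _ _)
    have := map_dvd (res p q v) hdvd
    rwa [map_sub, map_mul, res_form_self, mul_zero, sub_zero, map_prod,
      Finset.prod_congr rfl fun i _ => res_form (w i)] at this

theorem IsTraceChoice.card_filter [DecidableEq ι] (hr : IsTraceChoice w s v r) :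
    (s.filter fun i => r i ≠ i).card + (s.image r).card = s.card := by
  have : s.image r = s.filter fun i => r i = i := by
    ext i
    simp only [Finset.mem_image, Finset.mem_filter]
    constructor
    · rintro ⟨j, hj, rfl⟩
      exact ⟨hr.mem j hj, hr.idem j hj⟩
    · rintro ⟨hi, hri⟩
      exact ⟨i, hi, hri⟩
  rw [this, add_comm, Finset.card_filter_add_card_filter_not]

theorem det3_smul_right {R : Type*} [CommRing R] (u v w : Fin 3 → R) (c : R) :
    det3 u v (c • w) = c * det3 u v w := by
  simp only [det3, Pi.smul_apply, smul_eq_mul]; ring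

theorem det3_combination {R : Type*} [CommRing R] (u v w : Fin 3 → R) (a b : R) :
    det3 u (a • v - b • w) w = a * det3 u v w := by
  simp only [det3, Pi.smul_apply, Pi.sub_apply, smul_eq_mul]; ring

/-- The addition theorem for plane arrangements. -/
theorem HasExps.insert_plane [DecidableEq ι] {a b : ℕ} {i : ι} (h : HasExps w s a b)
    (hi : i ∉ s) (hw : PairwiseIndep w (insert i s)) (hr : IsTraceChoice w s (w i) r)
    (hcard : (s.image r).card = 1 + a) : HasExps w (insert i s) a (b + 1) := by
  obtain ⟨P, Q, hP, hQ, hPa, hQb, h0, hc⟩ := h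
  have hws := hw.mono (Finset.subset_insert i s)
  have hv : w i ≠ 0 := hw.1 i (Finset.mem_insert_self i s)
  have hvs : ∀ j ∈ s, ∀ k : K, w j ≠ k • w i := fun j hj =>
    hw.2 i (Finset.mem_insert_self i s) j (Finset.mem_insert_of_mem hj)
      (by rintro rfl; exact hi hj)
  obtain ⟨p, q, hpq⟩ := exists_det3_ne_zero hv
  have hcf := hr.card_filter
  have hdegB : (∏ j ∈ s with r j ≠ j, form (resVec p q (w i) (w j))).IsHomogeneous b := by
    have := prod_form_isHomogeneous (fun j => resVec p q (w i) (w j)) (s.filter fun j => r j ≠ j)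
    rwa [show (s.filter fun j => r j ≠ j).card = b by omega] at this
  set B := ∏ j ∈ s with r j ≠ j, form (resVec p q (w i) (w j)) with hB
  obtain ⟨f, hf, hPf, hf0⟩ := exists_homogeneous_cofactor
    (res_isHomogeneous (p := p) (q := q) (v := w i) (pairing_isHomogeneous (v := w i) hPa)) hdegB
    (hr.prod_dvd_res hws hpq hv hvs hP)
  obtain ⟨g, hg, hQg, -⟩ := exists_homogeneous_cofactor
    (res_isHomogeneous (p := p) (q := q) (v := w i) (pairing_isHomogeneous (v := w i) hQb)) hdegB
    (hr.prod_dvd_res hws hpq hv hvs hQ)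
  have hdeg : (det3 X P Q).IsHomogeneous s.card := by
    rw [hc]; exact isHomogeneous_det3 (isHomogeneous_X K) hPa hQb
  -- a determinant that is divisible by all forms vanishes
  have hnot : ¬ form (w i) ∣ det3 X P Q := by
    intro hd
    apply h0
    refine eq_zero_of_dvd_of_degree_lt hdeg
      ((form_isHomogeneous (w i)).mul (prod_form_isHomogeneous w s))
      (form_mul_prod_dvd hv hvs hd (hws.prod_dvd_det3 isLog_X hP hQ)) (by omega)
  have hlog : ∀ {R : Fin 3 → MvPolynomial (Fin 3) K}, IsLog w s R →
      form (w i) ∣ pairing (w i) R → IsLog w (insert i s) R := by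
    intro R hR hRi j hj
    rcases Finset.mem_insert.mp hj with rfl | hj
    · exact hRi
    · exact hR j hj
  have hlog' : ∀ {R : Fin 3 → MvPolynomial (Fin 3) K}, IsLog w s R →
      IsLog w (insert i s) (form (w i) • R) := fun {R} hR =>
    hlog (fun j hj => by rw [pairing_smul]; exact Dvd.dvd.mul_left (hR j hj) _)
      (by rw [pairing_smul]; exact dvd_mul_right _ _)
  have hhom : ∀ {R : Fin 3 → MvPolynomial (Fin 3) K} {d : ℕ}, (∀ j, (R j).IsHomogeneous d) →
      ∀ j, ((form (w i) • R) j).IsHomogeneous (d + 1) := fun {R} {d} hR j => by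
    rw [add_comm]; exact (form_isHomogeneous (w i)).mul (hR j)
  have hins : (insert i s).card = s.card + 1 := Finset.card_insert_of_notMem hi
  rw [Nat.sub_self] at hg
  have hgC := totalDegree_eq_zero_iff_eq_C.mp (Nat.le_zero.mp hg.totalDegree_le)
  set c := coeff 0 g
  by_cases hc0 : c = 0
  · -- `Q` is tangent to the new plane
    have hQi : form (w i) ∣ pairing (w i) Q := by
      rw [← res_eq_zero_iff hpq, hQg, hgC, hc0, C_0, mul_zero]
    have hab : b ≤ a := by
      by_contra hlt
      push Not at hlt
      apply hnot
      have hPi : form (w i) ∣ pairing (w i) P := by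
        rw [← res_eq_zero_iff hpq, hPf, hf0 hlt, mul_zero]
      exact form_dvd_det3 hv dvd_rfl hPi hQi
    rcases hab.eq_or_lt with rfl | hlt
    · refine ⟨Q, form (w i) • P, hlog hQ hQi, hlog' hP, hQb, hhom hPa, ?_, by omega⟩
      rw [det3_smul_right, det3_swap]
      exact mul_ne_zero (form_ne_zero hv) (neg_ne_zero.mpr h0)
    · exfalso
      have hwedge : resWedge p q (w i) Q = 0 := by
        refine resWedge_eq_zero (s := s.image r) hpq hQb hQi (hQ.mono ?_) ?_ ?_ (by omega)
        · intro j hj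
          obtain ⟨l, hl, rfl⟩ := Finset.mem_image.mp hj
          exact hr.mem l hl
        · intro j hj
          obtain ⟨l, hl, rfl⟩ := Finset.mem_image.mp hj
          exact hvs _ (hr.mem l hl)
        · intro j hj j' hj' hne
          obtain ⟨l, hl, rfl⟩ := Finset.mem_image.mp hj
          obtain ⟨l', hl', rfl⟩ := Finset.mem_image.mp hj'
          exact hr.sep l hl l' hl' hne
      apply hnot
      rw [← dvd_neg, ← det3_swap]
      exact form_dvd_det3_of_resWedge hpq hQi hwedge P
  · refine ⟨(C c : MvPolynomial (Fin 3) K) • P - resLift p q f • Q, form (w i) • Q,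
      hlog ?_ ?_, hlog' hQ, ?_, hhom hQb, ?_, by omega⟩
    · intro j hj
      rw [pairing_sub, pairing_smul, pairing_smul]
      exact dvd_sub (Dvd.dvd.mul_left (hP j hj) _) (Dvd.dvd.mul_left (hQ j hj) _)
    · rw [← res_eq_zero_iff hpq, pairing_sub, pairing_smul, pairing_smul, map_sub, map_mul,
        map_mul, res_resLift hpq, algHom_C, algebraMap_eq, hPf, hQg, hgC]
      ring
    · intro j
      by_cases hab : a < b
      · rw [hf0 hab, map_zero, zero_smul, sub_zero]
        simpa using (isHomogeneous_C (Fin 3) c).mul (hPa j)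
      · refine IsHomogeneous.sub (by simpa using (isHomogeneous_C (Fin 3) c).mul (hPa j)) ?_
        have := (resLift_isHomogeneous (p := p) (q := q) hf).mul (hQb j)
        rwa [Nat.sub_add_cancel (not_lt.mp hab)] at this
    · rw [det3_smul_right, det3_combination]
      exact mul_ne_zero (form_ne_zero hv) (mul_ne_zero (by simpa using hc0) h0)

end AddDelete

/-! ### Obstructions to freeness -/

section NonFree

variable {K : Type u} [Field K] {ι : Type v} {w : ι → Fin 3 → K} {s : Finset ι}

/-- The vector field is proportional to the Euler field. -/
def IsEulerMultiple (P : Fin 3 → MvPolynomial (Fin 3) K) : Prop :=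
  ∀ i j, X i * P j = X j * P i

theorem IsEulerMultiple.parallel {P Q : Fin 3 → MvPolynomial (Fin 3) K} (hP : IsEulerMultiple P)
    (hQ : IsEulerMultiple Q) (i j : Fin 3) : P i * Q j = P j * Q i := by
  have h0 : (X 0 * X 0 : MvPolynomial (Fin 3) K) ≠ 0 := mul_ne_zero (X_ne_zero 0) (X_ne_zero 0)
  apply mul_left_cancel₀ h0
  linear_combination X 0 * Q j * hP 0 i + X i * P 0 * hQ 0 j - X 0 * Q i * hP 0 j -
    X j * P 0 * hQ 0 i

theorem IsEulerMultiple.eq_zero {P : Fin 3 → MvPolynomial (Fin 3) K} (hP : IsEulerMultiple P)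
    (hd : ∀ i, (P i).IsHomogeneous 0) : P = 0 := by
  have hC : ∀ j, P j = C (coeff 0 (P j)) := fun j =>
    totalDegree_eq_zero_iff_eq_C.mp (Nat.le_zero.mp (hd j).totalDegree_le)
  have key : ∀ i j : Fin 3, i ≠ j → P j = 0 := by
    intro i j hij
    have h := congrArg (eval (Pi.single i 1)) (hP i j)
    rw [hC i, hC j] at h
    simp [hij.symm] at h
    rw [hC j, h, C_0]
  ext1 j
  fin_cases j
  · exact key 1 0 (by decide)
  · exact key 0 1 (by decide)
  · exact key 0 2 (by decide)

/-- A derivation that is dependent with the Euler derivation and each of two further derivations,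
which are independent together with it, is a multiple of the Euler derivation. -/
theorem isEulerMultiple_of_det3 {P Q R : Fin 3 → MvPolynomial (Fin 3) K} (h : det3 X Q R ≠ 0)
    (hQ : det3 X P Q = 0) (hR : det3 X P R = 0) : IsEulerMultiple P := by
  intro i j
  apply mul_left_cancel₀ h
  simp only [det3] at hQ hR ⊢
  fin_cases i <;> fin_cases j <;> simp only [Fin.zero_eta, Fin.mk_one, Fin.reduceFinMk]
  · linear_combination (R 0 * X 1 - R 1 * X 0) * hQ + (X 0 * Q 1 - X 1 * Q 0) * hR
  · linear_combination -(R 2 * X 0 - R 0 * X 2) * hQ - (X 2 * Q 0 - X 0 * Q 2) * hR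
  · linear_combination -(R 0 * X 1 - R 1 * X 0) * hQ - (X 0 * Q 1 - X 1 * Q 0) * hR
  · linear_combination (R 1 * X 2 - R 2 * X 1) * hQ + (X 1 * Q 2 - X 2 * Q 1) * hR
  · linear_combination (R 2 * X 0 - R 0 * X 2) * hQ + (X 2 * Q 0 - X 0 * Q 2) * hR
  · linear_combination -(R 1 * X 2 - R 2 * X 1) * hQ - (X 1 * Q 2 - X 2 * Q 1) * hR

/-- Among independent homogeneous vector fields with degree sum `2 * m`, there is one of degree
less than `m` that is not proportional to the Euler field. -/
theorem exists_not_isEulerMultiple {P : Matrix (Fin 3) (Fin 3) (MvPolynomial (Fin 3) K)}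
    {d : Fin 3 → ℕ} (hd : ∀ k j, (P k j).IsHomogeneous (d k)) (hdet : P.det ≠ 0) {m : ℕ}
    (hm : 0 < m) (hsum : ∑ k, d k = 2 * m) : ∃ k, d k < m ∧ ¬ IsEulerMultiple (P k) := by
  by_contra! hcon
  rw [det_of_fin_three] at hdet
  rw [Fin.sum_univ_three] at hsum
  have hne : ∀ k, d k < m → d k ≠ 0 := by
    intro k hk h0
    have hz := (hcon k hk).eq_zero fun i => h0 ▸ hd k i
    apply hdet
    fin_cases k <;> simp only [Fin.zero_eta, Fin.mk_one, Fin.reduceFinMk] at hz <;>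
      simp [hz, det3]
  have hpair : ∀ k l, k ≠ l → d k < m → d l < m → False := by
    intro k l hkl hk hl
    have h := (hcon k hk).parallel (hcon l hl)
    apply hdet
    simp only [det3]
    fin_cases k <;> fin_cases l <;>
      simp only [Fin.zero_eta, Fin.mk_one, Fin.reduceFinMk, ne_eq, not_true_eq_false] at h hkl
    · linear_combination P 2 2 * h 0 1 - P 2 1 * h 0 2 + P 2 0 * h 1 2
    · linear_combination -P 1 2 * h 0 1 + P 1 1 * h 0 2 - P 1 0 * h 1 2
    · linear_combination -P 2 2 * h 0 1 + P 2 1 * h 0 2 - P 2 0 * h 1 2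
    · linear_combination P 0 2 * h 0 1 - P 0 1 * h 0 2 + P 0 0 * h 1 2
    · linear_combination P 1 2 * h 0 1 - P 1 1 * h 0 2 + P 1 0 * h 1 2
    · linear_combination -P 0 2 * h 0 1 + P 0 1 * h 0 2 - P 0 0 * h 1 2
  have h01 := hpair 0 1 (by decide)
  have h02 := hpair 0 2 (by decide)
  have h12 := hpair 1 2 (by decide)
  rcases lt_or_ge (d 0) m with l0 | l0 <;> rcases lt_or_ge (d 1) m with l1 | l1 <;>
    rcases lt_or_ge (d 2) m with l2 | l2
  all_goals
    first
      | exact h01 l0 l1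
      | exact h02 l0 l2
      | exact h12 l1 l2
      | have := hne 0 l0; omega
      | have := hne 1 l1; omega
      | have := hne 2 l2; omega
      | omega

/-- Adding a plane with at least `a + 2` traces to a free arrangement with exponents `(1, a, a)`
destroys freeness. -/
theorem HasExps.not_isFree_insert {a : ℕ} (h : HasExps w s a a) (hw : PairwiseIndep w s)
    {v : Fin 3 → K} (hv : v ≠ 0) (hvs : ∀ i ∈ s, ∀ k : K, w i ≠ k • v) {T : Finset ι}
    (hTs : T ⊆ s) (hT : ∀ i ∈ T, ∀ j ∈ T, i ≠ j → det3 v (w i) (w j) ≠ 0)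
    (hcard : a + 2 ≤ T.card) {B : Arrangement K 3}
    (hB : B.planes = insert (plane v) ((fun i => plane (w i)) '' s)) : ¬ B.IsFree := by
  classical
  intro hfree
  obtain ⟨Q, R, hQ, hR, hQa, hRa, h0, hc⟩ := h
  set w' : Option ι → Fin 3 → K := fun o => o.elim v w with hw'
  have hred : PairwiseIndep w' (Finset.insertNone s) := by
    constructor
    · intro o ho
      cases o with
      | none => exact hv
      | some i => exact hw.1 i (by simpa using ho)
    · intro o ho o' ho' hne k
      cases o with
      | none =>
        cases o' with
        | none => exact absurd rfl hne
        | some j => exact hvs j (by simpa using ho') k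
      | some i =>
        have hi : i ∈ s := by simpa using ho
        cases o' with
        | none =>
          intro hk
          change v = k • w i at hk
          have hk0 : k ≠ 0 := by rintro rfl; simp at hk; exact hv hk
          exact hvs i hi k⁻¹ (by rw [hk, smul_smul, inv_mul_cancel₀ hk0, one_smul])
        | some j =>
          exact hw.2 i hi j (by simpa using ho') (fun h => hne (congrArg some h)) k
  have hB' : B.planes = (fun o => plane (w' o)) '' (Finset.insertNone s : Finset (Option ι)) := by
    rw [hB]
    ext H
    simp only [Set.mem_insert_iff, Set.mem_image, Finset.mem_coe]
    constructor
    · rintro (rfl | ⟨i, hi, rfl⟩)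
      · exact ⟨none, by simp, rfl⟩
      · exact ⟨some i, by simpa using hi, rfl⟩
    · rintro ⟨o, ho, rfl⟩
      cases o with
      | none => exact Or.inl rfl
      | some i => exact Or.inr ⟨i, by simpa using ho, rfl⟩
  obtain ⟨P, d, hP, hd, hdet, hsum⟩ := exists_isLog_of_isFree hred hB' ⟨none, by simp⟩ hfree
  rw [Finset.card_insertNone, hc] at hsum
  obtain ⟨k, hk, hkE⟩ := exists_not_isEulerMultiple hd hdet (m := a + 1) (by omega)
    (by rw [hsum]; ring)
  have hPs : IsLog w s (P k) := fun i hi => hP k (some i) (by simpa using hi)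
  have hPv : form v ∣ pairing v (P k) := hP k none (by simp)
  obtain ⟨p, q, hpq⟩ := exists_det3_ne_zero hv
  have hwedge := resWedge_eq_zero hpq (hd k) hPv (hPs.mono hTs) (fun i hi => hvs i (hTs hi)) hT
    (by omega)
  have hzero : ∀ {U : Fin 3 → MvPolynomial (Fin 3) K}, IsLog w s U →
      (∀ i, (U i).IsHomogeneous a) → det3 X (P k) U = 0 := fun {U} hU hUa =>
    eq_zero_of_dvd_of_degree_lt (isHomogeneous_det3 (isHomogeneous_X K) (hd k) hUa)
      ((form_isHomogeneous v).mul (prod_form_isHomogeneous w s))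
      (form_mul_prod_dvd hv hvs (form_dvd_det3_of_resWedge hpq hPv hwedge U)
        (hw.prod_dvd_det3 isLog_X hPs hU)) (by omega)
  exact hkE (isEulerMultiple_of_det3 h0 (hzero hQ hQa) (hzero hR hRa))

/-- Deleting a plane with at most `a` traces from a free arrangement with exponents `(1, a, a)`
destroys freeness. -/
theorem HasExps.not_isFree_erase [DecidableEq ι] {a : ℕ} (ha : 0 < a) (h : HasExps w s a a)
    (hw : PairwiseIndep w s) {i : ι} (hi : i ∈ s) {r : ι → ι}
    (hr : IsTraceChoice w (s.erase i) (w i) r) (hcard : ((s.erase i).image r).card ≤ a)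
    {B : Arrangement K 3} (hB : B.planes = (fun i => plane (w i)) '' (s.erase i : Finset ι)) :
    ¬ B.IsFree := by
  intro hfree
  obtain ⟨Q, R, hQ, hR, hQa, hRa, h0, hc⟩ := h
  have hsc : (s.erase i).card = 2 * a := by rw [Finset.card_erase_of_mem hi]; omega
  have hws := hw.mono (Finset.erase_subset i s)
  obtain ⟨P, d, hP, hd, hdet, hsum⟩ := exists_isLog_of_isFree hws hB
    (Finset.card_pos.mp (by omega)) hfree
  obtain ⟨k, hk, hkE⟩ := exists_not_isEulerMultiple hd hdet ha (by rw [hsum, hsc])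
  have hv := hw.1 i hi
  have hvs : ∀ j ∈ s.erase i, ∀ k : K, w j ≠ k • w i := fun j hj =>
    hw.2 i hi j (Finset.mem_of_mem_erase hj) (Finset.ne_of_mem_erase hj).symm
  obtain ⟨p, q, hpq⟩ := exists_det3_ne_zero hv
  have hcf := hr.card_filter
  have hPi : form (w i) ∣ pairing (w i) (P k) := by
    rw [← res_eq_zero_iff hpq]
    exact eq_zero_of_dvd_of_degree_lt (res_isHomogeneous (pairing_isHomogeneous (hd k)))
      (prod_form_isHomogeneous (fun j => resVec p q (w i) (w j)) _)
      (hr.prod_dvd_res hws hpq hv hvs (hP k)) (by omega)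
  have hPs : IsLog w s (P k) := by
    intro j hj
    by_cases hji : j = i
    · rw [hji]; exact hPi
    · exact hP k j (Finset.mem_erase.mpr ⟨hji, hj⟩)
  have hzero : ∀ {U : Fin 3 → MvPolynomial (Fin 3) K}, IsLog w s U →
      (∀ i, (U i).IsHomogeneous a) → det3 X (P k) U = 0 := fun {U} hU hUa =>
    eq_zero_of_dvd_of_degree_lt (isHomogeneous_det3 (isHomogeneous_X K) (hd k) hUa)
      (prod_form_isHomogeneous w s) (hw.prod_dvd_det3 isLog_X hPs hU) (by omega)
  exact hkE (isEulerMultiple_of_det3 h0 (hzero hQ hQa) (hzero hR hRa))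

/-- A nonempty arrangement is not recursively free if no arrangement that differs from it by a
single plane is free. -/
theorem not_isRecursivelyFree_of_isolated {A : Arrangement K 3} (hA : A.planes.Nonempty)
    (hadd : ∀ B : Arrangement K 3, ∀ v : Fin 3 → K, v ≠ 0 → plane v ∉ A.planes →
      B.planes = insert (plane v) A.planes → ¬ B.IsFree)
    (hdel : ∀ B : Arrangement K 3, ∀ H ∈ A.planes, B.planes = A.planes \ {H} → ¬ B.IsFree) :
    ¬ A.IsRecursivelyFree := by
  rintro ⟨t, B, h0, ht, hstep, hfree⟩
  cases t with
  | zero => rw [← ht, h0] at hA; exact Set.not_nonempty_empty hA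
  | succ k =>
    obtain ⟨H, hH⟩ := Set.ncard_eq_one.mp (hstep k (Nat.lt_succ_self k))
    rw [ht] at hH
    have hfk := hfree k (Nat.le_succ k)
    have hmem : ∀ H', (H' ∈ (B k).planes ↔ H' ∈ A.planes) ↔ H' ≠ H := by
      intro H'
      have : H' ∈ symmDiff (B k).planes A.planes ↔ H' = H := by rw [hH]; rfl
      rw [Set.mem_symmDiff] at this
      tauto
    have hHH := hmem H
    by_cases hHA : H ∈ A.planes
    · refine hdel (B k) H hHA ?_ hfk
      ext H'
      have := hmem H'
      simp only [Set.mem_sdiff, Set.mem_singleton_iff]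
      by_cases hHH' : H' = H
      · subst hHH'; tauto
      · tauto
    · have hHB : H ∈ (B k).planes := by tauto
      obtain ⟨v, hv, rfl⟩ := (B k).isHyperplane H hHB
      refine hadd (B k) v hv hHA ?_ hfk
      ext H'
      have := hmem H'
      simp only [Set.mem_insert_iff]
      by_cases hHH' : H' = plane v
      · subst hHH'; tauto
      · tauto

end NonFree

/-! ### Integer polynomials that can be evaluated in the kernel -/

section ZPoly

/-- Addition of integer polynomials, given by their lists of coefficients, lowest degree first. -/
def zadd : List ℤ → List ℤ → List ℤ
  | [], q => q
  | p, [] => p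
  | a :: p, b :: q => (a + b) :: zadd p q

/-- Multiplication of an integer polynomial by a scalar. -/
def zsmul (a : ℤ) (p : List ℤ) : List ℤ := p.map (a * ·)

/-- Multiplication of integer polynomials. -/
def zmul : List ℤ → List ℤ → List ℤ
  | [], _ => []
  | a :: p, q => zadd (zsmul a q) (0 :: zmul p q)

/-- Subtraction of integer polynomials. -/
def zsub (p q : List ℤ) : List ℤ := zadd p (zsmul (-1) q)

/-- Removal of vanishing leading coefficients. -/
def ztrim : List ℤ → List ℤ
  | [] => []
  | a :: p =>
    match ztrim p with
    | [] => bif Int.beq' a 0 then [] else [a]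
    | b :: q => a :: b :: q

/-- Whether the lowest nonvanishing coefficient is negative. -/
def zneg : List ℤ → Bool
  | [] => false
  | 0 :: p => zneg p
  | Int.ofNat _ :: _ => false
  | Int.negSucc _ :: _ => true

/-- The normal form of a polynomial up to sign. -/
def znorm (p : List ℤ) : List ℤ := bif zneg p then ztrim (zsmul (-1) p) else ztrim p

/-- Equality of lists of coefficients. -/
def zbeq : List ℤ → List ℤ → Bool
  | [], [] => true
  | a :: p, b :: q => Int.beq' a b && zbeq p q
  | _, _ => false

theorem eq_of_zbeq : ∀ {p q : List ℤ}, zbeq p q = true → p = q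
  | [], [], _ => rfl
  | [], _ :: _, h => by simp [zbeq] at h
  | _ :: _, [], h => by simp [zbeq] at h
  | a :: p, b :: q, h => by
    simp only [zbeq, Bool.and_eq_true, Int.beq'_eq] at h
    rw [h.1, eq_of_zbeq h.2]

/-- Vectors of three integer polynomials. -/
abbrev ZVec : Type := List ℤ × List ℤ × List ℤ

/-- The cross product of vectors of integer polynomials. -/
def zcross (u v : ZVec) : ZVec :=
  (zsub (zmul u.2.1 v.2.2) (zmul u.2.2 v.2.1), zsub (zmul u.2.2 v.1) (zmul u.1 v.2.2),
    zsub (zmul u.1 v.2.1) (zmul u.2.1 v.1))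

/-- The dot product of vectors of integer polynomials. -/
def zdot (u v : ZVec) : List ℤ :=
  zadd (zmul u.1 v.1) (zadd (zmul u.2.1 v.2.1) (zmul u.2.2 v.2.2))

variable {K : Type u} [Field K] (c : K)

/-- The value of an integer polynomial. -/
def zeval : List ℤ → K
  | [] => 0
  | a :: p => a + c * zeval p

/-- The value of a vector of integer polynomials. -/
def zvec (v : ZVec) : Fin 3 → K := ![zeval c v.1, zeval c v.2.1, zeval c v.2.2]

@[simp] theorem zeval_zadd : ∀ p q : List ℤ, zeval c (zadd p q) = zeval c p + zeval c q
  | [], q => by simp [zadd, zeval]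
  | a :: p, [] => by simp [zadd, zeval]
  | a :: p, b :: q => by
    simp only [zadd, zeval, zeval_zadd p q]; push_cast; ring

@[simp] theorem zeval_zsmul (a : ℤ) : ∀ p : List ℤ, zeval c (zsmul a p) = a * zeval c p
  | [] => by simp [zsmul, zeval]
  | b :: p => by
    have := zeval_zsmul a p
    simp only [zsmul] at this
    simp only [zsmul, List.map_cons, zeval, this]; push_cast; ring

@[simp] theorem zeval_zmul : ∀ p q : List ℤ, zeval c (zmul p q) = zeval c p * zeval c q
  | [], q => by simp [zmul, zeval]
  | a :: p, q => by
    simp only [zmul, zeval_zadd, zeval_zsmul, zeval, zeval_zmul p q]; push_cast; ring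

@[simp] theorem zeval_zsub (p q : List ℤ) : zeval c (zsub p q) = zeval c p - zeval c q := by
  simp only [zsub, zeval_zadd, zeval_zsmul]; push_cast; ring

@[simp] theorem zeval_ztrim : ∀ p : List ℤ, zeval c (ztrim p) = zeval c p
  | [] => rfl
  | a :: p => by
    have ih := zeval_ztrim p
    rw [ztrim]
    split
    next h =>
      rw [h] at ih
      cases h0 : Int.beq' a 0
      · simp [zeval, ← ih]
      · rw [Int.beq'_eq] at h0
        simp [zeval, h0, ← ih]
    next b q h =>
      rw [h] at ih
      simp only [zeval] at ih ⊢
      rw [ih]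

theorem zeval_znorm_eq_zero_iff (p : List ℤ) : zeval c (znorm p) = 0 ↔ zeval c p = 0 := by
  unfold znorm
  cases zneg p <;> simp

theorem dot_zvec (u v : ZVec) :
    zeval c (zdot u v) = ∑ i, zvec c u i * zvec c v i := by
  simp [zdot, zvec, Fin.sum_univ_three, add_assoc]

theorem det3_zvec (u v w : ZVec) :
    zeval c (zdot (zcross u v) w) = det3 (zvec c u) (zvec c v) (zvec c w) := by
  simp [zdot, zcross, zvec, det3]; ring

/-- Elimination of the lowest coefficients, a test for the absence of common nonzero roots. -/
def zcoprime : ℕ → List ℤ → List ℤ → Bool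
  | _, [], _ => false
  | _, _, [] => false
  | 0, _, _ => false
  | n + 1, a :: p, b :: q =>
    if p.isEmpty && a != 0 then true
    else if q.isEmpty && b != 0 then true
    else if a == 0 then zcoprime n p (b :: q)
    else if b == 0 then zcoprime n (a :: p) q
    else
      let r := ztrim (zsub (zsmul b p) (zsmul a q))
      if p.length ≤ q.length then zcoprime n (a :: p) r else zcoprime n (b :: q) r

theorem not_common_root_of_zcoprime [CharZero K] (hc : c ≠ 0) :
    ∀ (n : ℕ) (p q : List ℤ), zcoprime n p q = true → zeval c p = 0 → zeval c q = 0 → False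
  | 0, [], _ => by simp [zcoprime]
  | 0, _ :: _, [] => by simp [zcoprime]
  | 0, _ :: _, _ :: _ => by simp [zcoprime]
  | _ + 1, [], _ => by simp [zcoprime]
  | _ + 1, _ :: _, [] => by simp [zcoprime]
  | n + 1, a :: p, b :: q => by
    intro h hp hq
    have hr : zeval c (ztrim (zsub (zsmul b p) (zsmul a q))) = 0 := by
      apply mul_left_cancel₀ hc
      simp only [zeval_ztrim, zeval_zsub, zeval_zsmul]
      simp only [zeval] at hp hq
      linear_combination b * hp - a * hq
    rw [zcoprime] at h
    split_ifs at h with h1 h2 h3 h4 h5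
    · simp only [Bool.and_eq_true, List.isEmpty_iff, bne_iff_ne] at h1
      simp only [zeval, h1.1, mul_zero, add_zero, Int.cast_eq_zero] at hp
      exact h1.2 hp
    · simp only [Bool.and_eq_true, List.isEmpty_iff, bne_iff_ne] at h2
      simp only [zeval, h2.1, mul_zero, add_zero, Int.cast_eq_zero] at hq
      exact h2.2 hq
    · rw [beq_iff_eq] at h3
      refine not_common_root_of_zcoprime hc n _ _ h ?_ hq
      simpa [zeval, h3, hc] using hp
    · rw [beq_iff_eq] at h4
      refine not_common_root_of_zcoprime hc n _ _ h hp ?_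
      simpa [zeval, h4, hc] using hq
    · exact not_common_root_of_zcoprime hc n _ _ h hp hr
    · exact not_common_root_of_zcoprime hc n _ _ h hq hr

end ZPoly

/-! ### The standard arrangements -/

section Std

/-- The normals of the standard arrangement with parameter `c`: its planes join the six points
`(0 : 1 : ±1)`, `(±1 : 0 : 1)`, `(1 : ±c : 0)` of the projective plane. -/
def std {R : Type*} [CommRing R] (c : R) : Fin 15 → Fin 3 → R :=
  ![![1, 0, 0], ![0, 1, 0], ![0, 0, 1],
    ![1, 1, 1], ![1, 1, -1], ![1, -1, 1], ![1, -1, -1],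
    ![c, 1, 1], ![c, 1, -1], ![c, -1, 1], ![c, -1, -1],
    ![c, 1, c], ![c, 1, -c], ![c, -1, c], ![c, -1, -c]]

/-- The standard normals as vectors of polynomials in the parameter. -/
def stdZ : Fin 15 → ZVec :=
  ![([1], [], []), ([], [1], []), ([], [], [1]),
    ([1], [1], [1]), ([1], [1], [-1]), ([1], [-1], [1]), ([1], [-1], [-1]),
    ([0, 1], [1], [1]), ([0, 1], [1], [-1]), ([0, 1], [-1], [1]), ([0, 1], [-1], [-1]),
    ([0, 1], [1], [0, 1]), ([0, 1], [1], [0, -1]), ([0, 1], [-1], [0, 1]),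
    ([0, 1], [-1], [0, -1])]

/-- The points of intersection of the projective lines of the generic standard arrangement, each
with the list of the lines through it. -/
def stdPoints : List (List (Fin 15) × ZVec) :=
  [([0, 1], [], [], [1]), ([0, 2], [], [-1], []), ([0, 3, 6, 7, 10], [], [-1], [1]),
    ([0, 4, 5, 8, 9], [], [1], [1]),
    ([0, 11, 14], [], [0, -1], [1]), ([0, 12, 13], [], [0, 1], [1]), ([1, 2], [1], [], []),
    ([1, 3, 5, 11, 13], [1], [], [-1]), ([1, 4, 6, 12, 14], [-1], [], [-1]),
    ([1, 7, 9], [1], [], [0, -1]),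
    ([1, 8, 10], [-1], [], [0, -1]), ([2, 3, 4], [-1], [1], []), ([2, 5, 6], [1], [1], []),
    ([2, 7, 8, 11, 12], [-1], [0, 1], []), ([2, 9, 10, 13, 14], [1], [0, 1], []),
    ([3, 8], [-2], [1, 1], [1, -1]),
    ([3, 9], [2], [-1, 1], [-1, -1]), ([3, 12], [-1, -1], [0, 2], [1, -1]),
    ([3, 14], [1, -1], [0, 2], [-1, -1]),
    ([4, 7], [2], [-1, -1], [1, -1]), ([4, 10], [-2], [1, -1], [-1, -1]),
    ([4, 11], [1, 1], [0, -2], [1, -1]),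
    ([4, 13], [-1, 1], [0, -2], [-1, -1]), ([5, 7], [-2], [-1, 1], [1, 1]),
    ([5, 10], [2], [1, 1], [-1, 1]),
    ([5, 12], [-1, 1], [0, 2], [1, 1]), ([5, 14], [1, 1], [0, 2], [-1, 1]),
    ([6, 8], [2], [1, -1], [1, 1]),
    ([6, 9], [-2], [-1, -1], [-1, 1]), ([6, 11], [1, -1], [0, -2], [1, 1]),
    ([6, 13], [-1, -1], [0, -2], [-1, 1]),
    ([7, 13], [1, 1], [0, 1, -1], [0, -2]), ([7, 14], [1, -1], [0, 1, 1], [0, -2]),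
    ([8, 13], [-1, 1], [0, -1, -1], [0, -2]), ([8, 14], [-1, -1], [0, -1, 1], [0, -2]),
    ([9, 11], [-1, -1], [0, 1, -1], [0, 2]), ([9, 12], [-1, 1], [0, 1, 1], [0, 2]),
    ([10, 11], [1, -1], [0, -1, -1], [0, 2]), ([10, 12], [1, 1], [0, -1, 1], [0, 2])]

/-- Polynomials in the parameter: the first five vanish at the excluded parameters, the next five
at the special parameters, the others are pairwise without common root. -/
def stdFactors : List (List ℤ) :=
  [[0, 1], [-1, 1], [1, 1], [-1, -4, 1], [-1, 4, 1], [3, 1], [-3, 1], [1, 3], [-1, 3], [1, 0, 1],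
    [1, 0, 3],
    [3, 0, 1], [1, -1, 7, 1], [-1, -1, -7, 1], [-1, 7, 1, 1], [1, 7, -1, 1], [1, -6, 1],
    [1, 6, 1], [1, 0, 14, 0, 1],
    [-1, -2, 1], [-1, 2, 1], [1, -1, -9, 1], [-1, -1, 9, 1], [-1, -9, 1, 1], [1, 4, 14, -4, 1],
    [-1, 2, -16, -2, 1],
    [-1, -2, 16, 2, 1], [-1, 2, 16, -2, 1], [-1, -2, -16, 2, 1], [1, -4, 14, 4, 1],
    [1, -9, -1, 1], [1, 5, -1, 3],
    [-1, 5, 1, 3], [-3, -1, -5, 1], [3, -1, 5, 1], [-1, 3, -11, 1], [1, 11, 3, 1], [1, 3, 11, 1],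
    [-1, 11, -3, 1]]

/-- A factorization `(p, j, k, l)` of a polynomial `p` in the parameter: `p` is the product of the
integer `k`, the first ten factors with index in `l`, and, if `j ≠ 1`, the factor with index `j`. -/
abbrev FactorRow : Type := List ℤ × ℕ × ℤ × List ℕ

/-- Rows of the table `factorTable` below. -/
def factorRows₁ : List FactorRow :=
  [([0, 4, 4], 1, 4, [0, 2]), ([0, 4, -4], 1, -4, [0, 1]), ([0, 4], 1, 4, [0]),
   ([0, 0, 4], 1, 4, [0, 0]), ([0, 3, -1], 1, -1, [0, 6]), ([0, 3, 1], 1, 1, [0, 5]),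
   ([0, 0, 8], 1, 8, [0, 0]), ([0, 1, -3], 1, -1, [0, 8]), ([0, 1, 3], 1, 1, [0, 7]),
   ([0, 8], 1, 8, [0]), ([0, 2], 1, 2, [0]), ([0, 2, -2], 1, -2, [0, 1]),
   ([0, 2, 2], 1, 2, [0, 2]), ([0, 1], 1, 1, [0]), ([0, 1, -1], 1, -1, [0, 1]),
   ([0, 1, 1], 1, 1, [0, 2]), ([0, 0, 2], 1, 2, [0, 0])]

/-- Rows of the table `factorTable` below. -/
def factorRows₂ : List FactorRow :=
  [([1, 0, 3], 10, 1, []), ([1, 4, -1], 1, -1, [3]), ([1, -4, -1], 1, -1, [4]),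
   ([1, -2, -3], 1, -1, [2, 8]), ([1, 2, -3], 1, -1, [1, 7]), ([1, 0, 1], 1, 1, [9]),
   ([1, -2, 1], 1, 1, [1, 1]), ([1, 2, 1], 1, 1, [2, 2]), ([3, 0, 1], 11, 1, []),
   ([1, -3], 1, -1, [8]), ([1, 3], 1, 1, [7]), ([1, 6, 1], 17, 1, []), ([1, -6, 1], 16, 1, []),
   ([2, 0, -2], 1, -2, [1, 2]), ([2, 0, 2], 1, 2, [9]), ([2, 0, 6], 10, 2, []),
   ([4, 0, 4], 1, 4, [9]), ([1, 2, -1], 19, -1, []), ([1, -2, -1], 20, -1, []),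
   ([4, 4], 1, 4, [2]), ([4, -4], 1, -4, [1]), ([3, -2, -1], 1, -1, [1, 5]),
   ([3, 2, -1], 1, -1, [2, 6]), ([4, 0, -4], 1, -4, [1, 2]), ([4], 1, 4, []),
   ([3, -1], 1, -1, [6]), ([3, 1], 1, 1, [5]), ([2, -4, -6], 1, -2, [2, 8]),
   ([2, 4, -6], 1, -2, [1, 7]), ([6, 0, 2], 11, 2, []), ([8, 0, -8], 1, -8, [1, 2]),
   ([8, 0, 8], 1, 8, [9]), ([4, 0, 12], 10, 4, []), ([1, 0, -1], 1, -1, [1, 2]),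
   ([6, 4, -2], 1, -2, [2, 6]), ([6, -4, -2], 1, -2, [1, 5]), ([4, 8, -12], 1, -4, [1, 7]),
   ([4, -8, -12], 1, -4, [2, 8]), ([4, 8, -4], 19, -4, []), ([4, -8, -4], 20, -4, []),
   ([1, -1], 1, -1, [1]), ([1, 1], 1, 1, [2]), ([1], 1, 1, []), ([2], 1, 2, []),
   ([2, -2], 1, -2, [1]), ([2, 2], 1, 2, [2])]

/-- Rows of the table `factorTable` below. -/
def factorRows₃ : List FactorRow :=
  [([0, 3, 0, 1], 11, 1, [0]), ([0, 4, 0, 4], 1, 4, [0, 9]), ([0, 3, 2, -1], 1, -1, [0, 2, 6]),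
   ([0, 1, -4, -1], 1, -1, [0, 4]), ([0, 1, 4, -1], 1, -1, [0, 3]),
   ([0, 3, -2, -1], 1, -1, [0, 1, 5]), ([0, 4, 0, -4], 1, -4, [0, 1, 2]),
   ([0, 12, 0, 4], 11, 4, [0]), ([0, 4, 0, 12], 10, 4, [0]), ([0, 1, 2, 1], 1, 1, [0, 2, 2]),
   ([0, 1, -2, 1], 1, 1, [0, 1, 1]), ([0, 6, 0, 2], 11, 2, [0]), ([0, 0, 4, -4], 1, -4, [0, 0, 1]),
   ([0, 0, 4, 4], 1, 4, [0, 0, 2]), ([0, 2, 0, -2], 1, -2, [0, 1, 2]),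
   ([0, 2, 0, 2], 1, 2, [0, 9]), ([0, 2, 0, 6], 10, 2, [0]), ([0, 1, -6, 1], 16, 1, [0]),
   ([0, 1, 6, 1], 17, 1, [0]), ([0, 12, -8, -4], 1, -4, [0, 1, 5]),
   ([0, 12, 8, -4], 1, -4, [0, 2, 6]), ([0, 4, -8, -12], 1, -4, [0, 2, 8]),
   ([0, 4, 8, -12], 1, -4, [0, 1, 7]), ([0, 8, 0, -8], 1, -8, [0, 1, 2]),
   ([0, 8, 0, 8], 1, 8, [0, 9]), ([0, 6, -4, -2], 1, -2, [0, 1, 5]),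
   ([0, 6, 4, -2], 1, -2, [0, 2, 6]), ([0, 2, -4, -6], 1, -2, [0, 2, 8]),
   ([0, 2, 4, -6], 1, -2, [0, 1, 7]), ([0, 0, 0, 4], 1, 4, [0, 0, 0]),
   ([0, 4, -8, -4], 20, -4, [0]), ([0, 4, 8, -4], 19, -4, [0])]

/-- Rows of the table `factorTable` below. -/
def factorRows₄ : List FactorRow :=
  [([1, -1, 7, 1], 12, 1, []), ([1, 1, 7, -1], 13, -1, []), ([1, -7, -1, -1], 14, -1, []),
   ([1, 7, -1, 1], 15, 1, []), ([1, -5, -5, 1], 16, 1, [2]), ([1, 5, -5, -1], 17, -1, [1]),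
   ([2, -6, -2, 6], 1, 2, [1, 2, 8]), ([2, 6, -2, -6], 1, -2, [1, 2, 7]),
   ([1, -1, -9, 1], 21, 1, []), ([1, 3, -5, 1], 1, 1, [1, 3]), ([1, -3, -5, -1], 1, -1, [2, 4]),
   ([1, 1, -9, -1], 22, -1, []), ([2, 10, -10, -2], 17, -2, [1]),
   ([2, -6, 6, -2], 1, -2, [1, 1, 1]), ([2, 6, 6, 2], 1, 2, [2, 2, 2]),
   ([2, -10, -10, 2], 16, 2, [2]), ([1, 9, -1, -1], 23, -1, []), ([1, 5, 3, -1], 1, -1, [2, 3]),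
   ([1, -5, 3, 1], 1, 1, [1, 4]), ([1, -9, -1, 1], 30, 1, []), ([2, -2, 6, -6], 10, -2, [1]),
   ([2, 2, 14, -2], 13, -2, []), ([2, -2, 14, 2], 12, 2, []), ([6, -2, -6, 2], 1, 2, [1, 2, 6]),
   ([6, 2, -6, -2], 1, -2, [1, 2, 5]), ([2, 10, -2, 6], 31, 2, []), ([2, -10, -2, -6], 32, -2, []),
   ([2, -6, -10, -2], 1, -2, [2, 4]), ([2, 2, 6, 6], 10, 2, [2]), ([2, 6, -10, 2], 1, 2, [1, 3]),
   ([2, -10, 6, 2], 1, 2, [1, 4]), ([2, 14, -2, 2], 15, 2, []), ([2, -14, -2, -2], 14, -2, []),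
   ([6, 2, 10, -2], 33, -2, []), ([6, 6, 2, 2], 11, 2, [2]), ([6, -2, 10, 2], 34, 2, []),
   ([2, 10, 6, -2], 1, -2, [2, 3]), ([6, -6, 2, -2], 11, -2, [1])]

/-- Rows of the table `factorTable` below. -/
def factorRows₅ : List FactorRow :=
  [([0, 6, 2, -6, -2], 1, -2, [0, 1, 2, 5]), ([0, 6, -2, -6, 2], 1, 2, [0, 1, 2, 6]),
   ([0, 1, -7, -1, -1], 14, -1, [0]), ([0, 1, 7, -1, 1], 15, 1, [0]),
   ([0, 2, -6, 6, -2], 1, -2, [0, 1, 1, 1]), ([0, 2, -10, -10, 2], 16, 2, [0, 2]),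
   ([0, 2, 6, 6, 2], 1, 2, [0, 2, 2, 2]), ([0, 2, 10, -10, -2], 17, -2, [0, 1]),
   ([0, 2, -10, 6, 2], 1, 2, [0, 1, 4]), ([0, 2, -14, -2, -2], 14, -2, [0]),
   ([0, 6, 6, 2, 2], 11, 2, [0, 2]), ([0, 6, 2, 10, -2], 33, -2, [0]),
   ([0, 6, -6, 2, -2], 11, -2, [0, 1]), ([0, 6, -2, 10, 2], 34, 2, [0]),
   ([0, 2, 10, 6, -2], 1, -2, [0, 2, 3]), ([0, 2, 14, -2, 2], 15, 2, [0]),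
   ([0, 2, -6, -2, 6], 1, 2, [0, 1, 2, 8]), ([0, 2, 6, -2, -6], 1, -2, [0, 1, 2, 7]),
   ([0, 0, 12, 0, 4], 11, 4, [0, 0]), ([0, 0, 8, 0, -8], 1, -8, [0, 0, 1, 2]),
   ([0, 0, 8, 0, 8], 1, 8, [0, 0, 9]), ([0, 1, -9, -1, 1], 30, 1, [0]),
   ([0, 1, 5, -5, -1], 17, -1, [0, 1]), ([0, 1, -5, 3, 1], 1, 1, [0, 1, 4]),
   ([0, 1, 5, 3, -1], 1, -1, [0, 2, 3]), ([0, 1, -5, -5, 1], 16, 1, [0, 2]),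
   ([0, 1, 9, -1, -1], 23, -1, [0]), ([0, 0, 6, 0, 2], 11, 2, [0, 0]),
   ([0, 0, 12, 8, -4], 1, -4, [0, 0, 2, 6]), ([0, 2, 6, -10, 2], 1, 2, [0, 1, 3]),
   ([0, 2, -10, -2, -6], 32, -2, [0]), ([0, 2, 2, 6, 6], 10, 2, [0, 2]),
   ([0, 2, 2, 14, -2], 13, -2, [0]), ([0, 2, -2, 6, -6], 10, -2, [0, 1]),
   ([0, 2, -2, 14, 2], 12, 2, [0]), ([0, 2, -6, -10, -2], 1, -2, [0, 2, 4]),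
   ([0, 2, 10, -2, 6], 31, 2, [0]), ([0, 0, 12, -8, -4], 1, -4, [0, 0, 1, 5]),
   ([0, 0, 6, 4, -2], 1, -2, [0, 0, 2, 6]), ([0, 0, 6, -4, -2], 1, -2, [0, 0, 1, 5])]

/-- Rows of the table `factorTable` below. -/
def factorRows₆ : List FactorRow :=
  [([1, 0, 14, 0, 1], 18, 1, []), ([1, 8, -10, 0, 1], 23, 1, [1]),
   ([1, 6, -8, 2, -1], 15, -1, [1]), ([1, 0, -10, 8, 1], 22, 1, [1]),
   ([1, -2, 8, -6, -1], 12, -1, [1]), ([1, 4, 14, -4, 1], 24, 1, []),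
   ([1, -6, -8, -2, -1], 14, -1, [2]), ([1, -2, 16, 2, -1], 25, -1, []),
   ([1, 0, -10, -8, 1], 21, 1, [2]), ([1, 2, -16, -2, -1], 26, -1, []),
   ([1, -2, -16, 2, -1], 27, -1, []), ([1, 2, 8, 6, -1], 13, -1, [2]),
   ([1, 2, 16, -2, -1], 28, -1, []), ([1, -4, 14, 4, 1], 29, 1, []),
   ([1, -8, -10, 0, 1], 30, 1, [2]), ([1, -4, -2, 4, 1], 1, 1, [1, 2, 4]),
   ([1, -2, 8, 10, -1], 35, -1, [2]), ([1, 10, -8, -2, -1], 36, -1, [1]),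
   ([1, 4, -2, -4, 1], 1, 1, [1, 2, 3]), ([1, 2, 8, -10, -1], 37, -1, [1]),
   ([1, -10, -8, 2, -1], 38, -1, [2])]

/-- Factorizations of the polynomials that occur as determinants of standard normals, and of planes
through two points of the standard arrangement with standard points. -/
def factorTable : List FactorRow :=
  factorRows₁ ++ factorRows₂ ++ factorRows₃ ++ factorRows₄ ++ factorRows₅ ++ factorRows₆

/-- The part of the table `factorTable` that can contain a given polynomial, for quick search. -/
def factorBucket (p : List ℤ) : List FactorRow :=
  bif Int.beq' (p.headD 0) 0 then
    bif p.length.ble 3 then factorRows₁ else bif p.length.beq 4 then factorRows₃ else factorRows₅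
  else bif p.length.ble 3 then factorRows₂ else bif p.length.beq 4 then factorRows₄
    else factorRows₆

theorem mem_factorTable_of_mem_factorBucket {p : List ℤ} {r : FactorRow}
    (h : r ∈ factorBucket p) : r ∈ factorTable := by
  unfold factorBucket at h
  simp only [factorTable, List.mem_append]
  simp only [cond_eq_ite] at h
  split_ifs at h <;> tauto

/-- Three standard normals are dependent for every parameter. -/
def dep (i j k : Fin 15) : Bool :=
  i == j || j == k || i == k ||
    stdPoints.any fun P => P.1.contains i && P.1.contains j && P.1.contains k

/-- The parameters for which the standard arrangement has the generic intersection pattern. -/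
structure IsGood {K : Type u} [Field K] (c : K) : Prop where
  ne_zero : c ≠ 0
  ne_one : c ≠ 1
  ne_neg_one : c ≠ -1
  quad : c ^ 2 - 4 * c - 1 ≠ 0
  quad' : c ^ 2 + 4 * c - 1 ≠ 0

/-- The parameters for which some plane outside of the standard arrangement has only eight
traces. -/
def IsSpecial {K : Type u} [Field K] (c : K) : Prop :=
  c = 3 ∨ c = -3 ∨ 3 * c = 1 ∨ 3 * c = -1 ∨ c ^ 2 = -1

/-- The factor with a given index. -/
def stdFactor (i : ℕ) : List ℤ := stdFactors.getD i [1]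

/-- Verification of a factorization. -/
def factorRowOk (r : FactorRow) : Bool :=
  r.2.2.1 != 0 && r.2.2.2.all (fun i => decide (i < 10)) && (r.2.1 == 1 || decide (10 ≤ r.2.1)) &&
    (ztrim (r.2.2.2.foldr (fun i p => zmul (stdFactor i) p)
      (zsmul r.2.2.1 (if r.2.1 == 1 then [1] else stdFactor r.2.1))) == r.1)

set_option maxRecDepth 100000 in
theorem factorTable_ok : factorTable.all factorRowOk = true := by decide +kernel

variable {K : Type u} [Field K]

theorem zvec_stdZ (c : K) (i : Fin 15) : zvec c (stdZ i) = std c i := by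
  fin_cases i <;> ext j <;> fin_cases j <;> simp [zvec, stdZ, std, zeval]

theorem zeval_stdFactor_ne_zero {c : K} (hc : IsGood c) {i : ℕ} (hi : i < 5) :
    zeval c (stdFactor i) ≠ 0 := by
  obtain ⟨h0, h1, h2, h3, h4⟩ := hc
  interval_cases i <;> simp only [stdFactor, stdFactors, List.getD_cons_zero, List.getD_cons_succ,
    zeval]
  · simpa using h0
  · intro h; apply h1; push_cast at h; linear_combination h
  · intro h; apply h2; push_cast at h; linear_combination h
  · intro h; apply h3; push_cast at h; linear_combination h
  · intro h; apply h4; push_cast at h; linear_combination h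

theorem zeval_stdFactor_ne_zero' {c : K} (hc : IsGood c) (hs : ¬ IsSpecial c) {i : ℕ}
    (hi : i < 10) : zeval c (stdFactor i) ≠ 0 := by
  by_cases hi' : i < 5
  · exact zeval_stdFactor_ne_zero hc hi'
  simp only [IsSpecial, not_or] at hs
  obtain ⟨h0, h1, h2, h3, h4⟩ := hs
  interval_cases i <;> first | omega | simp only [stdFactor, stdFactors, List.getD_cons_zero,
    List.getD_cons_succ, zeval]
  · intro h; apply h1; push_cast at h; linear_combination h
  · intro h; apply h0; push_cast at h; linear_combination h
  · intro h; apply h3; push_cast at h; linear_combination h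
  · intro h; apply h2; push_cast at h; linear_combination h
  · intro h; apply h4; push_cast at h; linear_combination h

/-- If a polynomial of the table vanishes at `c` and its factors among the first ten do not, then
its remaining factor vanishes at `c`. -/
theorem factorTable_root [CharZero K] {c : K} {r : FactorRow} (hr : r ∈ factorTable)
    (hl : ∀ i ∈ r.2.2.2, zeval c (stdFactor i) ≠ 0) (h0 : zeval c r.1 = 0) :
    10 ≤ r.2.1 ∧ zeval c (stdFactor r.2.1) = 0 := by
  have h := List.all_eq_true.mp factorTable_ok r hr
  simp only [factorRowOk, Bool.and_eq_true, bne_iff_ne, Bool.or_eq_true, beq_iff_eq,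
    decide_eq_true_eq] at h
  obtain ⟨⟨⟨hk, -⟩, hj⟩, hp⟩ := h
  rw [← hp, zeval_ztrim] at h0
  have hfold : ∀ (l : List ℕ) (p : List ℤ), (∀ i ∈ l, zeval c (stdFactor i) ≠ 0) →
      zeval c (l.foldr (fun i p => zmul (stdFactor i) p) p) = 0 → zeval c p = 0 := by
    intro l p hl h
    induction l with
    | nil => exact h
    | cons i l ih =>
      rw [List.foldr_cons, zeval_zmul] at h
      rcases mul_eq_zero.mp h with h | h
      · exact absurd h (hl i List.mem_cons_self)
      · exact ih (fun i hi => hl i (List.mem_cons_of_mem _ hi)) h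
  have h1 := hfold _ _ hl h0
  rw [zeval_zsmul] at h1
  have h2 := (mul_eq_zero.mp h1).resolve_left (Int.cast_ne_zero.mpr hk)
  by_cases hj1 : r.2.1 = 1
  · simp [hj1, zeval] at h2
  · exact ⟨hj.resolve_left hj1, by simpa [hj1] using h2⟩

/-- The test that a standard determinant either vanishes identically or vanishes at excluded
parameters only. -/
def depCheck (i j k : Fin 15) : Bool :=
  let D := znorm (zdot (zcross (stdZ i) (stdZ j)) (stdZ k))
  if dep i j k then D.isEmpty
  else (factorBucket D).any fun r => zbeq r.1 D && r.2.1 == 1 && r.2.2.2.all fun i => decide (i < 5)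

set_option maxRecDepth 100000 in
theorem depCheck_eq_true : ∀ i j k : Fin 15, i < j → j < k → depCheck i j k = true := by
  decide +kernel

set_option maxRecDepth 100000 in
theorem dep_symm : ∀ i j k : Fin 15, dep i j k = dep j i k ∧ dep i j k = dep i k j := by
  decide +kernel

/-- The intersection pattern of the standard arrangement. -/
theorem det3_std_eq_zero_iff [CharZero K] {c : K} (hc : IsGood c) (i j k : Fin 15) :
    det3 (std c i) (std c j) (std c k) = 0 ↔ dep i j k = true := by
  have swap1 : ∀ u v w : Fin 3 → K, det3 v u w = -det3 u v w := fun u v w => by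
    simp only [det3]; ring
  have swap2 : ∀ u v w : Fin 3 → K, det3 u w v = -det3 u v w := fun u v w => by
    simp only [det3]; ring
  have key : ∀ i j k : Fin 15, i < j → j < k →
      (det3 (std c i) (std c j) (std c k) = 0 ↔ dep i j k = true) := by
    intro i j k hij hjk
    have h := depCheck_eq_true i j k hij hjk
    rw [← zvec_stdZ, ← zvec_stdZ, ← zvec_stdZ, ← det3_zvec, ← zeval_znorm_eq_zero_iff]
    unfold depCheck at h
    split_ifs at h with hd
    · simp only [List.isEmpty_iff] at h
      simp [h, zeval, hd]
    · refine iff_of_false ?_ hd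
      obtain ⟨r, hr, h⟩ := List.any_eq_true.mp h
      simp only [Bool.and_eq_true, beq_iff_eq, List.all_eq_true, decide_eq_true_eq] at h
      obtain ⟨⟨hrD, hr1⟩, hl⟩ := h
      rw [← eq_of_zbeq hrD]
      intro h0
      have := (factorTable_root (mem_factorTable_of_mem_factorBucket hr)
        (fun i hi => zeval_stdFactor_ne_zero hc (hl i hi)) h0).1
      omega
  have step1 : ∀ i j k : Fin 15, (det3 (std c i) (std c j) (std c k) = 0 ↔ dep i j k = true) →
      (det3 (std c j) (std c i) (std c k) = 0 ↔ dep j i k = true) := by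
    intro i j k h
    rw [swap1, neg_eq_zero, h, (dep_symm i j k).1]
  have step2 : ∀ i j k : Fin 15, (det3 (std c i) (std c j) (std c k) = 0 ↔ dep i j k = true) →
      (det3 (std c i) (std c k) (std c j) = 0 ↔ dep i k j = true) := by
    intro i j k h
    rw [swap2, neg_eq_zero, h, (dep_symm i j k).2]
  have hdeg : ∀ u v : Fin 3 → K, det3 u u v = 0 ∧ det3 u v u = 0 ∧ det3 v u u = 0 := fun u v => by
    simp only [det3]; exact ⟨by ring, by ring, by ring⟩
  rcases lt_trichotomy i j with hij | rfl | hij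
  · rcases lt_trichotomy j k with hjk | rfl | hjk
    · exact key i j k hij hjk
    · simp [(hdeg (std c j) (std c i)).2.2, dep]
    · rcases lt_trichotomy i k with hik | rfl | hik
      · exact step2 _ _ _ (key i k j hik hjk)
      · simp [(hdeg (std c i) (std c j)).2.1, dep]
      · exact step2 _ _ _ (step1 _ _ _ (key k i j hik hij))
  · simp [(hdeg (std c i) (std c k)).1, dep]
  · rcases lt_trichotomy i k with hik | rfl | hik
    · exact step1 _ _ _ (key j i k hij hik)
    · simp [(hdeg (std c i) (std c j)).2.1, dep]
    · rcases lt_trichotomy j k with hjk | rfl | hjk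
      · exact step1 _ _ _ (step2 _ _ _ (key j k i hjk hik))
      · simp [(hdeg (std c j) (std c i)).2.2, dep]
      · exact step1 _ _ _ (step2 _ _ _ (step1 _ _ _ (key k j i hjk hij)))

end Std

/-! ### Planes outside of the standard arrangement -/

section Outside

/-- Whether two lists of lines have no common member. -/
def disj (a b : List (Fin 15)) : Bool := a.all fun x => !b.contains x

/-- The index of the factor at whose roots a polynomial vanishes: `0` if there is no information,
`1` if there is no root among the admissible parameters. -/
def factorClass (D : List ℤ) : ℕ :=
  let n := znorm D
  if n.isEmpty then 0
  else match (factorBucket n).find? fun r => zbeq r.1 n with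
    | some r => r.2.1
    | none => 0

/-- Whether the weights whose conditions can hold simultaneously have sum at most six. -/
def weightCheck (cs : List (ℕ × ℕ)) : Bool :=
  cs.all fun j => Nat.ble (cs.map fun x : ℕ × ℕ => if x.1 == 0 || x.1 == j.1 then x.2 else 0).sum 6

/-- The weights of the points on the line through the disjoint points `p`, `q`, where `S` is the
list of the points disjoint from both: every weight comes with the class of the condition that the
point is on this line. -/
def lineWeights (p q : List (Fin 15) × ZVec) (S : List (List (Fin 15) × ZVec)) : List (ℕ × ℕ) :=
  let n := zcross p.2 q.2
  (0, p.1.length - 1) :: (0, q.1.length - 1) ::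
    (S.map fun r => (factorClass (zdot n r.2), r.1.length - 1)).filter fun x => x.1 != 1

/-- The test for all pairs of disjoint points. -/
def lineCheck : Bool :=
  stdPoints.all fun p =>
    let S := stdPoints.filter fun r => disj p.1 r.1
    S.all fun q => Nat.ble (q.1.headD 0).val (p.1.headD 0).val ||
      weightCheck (lineWeights p q (S.filter fun r => disj q.1 r.1))

set_option maxRecDepth 1000000 in
theorem lineCheck_eq_true : lineCheck = true := by decide +kernel

/-- Every point of the table has a coordinate without admissible root, lies on its lines, and is
given with an increasing list of at least two lines. -/
def pointCheck (P : List (Fin 15) × ZVec) : Bool :=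
  (P.1.all fun i => (znorm (zdot P.2 (stdZ i))).isEmpty) &&
    ([P.2.1, P.2.2.1, P.2.2.2].any fun x => (factorBucket (znorm x)).any fun r =>
      zbeq r.1 (znorm x) && r.2.1 == 1 && r.2.2.2.all fun i => decide (i < 5)) &&
    decide (P.1.Pairwise (· < ·)) && decide (2 ≤ P.1.length)

set_option maxRecDepth 100000 in
theorem stdPoints_all_pointCheck : stdPoints.all pointCheck = true := by decide +kernel

set_option maxRecDepth 100000 in
theorem exists_stdPoint : ∀ i j : Fin 15, i < j → ∃ P ∈ stdPoints, i ∈ P.1 ∧ j ∈ P.1 := by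
  decide +kernel

theorem stdPoints_length_le : stdPoints.all (fun p => p.1.length.ble 5) = true := by decide +kernel

/-- Different points of the table determine different lines through a given common line, and
through two lines of one of them. -/
def spanCheck : Bool :=
  stdPoints.all fun p => stdPoints.all fun q => p.1 == q.1 ||
    (p.1.all (fun l => !q.1.contains l || p.1.any fun m => q.1.any fun n => !dep l m n) &&
      p.1.all fun a => p.1.all fun b => a == b || q.1.any fun n => !dep a b n)

set_option maxRecDepth 100000 in
theorem spanCheck_eq_true : spanCheck = true := by decide +kernel

set_option maxRecDepth 100000 in
theorem exists_dep_eq_false : ∀ i j : Fin 15, i ≠ j → ∃ k, dep i j k = false := by decide +kernel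

/-- Different factors beyond the first ten have no common root. -/
def coprimeCheck : Bool :=
  (List.range 39).all fun a => a.blt 10 || (List.range a).all fun b => b.blt 10 ||
    zcoprime 20 (stdFactor a) (stdFactor b)

set_option maxRecDepth 100000 in
theorem coprimeCheck_eq_true : coprimeCheck = true := by decide +kernel

end Outside

/-! ### The traces on a plane outside of the standard arrangement -/

section OutsideTraces

variable {K : Type u} [Field K]

/-- Three linear forms that vanish at a common point are dependent. -/
theorem det3_eq_zero_of_dot {x u v w : Fin 3 → K} (hx : x ≠ 0) (hu : ∑ k, x k * u k = 0)
    (hv : ∑ k, x k * v k = 0) (hw : ∑ k, x k * w k = 0) : det3 u v w = 0 := by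
  obtain ⟨k, hk⟩ := Function.ne_iff.mp hx
  apply (mul_eq_zero.mp (?_ : x k * det3 u v w = 0)).resolve_left hk
  simp only [Fin.sum_univ_three] at hu hv hw
  fin_cases k <;> simp only [det3, Fin.zero_eta, Fin.mk_one, Fin.reduceFinMk]
  · linear_combination (v 1 * w 2 - v 2 * w 1) * hu - (u 1 * w 2 - u 2 * w 1) * hv +
      (u 1 * v 2 - u 2 * v 1) * hw
  · linear_combination -(v 0 * w 2 - v 2 * w 0) * hu + (u 0 * w 2 - u 2 * w 0) * hv -
      (u 0 * v 2 - u 2 * v 0) * hw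
  · linear_combination (v 0 * w 1 - v 1 * w 0) * hu - (u 0 * w 1 - u 1 * w 0) * hv +
      (u 0 * v 1 - u 1 * v 0) * hw

theorem dot_eq_zero_of_det3 {x u v w : Fin 3 → K} (hv : v ≠ 0) (hvw : ∀ k : K, w ≠ k • v)
    (h : det3 u v w = 0) (hxv : ∑ k, x k * v k = 0) (hxw : ∑ k, x k * w k = 0) :
    ∑ k, x k * u k = 0 := by
  obtain ⟨a, b, rfl⟩ := exists_eq_add_of_det3_eq_zero (w := u) hv hvw
    (by rw [← h]; simp only [det3]; ring)
  simp only [Fin.sum_univ_three, Pi.add_apply, Pi.smul_apply, smul_eq_mul] at *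
  linear_combination a * hxv + b * hxw

/-- A plane that is dependent with `u, v` and with `u, w`, for a basis `u, v, w`, is proportional
to `u`. -/
theorem exists_eq_smul_of_det3 {x u v w : Fin 3 → K} (h : det3 u v w ≠ 0) (hv : det3 x u v = 0)
    (hw : det3 x u w = 0) : ∃ k : K, x = k • u := by
  have hu : u ≠ 0 := det3_ne_zero_left h
  have huv : ∀ k : K, v ≠ k • u := by
    rintro k rfl
    apply h; simp only [det3, Pi.smul_apply, smul_eq_mul]; ring
  obtain ⟨a, b, rfl⟩ := exists_eq_add_of_det3_eq_zero (w := x) hu huv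
    (by rw [← hv]; simp only [det3]; ring)
  have hb : b * det3 u v w = 0 := by
    rw [← neg_eq_zero, ← hw]
    simp only [det3, Pi.add_apply, Pi.smul_apply, smul_eq_mul]; ring
  exact ⟨a, by simp [(mul_eq_zero.mp hb).resolve_right h]⟩

variable [CharZero K] {c : K}

theorem std_ne_zero (hc : IsGood c) (i : Fin 15) : std c i ≠ 0 := by
  obtain ⟨j, hj⟩ : ∃ j, i ≠ j := ⟨i + 1, by revert i; decide⟩
  obtain ⟨k, hk⟩ := exists_dep_eq_false i j hj
  refine det3_ne_zero_left (v := std c j) (w := std c k) fun h => ?_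
  simp [(det3_std_eq_zero_iff hc i j k).mp h] at hk

theorem std_ne_smul (hc : IsGood c) {i j : Fin 15} (hij : i ≠ j) (a : K) :
    std c j ≠ a • std c i := by
  obtain ⟨k, hk⟩ := exists_dep_eq_false i j hij
  intro h
  have h0 : det3 (std c i) (std c j) (std c k) = 0 := by
    rw [h]; simp only [det3, Pi.smul_apply, smul_eq_mul]; ring
  simp [(det3_std_eq_zero_iff hc i j k).mp h0] at hk

/-- For a good parameter that is not special, a polynomial that vanishes has class `0`, which is
no restriction, or its class is the index of the factor that vanishes. -/
theorem factorClass_of_root (hc : IsGood c) (hs : ¬ IsSpecial c) {D : List ℤ}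
    (h : zeval c D = 0) :
    factorClass D = 0 ∨ 10 ≤ factorClass D ∧ zeval c (stdFactor (factorClass D)) = 0 := by
  unfold factorClass
  simp only
  split_ifs with hn
  · exact Or.inl rfl
  split
  · next r hr =>
    right
    have hr1 := eq_of_zbeq (by simpa using List.find?_some hr)
    have hmem := mem_factorTable_of_mem_factorBucket (List.mem_of_find?_eq_some hr)
    have hok := List.all_eq_true.mp factorTable_ok r hmem
    simp only [factorRowOk, Bool.and_eq_true, List.all_eq_true, decide_eq_true_eq] at hok
    refine factorTable_root hmem (fun i hi => zeval_stdFactor_ne_zero' hc hs (hok.1.1.2 i hi)) ?_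
    rw [hr1, zeval_znorm_eq_zero_iff, h]
  · exact Or.inl rfl

/-- At most one of the factors beyond the first ten vanishes. -/
theorem stdFactor_root_unique (hc : IsGood c) {a b : ℕ} (ha : 10 ≤ a) (hb : 10 ≤ b)
    (ha0 : zeval c (stdFactor a) = 0) (hb0 : zeval c (stdFactor b) = 0) : a = b := by
  have hlt : ∀ a, zeval c (stdFactor a) = 0 → a < 39 := by
    intro a h
    by_contra! h39
    have : stdFactor a = [1] := List.getD_eq_default _ _ (by simpa [stdFactors] using h39)
    simp [this, zeval] at h
  have key : ∀ a b : ℕ, 10 ≤ a → 10 ≤ b → b < a → zeval c (stdFactor a) = 0 →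
      zeval c (stdFactor b) = 0 → False := by
    intro a b ha hb hab ha0 hb0
    have h := List.all_eq_true.mp coprimeCheck_eq_true a (List.mem_range.mpr (hlt a ha0))
    simp only [Bool.or_eq_true, List.all_eq_true, List.mem_range] at h
    have h1 : ∀ n, 10 ≤ n → ¬ n.blt 10 = true := fun n hn => by simp [Nat.blt_eq, hn]
    exact not_common_root_of_zcoprime c hc.ne_zero _ _ _
      (((h.resolve_left (h1 a ha)) b hab).resolve_left (h1 b hb)) ha0 hb0
  rcases lt_trichotomy a b with h | h | h
  · exact (key b a hb ha h hb0 ha0).elim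
  · exact h
  · exact (key a b ha hb h ha0 hb0).elim

theorem zvec_stdPoint (hc : IsGood c) {P : List (Fin 15) × ZVec} (hP : P ∈ stdPoints) :
    zvec c P.2 ≠ 0 ∧ (∀ i ∈ P.1, ∑ k, zvec c P.2 k * std c i k = 0) ∧
      P.1.Pairwise (· < ·) ∧ 2 ≤ P.1.length := by
  have h := List.all_eq_true.mp stdPoints_all_pointCheck P hP
  simp only [pointCheck, Bool.and_eq_true, decide_eq_true_eq] at h
  obtain ⟨⟨⟨h1, h2⟩, h3⟩, h4⟩ := h
  refine ⟨?_, ?_, h3, h4⟩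
  · obtain ⟨x, hx, h2⟩ := List.any_eq_true.mp h2
    obtain ⟨r, hr, h2⟩ := List.any_eq_true.mp h2
    simp only [Bool.and_eq_true, beq_iff_eq, List.all_eq_true, decide_eq_true_eq] at h2
    obtain ⟨⟨hrx, hr1⟩, hl⟩ := h2
    have hx0 : zeval c x ≠ 0 := by
      rw [ne_eq, ← zeval_znorm_eq_zero_iff, ← eq_of_zbeq hrx]
      intro h0
      have := (factorTable_root (mem_factorTable_of_mem_factorBucket hr)
        (fun i hi => zeval_stdFactor_ne_zero hc (hl i hi)) h0).1
      omega
    intro h0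
    have h0' := fun k => congrFun h0 k
    have a0 := h0' 0
    have a1 := h0' 1
    have a2 := h0' 2
    simp only [zvec, Matrix.cons_val_zero, Matrix.cons_val_one, Matrix.cons_val_two,
      Matrix.tail_cons, Matrix.head_cons, Pi.zero_apply] at a0 a1 a2
    simp only [List.mem_cons, List.not_mem_nil, or_false] at hx
    rcases hx with rfl | rfl | rfl
    exacts [hx0 a0, hx0 a1, hx0 a2]
  · intro i hi
    have h := List.all_eq_true.mp h1 i hi
    rw [← zvec_stdZ, ← dot_zvec, ← zeval_znorm_eq_zero_iff, List.isEmpty_iff.mp h]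
    rfl

theorem head_le_of_pairwise {l : List (Fin 15)} (h : l.Pairwise (· < ·)) {i j : Fin 15}
    (hi : i ∈ l) (hj : j ∈ l) (hij : i < j) : j ∈ l.tail := by
  cases l with
  | nil => simp at hi
  | cons a l =>
    rcases List.mem_cons.mp hj with rfl | hj
    · rcases List.mem_cons.mp hi with rfl | hi
      · exact absurd hij (lt_irrefl _)
      · exact absurd ((List.pairwise_cons.mp h).1 i hi) (not_lt.mpr hij.le)
    · exact hj

/-- The points that satisfy `On` have class `0` or a common class `j`, so that their total weight is
at most the weight that the class `j` collects in the list of weights. -/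
theorem sum_weight_le {α : Type*} (On : α → Prop) [DecidablePred On] (cls w : α → ℕ) (j : ℕ)
    (hj : j ≠ 1) (S : List α) (h : ∀ r ∈ S, On r → cls r = 0 ∨ cls r = j) :
    ((S.filter On).map w).sum ≤ ((((S.map fun r => (cls r, w r)).filter fun x => x.1 != 1)).map
      fun x : ℕ × ℕ => if x.1 == 0 || x.1 == j then x.2 else 0).sum := by
  induction S with
  | nil => simp
  | cons r S ih =>
    have ih := ih fun r hr => h r (List.mem_cons_of_mem _ hr)
    rw [List.map_cons]
    by_cases hr : On r
    · have hcls := h r List.mem_cons_self hr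
      have h1 : cls r ≠ 1 := by rcases hcls with h | h <;> omega
      rw [List.filter_cons_of_pos (by simpa using hr), List.filter_cons_of_pos (by simpa using h1),
        List.map_cons, List.map_cons, List.sum_cons, List.sum_cons,
        if_pos (by simpa using hcls)]
      exact Nat.add_le_add_left ih _
    · rw [List.filter_cons_of_neg (by simpa using hr)]
      by_cases h1 : cls r = 1
      · rwa [List.filter_cons_of_neg (by simpa using h1)]
      · rw [List.filter_cons_of_pos (by simpa using h1), List.map_cons, List.sum_cons]
        exact le_add_left ih

/-- A plane outside of the standard arrangement meets it in at least nine different lines, unless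
the parameter is special. Otherwise the projective line of this plane would contain two intersection
points of the standard arrangement, because at most five planes meet in a point, and the planes
through two such points are checked one by one. -/
theorem exists_nine_traces (hc : IsGood c) (hs : ¬ IsSpecial c) {v : Fin 3 → K} (hv0 : v ≠ 0)
    (hv : ∀ i, ∀ k : K, v ≠ k • std c i) :
    ∃ T : Finset (Fin 15), 9 ≤ T.card ∧
      ∀ i ∈ T, ∀ j ∈ T, i ≠ j → det3 v (std c i) (std c j) ≠ 0 := by
  classical
  -- `T` has one plane for each trace on `v`, the first one in the order of the indices
  let T : Finset (Fin 15) := {j | ∀ i < j, det3 v (std c i) (std c j) ≠ 0}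
  refine ⟨T, ?_, ?_⟩
  swap
  · intro i hi j hj hij
    rcases lt_or_gt_of_ne hij with h | h
    · exact (Finset.mem_filter.mp hj).2 i h
    · intro h0
      refine (Finset.mem_filter.mp hi).2 j h ?_
      rw [det3_swap, h0, neg_zero]
  by_contra! hT
  have hbad : 7 ≤ Tᶜ.card := by rw [Finset.card_compl, Fintype.card_fin]; omega
  let On : List (Fin 15) × ZVec → Prop := fun P => ∑ k, zvec c P.2 k * v k = 0
  have hon : ∀ j ∈ Tᶜ, ∃ P ∈ stdPoints, On P ∧ j ∈ P.1.tail := by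
    intro j hj
    simp only [T, Finset.mem_compl, Finset.mem_filter, Finset.mem_univ, true_and, not_forall,
      not_not] at hj
    obtain ⟨i, hij, h⟩ := hj
    obtain ⟨P, hP, hi, hj⟩ := exists_stdPoint i j hij
    obtain ⟨-, h2, h3, -⟩ := zvec_stdPoint hc hP
    exact ⟨P, hP, dot_eq_zero_of_det3 (std_ne_zero hc i) (std_ne_smul hc hij.ne) h (h2 i hi)
      (h2 j hj), head_le_of_pairwise h3 hi hj hij⟩
  have hspan : ∀ p ∈ stdPoints, ∀ q ∈ stdPoints, p.1 ≠ q.1 →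
      (∀ l ∈ p.1, l ∈ q.1 → ∃ m ∈ p.1, ∃ n ∈ q.1, dep l m n = false) ∧
      ∀ a ∈ p.1, ∀ b ∈ p.1, a ≠ b → ∃ n ∈ q.1, dep a b n = false := by
    intro p hp q hq hpq
    have h := List.all_eq_true.mp (List.all_eq_true.mp spanCheck_eq_true p hp) q hq
    simp only [Bool.or_eq_true, beq_iff_eq, hpq, false_or, Bool.and_eq_true, List.all_eq_true,
      List.any_eq_true, Bool.not_eq_true', List.contains_eq_mem, decide_eq_false_iff_not] at h
    refine ⟨fun l hl hl' => ?_, fun a ha b hb hab => (h.2 a ha b hb).resolve_left hab⟩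
    exact (h.1 l hl).resolve_left (fun h => h hl')
  have hdisj : ∀ p ∈ stdPoints, ∀ q ∈ stdPoints, p.1 ≠ q.1 → On p → On q →
      ∀ l ∈ p.1, l ∉ q.1 := by
    intro p hp q hq hpq hvp hvq l hlp hlq
    obtain ⟨m, hm, n, hn, hd⟩ := (hspan p hp q hq hpq).1 l hlp hlq
    obtain ⟨hp0, hp1, -⟩ := zvec_stdPoint hc hp
    obtain ⟨hq0, hq1, -⟩ := zvec_stdPoint hc hq
    obtain ⟨k, hk⟩ := exists_eq_smul_of_det3 (x := v) (u := std c l) (v := std c m) (w := std c n)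
      (fun h => by simp [(det3_std_eq_zero_iff hc l m n).mp h] at hd)
      (det3_eq_zero_of_dot hp0 hvp (hp1 l hlp) (hp1 m hm))
      (det3_eq_zero_of_dot hq0 hvq (hq1 l hlq) (hq1 n hn))
    exact hv l k hk
  have htail : ∀ p ∈ stdPoints, p.1.tail.toFinset.card ≤ 4 := by
    intro p hp
    have h := List.all_eq_true.mp stdPoints_length_le p hp
    rw [Nat.ble_eq] at h
    exact (List.toFinset_card_le _).trans (by rw [List.length_tail]; omega)
  -- two different points on the projective line of `v`
  obtain ⟨p, hp, q, hq, hvp, hvq, hpq⟩ : ∃ p ∈ stdPoints, ∃ q ∈ stdPoints, On p ∧ On q ∧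
      p.1 ≠ q.1 := by
    obtain ⟨j, hj⟩ := Finset.card_pos.mp (show 0 < Tᶜ.card by omega)
    obtain ⟨p, hp, hvp, -⟩ := hon j hj
    obtain ⟨j', hj'⟩ := Finset.card_pos.mp (show 0 < (Tᶜ \ p.1.tail.toFinset).card by
      have := Finset.le_card_sdiff p.1.tail.toFinset Tᶜ
      have := htail p hp
      omega)
    rw [Finset.mem_sdiff] at hj'
    obtain ⟨q, hq, hvq, hjq⟩ := hon j' hj'.1
    refine ⟨p, hp, q, hq, hvp, hvq, fun h => hj'.2 ?_⟩
    rw [h]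
    exact List.mem_toFinset.mpr hjq
  have hhead : ∀ p ∈ stdPoints, p.1.headD 0 ∈ p.1 := by
    intro p hp
    obtain ⟨-, -, -, h4⟩ := zvec_stdPoint hc hp
    cases h : p.1 with
    | nil => simp [h] at h4
    | cons a l => simp
  wlog hlt : p.1.headD 0 < q.1.headD 0 generalizing p q
  · refine this q hq p hp hvq hvp hpq.symm ?_
    refine lt_of_le_of_ne (not_lt.mp hlt) fun h => ?_
    exact hdisj p hp q hq hpq hvp hvq _ (hhead p hp) (h ▸ hhead q hq)
  have hdisj' : ∀ p ∈ stdPoints, ∀ q ∈ stdPoints, p.1 ≠ q.1 → On p → On q →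
      disj p.1 q.1 = true := by
    intro p hp q hq hpq hvp hvq
    simp only [disj, List.all_eq_true, Bool.not_eq_true', List.contains_eq_mem,
      decide_eq_false_iff_not]
    exact hdisj p hp q hq hpq hvp hvq
  -- the points of the table on the line are `p`, `q` and members of `S`
  let S := (stdPoints.filter fun r => disj p.1 r.1).filter fun r => disj q.1 r.1
  have hS : ∀ r ∈ stdPoints, On r → r.1 = p.1 ∨ r.1 = q.1 ∨ r ∈ S := by
    intro r hr hvr
    by_cases h1 : r.1 = p.1
    · exact Or.inl h1
    by_cases h2 : r.1 = q.1
    · exact Or.inr (Or.inl h2)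
    refine Or.inr (Or.inr ?_)
    simp only [S, List.mem_filter]
    exact ⟨⟨hr, hdisj' p hp r hr (Ne.symm h1) hvp hvr⟩, hdisj' q hq r hr (Ne.symm h2) hvq hvr⟩
  let cls : List (Fin 15) × ZVec → ℕ := fun r => factorClass (zdot (zcross p.2 q.2) r.2)
  have hcls : ∀ r, On r → cls r = 0 ∨ 10 ≤ cls r ∧ zeval c (stdFactor (cls r)) = 0 := by
    intro r hvr
    apply factorClass_of_root hc hs
    rw [det3_zvec]
    have comm : ∀ P : List (Fin 15) × ZVec, On P → ∑ k, v k * zvec c P.2 k = 0 := by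
      intro P hP
      rw [← hP]
      exact Finset.sum_congr rfl fun k _ => mul_comm _ _
    exact det3_eq_zero_of_dot hv0 (comm p hvp) (comm q hvq) (comm r hvr)
  have hcheck := List.all_eq_true.mp lineCheck_eq_true p hp
  have hcheck := List.all_eq_true.mp hcheck q
    (List.mem_filter.mpr ⟨hq, hdisj' p hp q hq hpq hvp hvq⟩)
  rw [Bool.or_eq_true, Nat.ble_eq] at hcheck
  have hcheck := List.all_eq_true.mp (hcheck.resolve_left (not_le.mpr hlt))
  obtain ⟨j, hj1, hjm, hj⟩ : ∃ j : ℕ, j ≠ 1 ∧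
      (∃ x ∈ lineWeights p q S, x.1 = j) ∧ ∀ r ∈ S, On r → cls r = 0 ∨ cls r = j := by
    by_cases h : ∃ r ∈ S, On r ∧ cls r ≠ 0
    · obtain ⟨r, hr, hvr, hr0⟩ := h
      obtain ⟨h10, hroot⟩ := (hcls r hvr).resolve_left hr0
      refine ⟨cls r, by omega, ⟨(cls r, r.1.length - 1), ?_, rfl⟩, fun r' _ hvr' => ?_⟩
      · refine List.mem_cons_of_mem _ (List.mem_cons_of_mem _ (List.mem_filter.mpr ⟨?_, ?_⟩))
        · exact List.mem_map.mpr ⟨r, hr, rfl⟩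
        · simp only [bne_iff_ne]
          omega
      · rcases hcls r' hvr' with h | ⟨h, h'⟩
        · exact Or.inl h
        · exact Or.inr (stdFactor_root_unique hc h h10 h' hroot)
    · push Not at h
      exact ⟨0, by omega, ⟨(0, p.1.length - 1), List.mem_cons_self, rfl⟩,
        fun r hr hvr => Or.inl (h r hr hvr)⟩
  obtain ⟨x, hx, rfl⟩ := hjm
  have h6 := hcheck x hx
  rw [Nat.ble_eq] at h6
  have hsum := sum_weight_le On cls (fun r => r.1.length - 1) x.1 hj1 S hj
  simp only [lineWeights, List.map_cons, List.sum_cons, beq_self_eq_true, Bool.true_or,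
    if_true] at h6
  have hcover : Tᶜ ⊆ (p.1.tail ++ (q.1.tail ++
      (S.filter (fun r => decide (On r))).flatMap fun r => r.1.tail)).toFinset := by
    intro j hj
    obtain ⟨r, hr, hvr, hjr⟩ := hon j hj
    simp only [List.mem_toFinset, List.mem_append, List.mem_flatMap]
    rcases hS r hr hvr with h | h | h
    · exact Or.inl (h ▸ hjr)
    · exact Or.inr (Or.inl (h ▸ hjr))
    · exact Or.inr (Or.inr ⟨r, List.mem_filter.mpr ⟨h, by simpa using hvr⟩, hjr⟩)
  have hcard := (Finset.card_le_card hcover).trans (List.toFinset_card_le _)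
  simp only [List.length_append, List.length_flatMap, List.length_tail] at hcard
  have := hbad.trans hcard
  simp only [cls, S] at hsum this
  omega

end OutsideTraces

/-! ### Freeness of the standard arrangement -/

section Theta

variable {R : Type*} [CommRing R]

/-- The ternary cubic form with given coefficients. -/
def cubic (k : Fin 10 → R) (x y z : R) : R :=
  k 0 * z ^ 3 + k 1 * y * z ^ 2 + k 2 * y ^ 2 * z + k 3 * y ^ 3 + k 4 * x * z ^ 2 +
    k 5 * x * y * z + k 6 * x * y ^ 2 + k 7 * x ^ 2 * z + k 8 * x ^ 2 * y + k 9 * x ^ 3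

theorem sub_dvd_cubic_sub (k : Fin 10 → R) (x x' y z : R) :
    x - x' ∣ cubic k x y z - cubic k x' y z :=
  ⟨k 4 * z ^ 2 + k 5 * y * z + k 6 * y ^ 2 + (k 7 * z + k 8 * y) * (x + x') +
    k 9 * (x ^ 2 + x * x' + x' ^ 2), by simp only [cubic]; ring⟩

/-- Coefficients of the cubic in the middle component of the first basis derivation, where
`d = c ^ 2`. The four families of coefficients solve the linear equations `IsThetaPair`. -/
def thetaQ₁ (d : R) : Fin 10 → R :=
  ![-23 * d + 27 * d ^ 2, 9 + d + 2 * d ^ 2, 14 - 45 * d - 5 * d ^ 2, 1 + 19 * d,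
    2 * d - 19 * d ^ 2 - 11 * d ^ 3, -5 - 59 * d + 51 * d ^ 2 + 5 * d ^ 3,
    -1 - 41 * d - 18 * d ^ 2, 5 * d + 45 * d ^ 2 - 6 * d ^ 3, 22 * d + 39 * d ^ 2 - d ^ 3,
    -21 * d ^ 2 + d ^ 3]

/-- Coefficients of the cubic in the last component of the first basis derivation, where
`d = c ^ 2`. -/
def thetaR₁ (d : R) : Fin 10 → R :=
  ![-16 * d + 8 * d ^ 2, 2 + 18 * d + 28 * d ^ 2, 16 - 76 * d - 12 * d ^ 2, 6 + 26 * d,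
    24 * d + 8 * d ^ 2 - 8 * d ^ 3, -2 - 54 * d - 10 * d ^ 2 + 2 * d ^ 3, -4 - 68 * d + 16 * d ^ 2,
    -8 * d - 24 * d ^ 2 + 8 * d ^ 3, 36 * d - 18 * d ^ 2 - 2 * d ^ 3, 8 * d ^ 2]

/-- Coefficients of the cubic in the middle component of the second basis derivation, where
`d = c ^ 2`. -/
def thetaQ₂ (d : R) : Fin 10 → R :=
  ![-11 * d - d ^ 2, 5 + 29 * d - 6 * d ^ 2, -10 - 9 * d - d ^ 2, -3 + 7 * d,
    -6 * d + 25 * d ^ 2 + d ^ 3, -1 + d + 23 * d ^ 2 + d ^ 3, 3 - 5 * d - 10 * d ^ 2,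
    d + 9 * d ^ 2 - 14 * d ^ 3, -2 * d + 11 * d ^ 2 + 3 * d ^ 3, -d ^ 2 - 3 * d ^ 3]

/-- Coefficients of the cubic in the last component of the second basis derivation, where
`d = c ^ 2`. -/
def thetaR₂ (d : R) : Fin 10 → R :=
  ![-8 * d, 2 + 18 * d - 4 * d ^ 2, -4 * d - 4 * d ^ 2, -10 + 10 * d, 8 * d + 16 * d ^ 2,
    -2 - 22 * d + 22 * d ^ 2 + 2 * d ^ 3, 4 + 4 * d, -16 * d ^ 2 - 8 * d ^ 3,
    4 * d - 18 * d ^ 2 - 2 * d ^ 3, 8 * d ^ 3]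

theorem map_thetaQ₁ {S : Type*} [CommRing S] (f : R →+* S) (d : R) (i : Fin 10) :
    thetaQ₁ (f d) i = f (thetaQ₁ d i) := by
  fin_cases i <;> simp [thetaQ₁, map_ofNat f]

theorem map_thetaR₁ {S : Type*} [CommRing S] (f : R →+* S) (d : R) (i : Fin 10) :
    thetaR₁ (f d) i = f (thetaR₁ d i) := by
  fin_cases i <;> simp [thetaR₁, map_ofNat f]

theorem map_thetaQ₂ {S : Type*} [CommRing S] (f : R →+* S) (d : R) (i : Fin 10) :
    thetaQ₂ (f d) i = f (thetaQ₂ d i) := by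
  fin_cases i <;> simp [thetaQ₂, map_ofNat f]

theorem map_thetaR₂ {S : Type*} [CommRing S] (f : R →+* S) (d : R) (i : Fin 10) :
    thetaR₂ (f d) i = f (thetaR₂ d i) := by
  fin_cases i <;> simp [thetaR₂, map_ofNat f]

/-- The cubics `q`, `r` of a derivation `y q(x²,y²,z²) ∂_y + z r(x²,y²,z²) ∂_z` such that the
derivation is logarithmic for the planes of the standard arrangement: on each plane that is not a
coordinate plane, `x²` is the square of the sum of two forms `y`, `z`, proportional to the
coordinates, and the squares of the coordinates are `l y²` and `m z²`. -/
def IsThetaPair (q r : Fin 10 → R) (c : R) : Prop :=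
  ∀ l m : R, (l = 1 ∧ m = 1 ∨ l = c ^ 2 ∧ m = c ^ 2 ∨ l = c ^ 2 ∧ m = 1) → ∀ y z : R,
    y * cubic q ((y + z) ^ 2) (l * y ^ 2) (m * z ^ 2) +
      z * cubic r ((y + z) ^ 2) (l * y ^ 2) (m * z ^ 2) = 0

theorem isThetaPair₁ (c : R) : IsThetaPair (thetaQ₁ (c ^ 2)) (thetaR₁ (c ^ 2)) c := by
  rintro l m (⟨rfl, rfl⟩ | ⟨rfl, rfl⟩ | ⟨rfl, rfl⟩) y z <;>
  · simp only [cubic, thetaQ₁, thetaR₁, Matrix.cons_val]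
    ring

theorem isThetaPair₂ (c : R) : IsThetaPair (thetaQ₂ (c ^ 2)) (thetaR₂ (c ^ 2)) c := by
  rintro l m (⟨rfl, rfl⟩ | ⟨rfl, rfl⟩ | ⟨rfl, rfl⟩) y z <;>
  · simp only [cubic, thetaQ₂, thetaR₂, Matrix.cons_val]
    ring

variable {K : Type u} [Field K]

/-- The coefficients of the derivation `y q(x²,y²,z²) ∂_y + z r(x²,y²,z²) ∂_z`. -/
def theta (q r : Fin 10 → MvPolynomial (Fin 3) K) : Fin 3 → MvPolynomial (Fin 3) K :=
  ![0, X 1 * cubic q (X 0 ^ 2) (X 1 ^ 2) (X 2 ^ 2), X 2 * cubic r (X 0 ^ 2) (X 1 ^ 2) (X 2 ^ 2)]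

/-- Modulo the form `a x + e y + f z`, the square of `x` is a square of a form in `y`, `z`, and the
value of the derivation becomes one of the expressions in `IsThetaPair`. -/
theorem form_dvd_pairing_theta {q r : Fin 10 → MvPolynomial (Fin 3) K} {c a e f l m : K}
    (h : IsThetaPair q r (C c)) (ha : a ≠ 0) (hl : l * e ^ 2 = a ^ 2) (hm : m * f ^ 2 = a ^ 2)
    (hlm : l = 1 ∧ m = 1 ∨ l = c ^ 2 ∧ m = c ^ 2 ∨ l = c ^ 2 ∧ m = 1) :
    form ![a, e, f] ∣ pairing ![a, e, f] (theta q r) := by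
  set y : MvPolynomial (Fin 3) K := C (e / a) * X 1 with hy
  set z : MvPolynomial (Fin 3) K := C (f / a) * X 2 with hz
  have hyl : (X 1 ^ 2 : MvPolynomial (Fin 3) K) = C l * y ^ 2 := by
    rw [hy, mul_pow, ← mul_assoc, ← C_pow, ← C_mul, div_pow, mul_div_assoc', hl,
      div_self (pow_ne_zero 2 ha), C_1, one_mul]
  have hzm : (X 2 ^ 2 : MvPolynomial (Fin 3) K) = C m * z ^ 2 := by
    rw [hz, mul_pow, ← mul_assoc, ← C_pow, ← C_mul, div_pow, mul_div_assoc', hm,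
      div_self (pow_ne_zero 2 ha), C_1, one_mul]
  have hay : C e * X 1 = C a * y := by
    rw [hy, ← mul_assoc, ← C_mul, mul_div_cancel₀ _ ha]
  have haz : C f * X 2 = C a * z := by
    rw [hz, ← mul_assoc, ← C_mul, mul_div_cancel₀ _ ha]
  have hform : form ![a, e, f] = C a * (X 0 + (y + z)) := by
    simp only [form, Fin.sum_univ_three, Matrix.cons_val]
    linear_combination hay + haz
  have hpair : pairing ![a, e, f] (theta q r) =
      C a * (y * cubic q (X 0 ^ 2) (C l * y ^ 2) (C m * z ^ 2) +
        z * cubic r (X 0 ^ 2) (C l * y ^ 2) (C m * z ^ 2)) := by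
    rw [← hyl, ← hzm]
    simp only [pairing, theta, Fin.sum_univ_three, Matrix.cons_val, mul_zero, zero_add]
    linear_combination cubic q (X 0 ^ 2) (X 1 ^ 2) (X 2 ^ 2) * hay +
      cubic r (X 0 ^ 2) (X 1 ^ 2) (X 2 ^ 2) * haz
  rw [hform, hpair]
  apply mul_dvd_mul_left
  have h0 := h (C l) (C m) (by
    rcases hlm with ⟨rfl, rfl⟩ | ⟨rfl, rfl⟩ | ⟨rfl, rfl⟩ <;> simp) y z
  have hx : (X 0 + (y + z) : MvPolynomial (Fin 3) K) ∣ X 0 ^ 2 - (y + z) ^ 2 :=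
    ⟨X 0 - (y + z), by ring⟩
  have h1 := (hx.trans (sub_dvd_cubic_sub q (X 0 ^ 2) ((y + z) ^ 2) (C l * y ^ 2)
    (C m * z ^ 2))).mul_left y
  have h2 := (hx.trans (sub_dvd_cubic_sub r (X 0 ^ 2) ((y + z) ^ 2) (C l * y ^ 2)
    (C m * z ^ 2))).mul_left z
  have h3 := dvd_add h1 h2
  convert h3 using 1
  linear_combination h0

theorem isLog_theta {q r : Fin 10 → MvPolynomial (Fin 3) K} {c : K}
    (h : IsThetaPair q r (C c)) (hc : c ≠ 0) : IsLog (std c) Finset.univ (theta q r) := by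
  intro i _
  have h1 : ∀ e f : K, e ^ 2 = 1 → f ^ 2 = 1 →
      form ![1, e, f] ∣ pairing ![1, e, f] (theta q r) := fun e f he hf =>
    form_dvd_pairing_theta (l := 1) (m := 1) h one_ne_zero (by simp [he]) (by simp [hf]) (by simp)
  have h2 : ∀ e f : K, e ^ 2 = 1 → f ^ 2 = 1 →
      form ![c, e, f] ∣ pairing ![c, e, f] (theta q r) := fun e f he hf =>
    form_dvd_pairing_theta (l := c ^ 2) (m := c ^ 2) h hc (by simp [he]) (by simp [hf]) (by simp)
  have h3 : ∀ e f : K, e ^ 2 = 1 → f ^ 2 = c ^ 2 →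
      form ![c, e, f] ∣ pairing ![c, e, f] (theta q r) := fun e f he hf =>
    form_dvd_pairing_theta (l := c ^ 2) (m := 1) h hc (by simp [he]) (by simp [hf]) (by simp)
  fin_cases i
  · change form ![(1 : K), 0, 0] ∣ pairing ![1, 0, 0] (theta q r)
    simp [pairing, Fin.sum_univ_three, theta]
  · change form ![(0 : K), 1, 0] ∣ pairing ![0, 1, 0] (theta q r)
    simp [pairing, form, Fin.sum_univ_three, theta]
  · change form ![(0 : K), 0, 1] ∣ pairing ![0, 0, 1] (theta q r)
    simp [pairing, form, Fin.sum_univ_three, theta]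
  · exact h1 1 1 (by simp) (by simp)
  · exact h1 1 (-1) (by simp) (by simp)
  · exact h1 (-1) 1 (by simp) (by simp)
  · exact h1 (-1) (-1) (by simp) (by simp)
  · exact h2 1 1 (by simp) (by simp)
  · exact h2 1 (-1) (by simp) (by simp)
  · exact h2 (-1) 1 (by simp) (by simp)
  · exact h2 (-1) (-1) (by simp) (by simp)
  · exact h3 1 c (by simp) (by simp)
  · exact h3 1 (-c) (by simp) (by simp)
  · exact h3 (-1) c (by simp) (by simp)
  · exact h3 (-1) (-c) (by simp) (by simp)

theorem theta_isHomogeneous {q r : Fin 10 → MvPolynomial (Fin 3) K}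
    (hq : ∀ i, (q i).IsHomogeneous 0) (hr : ∀ i, (r i).IsHomogeneous 0) (i : Fin 3) :
    (theta q r i).IsHomogeneous 7 := by
  have hX : ∀ j : Fin 3, (X j ^ 2 : MvPolynomial (Fin 3) K).IsHomogeneous 2 := fun j => by
    simpa using (isHomogeneous_X K j).pow 2
  have hcub : ∀ k : Fin 10 → MvPolynomial (Fin 3) K, (∀ i, (k i).IsHomogeneous 0) →
      (cubic k (X 0 ^ 2) (X 1 ^ 2) (X 2 ^ 2)).IsHomogeneous 6 := by
    intro k hk
    refine (((((((((IsHomogeneous.add ?_ ?_).add ?_).add ?_).add ?_).add ?_).add ?_).add ?_).add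
      ?_).add ?_)
    · simpa using (hk 0).mul ((hX 2).pow 3)
    · simpa using ((hk 1).mul (hX 1)).mul ((hX 2).pow 2)
    · simpa using ((hk 2).mul ((hX 1).pow 2)).mul (hX 2)
    · simpa using (hk 3).mul ((hX 1).pow 3)
    · simpa using ((hk 4).mul (hX 0)).mul ((hX 2).pow 2)
    · simpa using (((hk 5).mul (hX 0)).mul (hX 1)).mul (hX 2)
    · simpa using ((hk 6).mul (hX 0)).mul ((hX 1).pow 2)
    · simpa using ((hk 7).mul ((hX 0).pow 2)).mul (hX 2)
    · simpa using ((hk 8).mul ((hX 0).pow 2)).mul (hX 1)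
    · simpa using (hk 9).mul ((hX 0).pow 3)
  fin_cases i
  · exact isHomogeneous_zero _ _ _
  · exact (isHomogeneous_X K 1).mul (hcub q hq)
  · exact (isHomogeneous_X K 2).mul (hcub r hr)

/-- The standard arrangement is free with exponents `(1, 7, 7)`. -/
theorem hasExps_std [CharZero K] {c : K} (hc : IsGood c) :
    HasExps (std c) Finset.univ 7 7 := by
  have hC : ∀ k : K → Fin 10 → K, ∀ k' : MvPolynomial (Fin 3) K → Fin 10 → MvPolynomial (Fin 3) K,
      (∀ i, k' (C (c ^ 2)) i = C (k (c ^ 2) i)) → ∀ i, (k' (C c ^ 2) i).IsHomogeneous 0 := by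
    intro k k' h i
    rw [← C_pow, h]
    exact isHomogeneous_C _ _
  refine ⟨theta (thetaQ₁ (C c ^ 2)) (thetaR₁ (C c ^ 2)),
    theta (thetaQ₂ (C c ^ 2)) (thetaR₂ (C c ^ 2)),
    isLog_theta (isThetaPair₁ _) hc.ne_zero, isLog_theta (isThetaPair₂ _) hc.ne_zero,
    theta_isHomogeneous (hC thetaQ₁ _ (map_thetaQ₁ C _)) (hC thetaR₁ _ (map_thetaR₁ C _)),
    theta_isHomogeneous (hC thetaQ₂ _ (map_thetaQ₂ C _)) (hC thetaR₂ _ (map_thetaR₂ C _)), ?_,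
    by simp⟩
  · -- the determinant is `x y z` times a polynomial that does not vanish at `(0, 1, 0)`
    have hdet : det3 X (theta (thetaQ₁ (C c ^ 2)) (thetaR₁ (C c ^ 2)))
        (theta (thetaQ₂ (C c ^ 2)) (thetaR₂ (C c ^ 2))) = X 0 * X 1 * X 2 *
        (cubic (thetaQ₁ (C c ^ 2)) (X 0 ^ 2) (X 1 ^ 2) (X 2 ^ 2) *
          cubic (thetaR₂ (C c ^ 2)) (X 0 ^ 2) (X 1 ^ 2) (X 2 ^ 2) -
        cubic (thetaR₁ (C c ^ 2)) (X 0 ^ 2) (X 1 ^ 2) (X 2 ^ 2) *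
          cubic (thetaQ₂ (C c ^ 2)) (X 0 ^ 2) (X 1 ^ 2) (X 2 ^ 2) :
          MvPolynomial (Fin 3) K) := by
      simp only [det3, theta, Matrix.cons_val]
      ring
    rw [hdet]
    refine mul_ne_zero (mul_ne_zero (mul_ne_zero (X_ne_zero _) (X_ne_zero _)) (X_ne_zero _)) ?_
    intro h0
    have h1 := congrArg (eval ![(0 : K), 1, 0]) h0
    simp [cubic, thetaQ₁, thetaR₁, thetaQ₂, thetaR₂] at h1
    refine mul_ne_zero (mul_ne_zero (by norm_num : (8 : K) ≠ 0) hc.quad) hc.quad' ?_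
    linear_combination h1

end Theta

/-! ### Linear changes of coordinates -/

section Frames

variable {K : Type u} [Field K] {ι : Type v}

theorem det3_vecMul {R : Type*} [CommRing R] (G : Matrix (Fin 3) (Fin 3) R) (u v w : Fin 3 → R) :
    det3 (Matrix.vecMul u G) (Matrix.vecMul v G) (Matrix.vecMul w G) = det3 u v w * G.det := by
  simp only [det3, Matrix.vecMul, dotProduct, Fin.sum_univ_three, Matrix.det_fin_three]
  ring

/-- The substitution of the forms given by the rows of a matrix. -/
def subst (G : Matrix (Fin 3) (Fin 3) K) : MvPolynomial (Fin 3) K →ₐ[K] MvPolynomial (Fin 3) K :=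
  aeval fun i => form (G i)

theorem subst_form (G : Matrix (Fin 3) (Fin 3) K) (u : Fin 3 → K) :
    subst G (form u) = form (Matrix.vecMul u G) := by
  simp only [subst, form, Fin.sum_univ_three, map_add, map_mul, aeval_X, algHom_C, algebraMap_eq,
    Matrix.vecMul, dotProduct]
  ring

theorem subst_subst (G H : Matrix (Fin 3) (Fin 3) K) (f : MvPolynomial (Fin 3) K) :
    subst H (subst G f) = subst (G * H) f := by
  have : (subst H).comp (subst G) = subst (G * H) := by
    ext i : 1
    simp only [AlgHom.comp_apply]
    conv_lhs => rw [subst, subst, aeval_X]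
    rw [← subst, subst_form, subst, aeval_X]
    rfl
  rw [← this, AlgHom.comp_apply]

theorem subst_one (f : MvPolynomial (Fin 3) K) : subst 1 f = f := by
  have : subst (1 : Matrix (Fin 3) (Fin 3) K) = AlgHom.id K _ := by
    ext i : 1
    simp [subst, form, Matrix.one_apply]
  rw [this, AlgHom.id_apply]

theorem subst_injective {G : Matrix (Fin 3) (Fin 3) K} (hG : G.det ≠ 0) :
    Function.Injective (subst G) := by
  refine Function.LeftInverse.injective (g := subst G⁻¹) fun f => ?_
  rw [subst_subst, Matrix.mul_nonsing_inv _ (isUnit_iff_ne_zero.mpr hG), subst_one]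

theorem subst_isHomogeneous (G : Matrix (Fin 3) (Fin 3) K) {f : MvPolynomial (Fin 3) K} {d : ℕ}
    (hf : f.IsHomogeneous d) : (subst G f).IsHomogeneous d := by
  have h := hf.aeval (fun i => form (G i)) (fun i => form_isHomogeneous (G i))
  simpa [subst] using h

/-- A logarithmic derivation in new coordinates. -/
def transport (G : Matrix (Fin 3) (Fin 3) K) (P : Fin 3 → MvPolynomial (Fin 3) K) :
    Fin 3 → MvPolynomial (Fin 3) K :=
  fun j => ∑ i, C (G⁻¹ j i) * subst G (P i)

theorem pairing_transport {G : Matrix (Fin 3) (Fin 3) K} (hG : G.det ≠ 0) (u : Fin 3 → K)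
    (P : Fin 3 → MvPolynomial (Fin 3) K) :
    pairing (Matrix.vecMul u G) (transport G P) = subst G (pairing u P) := by
  have h : G * G⁻¹ = 1 := Matrix.mul_nonsing_inv _ (isUnit_iff_ne_zero.mpr hG)
  have hu : ∀ i, ∑ j, Matrix.vecMul u G j * G⁻¹ j i = u i := by
    intro i
    have := congrFun (Matrix.vecMul_vecMul u G G⁻¹) i
    rw [h, Matrix.vecMul_one] at this
    rw [← this]
    rfl
  simp only [pairing, transport, map_sum, map_mul, subst, algHom_C, algebraMap_eq]
  simp_rw [Finset.mul_sum]
  rw [Finset.sum_comm]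
  refine Finset.sum_congr rfl fun i _ => ?_
  rw [← hu i, map_sum, Finset.sum_mul]
  refine Finset.sum_congr rfl fun j _ => ?_
  rw [C_mul]
  ring

theorem HasExps.vecMul {w : ι → Fin 3 → K} {s : Finset ι} {a b : ℕ} (h : HasExps w s a b)
    {G : Matrix (Fin 3) (Fin 3) K} (hG : G.det ≠ 0) :
    HasExps (fun i => Matrix.vecMul (w i) G) s a b := by
  obtain ⟨P, Q, hP, hQ, hPa, hQb, h0, hc⟩ := h
  have hlog : ∀ P, IsLog w s P → IsLog (fun i => Matrix.vecMul (w i) G) s (transport G P) := by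
    intro P hP i hi
    rw [pairing_transport hG, ← subst_form]
    exact map_dvd _ (hP i hi)
  have hhom : ∀ (P : Fin 3 → MvPolynomial (Fin 3) K) (d : ℕ), (∀ i, (P i).IsHomogeneous d) →
      ∀ i, (transport G P i).IsHomogeneous d := by
    intro P d hP j
    refine IsHomogeneous.sum _ _ _ fun i _ => ?_
    simpa using (isHomogeneous_C _ (G⁻¹ j i)).mul (subst_isHomogeneous G (hP i))
  refine ⟨transport G P, transport G Q, hlog P hP, hlog Q hQ, hhom P a hPa, hhom Q b hQb, ?_, hc⟩
  -- the values of the derivations on the forms of the rows of `G`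
  have hrow : ∀ P (i : Fin 3), pairing (G i) (transport G P) = subst G (P i) := by
    intro P i
    have h := pairing_transport hG (Pi.single i 1) P
    have hr : Matrix.vecMul (Pi.single i 1) G = G i := by
      ext j; simp
    rw [hr] at h
    rw [h]
    congr 1
    simp [pairing, Pi.single_apply]
  have hX : ∀ i : Fin 3, pairing (G i) X = subst G (X i) := fun i => by
    rw [subst, aeval_X]; rfl
  intro hz
  apply h0
  apply subst_injective hG
  have hm := map_det3 (subst G : MvPolynomial (Fin 3) K →+* MvPolynomial (Fin 3) K) X P Q
  simp only [RingHom.coe_coe, ← hX, ← hrow P, ← hrow Q] at hm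
  rw [map_zero, ← hm]
  have : det3 (fun i => pairing (G i) X) (fun i => pairing (G i) (transport G P))
      (fun i => pairing (G i) (transport G Q)) = C G.det * det3 X (transport G P)
        (transport G Q) := by
    simp only [det3, pairing, Fin.sum_univ_three, Matrix.det_fin_three, map_add, map_sub, map_mul]
    ring
  rw [this, hz, mul_zero]

end Frames

/-! ### Arrangements projectively equivalent to standard arrangements -/

section Projective

/-- The first line, different from the line `i`, through the intersection of the lines `i`
and `j`. -/
def traceRep (i j : Fin 15) : Fin 15 :=
  ((List.finRange 15).find? fun k => k != i && dep i j k).getD j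

set_option maxRecDepth 100000 in
theorem traceRep_spec : ∀ i j : Fin 15, j ≠ i →
    traceRep i j ≠ i ∧ dep i j (traceRep i j) = true ∧
      traceRep i (traceRep i j) = traceRep i j := by decide +kernel

set_option maxRecDepth 100000 in
theorem traceRep_sep : ∀ i j k : Fin 15, j ≠ i → k ≠ i → traceRep i j ≠ traceRep i k →
    dep i (traceRep i j) (traceRep i k) = false := by decide +kernel

set_option maxRecDepth 100000 in
theorem card_image_traceRep : ∀ i : Fin 15,
    ((Finset.univ.erase i).image (traceRep i)).card ≤ 7 := by decide +kernel

variable {K : Type u} [Field K] {c : K} {G : Matrix (Fin 3) (Fin 3) K}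

theorem pairwiseIndep_of_det3 {ι : Type v} {w : ι → Fin 3 → K} {s : Finset ι}
    (h0 : ∀ i ∈ s, w i ≠ 0) (h : ∀ i ∈ s, ∀ j ∈ s, i ≠ j → ∃ v, det3 (w i) (w j) v ≠ 0) :
    PairwiseIndep w s := by
  refine ⟨h0, fun i hi j hj hij a ha => ?_⟩
  obtain ⟨v, hv⟩ := h i hi j hj hij
  apply hv
  rw [ha]
  simp only [det3, Pi.smul_apply, smul_eq_mul]
  ring

variable [CharZero K]

theorem det3_std_vecMul_eq_zero_iff (hc : IsGood c) (hG : G.det ≠ 0) (i j k : Fin 15) :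
    det3 (Matrix.vecMul (std c i) G) (Matrix.vecMul (std c j) G) (Matrix.vecMul (std c k) G) = 0 ↔
      dep i j k = true := by
  rw [det3_vecMul, mul_eq_zero, or_iff_left hG, det3_std_eq_zero_iff hc]

theorem pairwiseIndep_std (hc : IsGood c) (hG : G.det ≠ 0) :
    PairwiseIndep (fun i => Matrix.vecMul (std c i) G) Finset.univ := by
  have h : ∀ i j : Fin 15, i ≠ j →
      ∃ v, det3 (Matrix.vecMul (std c i) G) (Matrix.vecMul (std c j) G) v ≠ 0 := by
    intro i j hij
    obtain ⟨k, hk⟩ := exists_dep_eq_false i j hij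
    exact ⟨Matrix.vecMul (std c k) G, fun h => by
      simp [(det3_std_vecMul_eq_zero_iff hc hG i j k).mp h] at hk⟩
  refine pairwiseIndep_of_det3 (fun i _ => ?_) fun i _ j _ hij => h i j hij
  obtain ⟨v, hv⟩ := h i (i + 1) (by revert i; decide)
  exact det3_ne_zero_left hv

theorem isFreeWithExponents_std (hc : IsGood c) (hG : G.det ≠ 0) {A : Arrangement K 3}
    (hA : A.planes = Set.range fun i => plane (Matrix.vecMul (std c i) G)) :
    A.IsFreeWithExponents ![1, 7, 7] :=
  ((hasExps_std hc).vecMul hG).isFreeWithExponents (pairwiseIndep_std hc hG) (by simp [hA])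

/-- An arrangement that is projectively equivalent to a standard arrangement with nonspecial
parameter stays isolated when planes are added or deleted one at a time through free
arrangements. -/
theorem not_isRecursivelyFree_std (hc : IsGood c) (hs : ¬ IsSpecial c) (hG : G.det ≠ 0)
    {A : Arrangement K 3}
    (hA : A.planes = Set.range fun i => plane (Matrix.vecMul (std c i) G)) :
    ¬ A.IsRecursivelyFree := by
  have hexp := (hasExps_std hc).vecMul hG
  have hind := pairwiseIndep_std hc hG
  have hA' : A.planes = (fun i => plane (Matrix.vecMul (std c i) G)) ''
      ((Finset.univ : Finset (Fin 15)) : Set _) := by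
    simp [hA]
  refine not_isRecursivelyFree_of_isolated ?_ ?_ ?_
  · rw [hA]; exact Set.range_nonempty _
  · intro B v hv hvA hB
    have hGu : IsUnit G.det := isUnit_iff_ne_zero.mpr hG
    set x := Matrix.vecMul v G⁻¹ with hx
    have hxv : Matrix.vecMul x G = v := by
      rw [hx, Matrix.vecMul_vecMul, Matrix.nonsing_inv_mul _ hGu, Matrix.vecMul_one]
    have hvs : ∀ i, ∀ k : K, v ≠ k • Matrix.vecMul (std c i) G := by
      intro i k h
      apply hvA
      rw [hA]
      exact ⟨i, ((plane_eq_plane_iff (hind.1 i (Finset.mem_univ i)) hv).mpr ⟨k, h⟩)⟩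
    have hx0 : x ≠ 0 := by
      intro h
      rw [h, Matrix.zero_vecMul] at hxv
      exact hv hxv.symm
    obtain ⟨T, hT, hTd⟩ := exists_nine_traces hc hs hx0 (fun i k h => hvs i k (by
      rw [← hxv, h, Matrix.smul_vecMul]))
    refine hexp.not_isFree_insert hind hv (fun i _ k h => ?_) (Finset.subset_univ T) ?_ hT
      (hA' ▸ hB)
    · have hk : k ≠ 0 := by
        rintro rfl
        exact hind.1 i (Finset.mem_univ i) (h.trans (zero_smul _ _))
      exact hvs i k⁻¹ (by rw [h, smul_smul, inv_mul_cancel₀ hk, one_smul])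
    · intro i hi j hj hij
      rw [← hxv, det3_vecMul]
      exact mul_ne_zero (hTd i hi j hj hij) hG
  · rintro B H hH hB
    rw [hA] at hH
    obtain ⟨i, rfl⟩ := hH
    refine hexp.not_isFree_erase (r := traceRep i) (by norm_num) hind (Finset.mem_univ i) ?_
      (card_image_traceRep i) ?_
    · have hne : ∀ j ∈ (Finset.univ : Finset (Fin 15)).erase i, j ≠ i := fun j hj =>
        Finset.ne_of_mem_erase hj
      refine ⟨fun j hj => ?_, fun j hj => ?_, fun j hj => ?_, fun j hj k hk hjk => ?_⟩
      · exact Finset.mem_erase.mpr ⟨(traceRep_spec i j (hne j hj)).1, Finset.mem_univ _⟩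
      · exact (det3_std_vecMul_eq_zero_iff hc hG _ _ _).mpr (traceRep_spec i j (hne j hj)).2.1
      · exact (traceRep_spec i j (hne j hj)).2.2
      · rw [ne_eq, det3_std_vecMul_eq_zero_iff hc hG,
          traceRep_sep i j k (hne j hj) (hne k hk) hjk]
        simp
    · rw [hB, hA', Finset.coe_erase]
      have hinj : Function.Injective fun j => plane (Matrix.vecMul (std c j) G) := by
        intro j k hjk
        by_contra hne
        obtain ⟨a, ha⟩ := (plane_eq_plane_iff (hind.1 j (Finset.mem_univ j))
          (hind.1 k (Finset.mem_univ k))).mp hjk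
        exact hind.2 j (Finset.mem_univ j) k (Finset.mem_univ k) hne a ha
      rw [Set.image_sdiff hinj, Set.image_singleton]

end Projective

/-! ### The arrangements `A_t` as standard arrangements -/

section Arr15

variable {K : Type u} [Field K]

/-- The change of coordinates from the standard arrangement with parameter `2 t - 1` to `A_t`. -/
def frame15 (t : K) : Matrix (Fin 3) (Fin 3) K := !![2, 1, 1; -2 * t, -t, -1; 0, t - 1, 0]

/-- The position of the standard normals among the normals of `A_t`. -/
def index15 : Fin 15 → Fin 15 := ![6, 9, 5, 0, 1, 7, 8, 3, 2, 14, 12, 4, 10, 13, 11]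

/-- The inverse of `index15`. -/
def index15Inv : Fin 15 → Fin 15 := ![3, 4, 8, 7, 11, 2, 0, 5, 6, 1, 12, 14, 10, 13, 9]

/-- The factors of proportionality between the standard normals and the normals of `A_t`. -/
def scale15 (t : K) : Fin 15 → K :=
  ![1, -1, t - 1, -2 * (t - 1), -2 * (t - 1), 2, 2, 2 * (t - 1), 2 * (t - 1), 2, 2, 2 * (t - 1),
    2 * (t - 1), -2, -2]

theorem index15_index15Inv : ∀ i, index15 (index15Inv i) = i := by decide

theorem std_vecMul_frame15 (t : K) (i : Fin 15) :
    Matrix.vecMul (std (2 * t - 1) i) (frame15 t) = scale15 t i • normals15 t (index15 i) := by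
  fin_cases i <;> ext j <;> fin_cases j <;>
    simp [std, frame15, scale15, normals15, index15, Matrix.vecMul, dotProduct,
      Fin.sum_univ_three] <;> ring

theorem scale15_ne_zero [CharZero K] {t : K} (ht : t ≠ 1) (i : Fin 15) : scale15 t i ≠ 0 := by
  have := sub_ne_zero.mpr ht
  fin_cases i <;> simp [scale15, this]

theorem det_frame15_ne_zero [CharZero K] {t : K} (ht : t ≠ 1) : (frame15 t).det ≠ 0 := by
  have h : (frame15 t).det = -2 * (t - 1) ^ 2 := by
    simp [frame15, Matrix.det_fin_three]; ring
  rw [h]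
  exact mul_ne_zero (by norm_num) (pow_ne_zero 2 (sub_ne_zero.mpr ht))

theorem planes_arr15 [CharZero K] {t : K} (ht : t ≠ 1) :
    (arr15 t).planes =
      Set.range fun i => plane (Matrix.vecMul (std (2 * t - 1) i) (frame15 t)) := by
  have h : ∀ i, plane (Matrix.vecMul (std (2 * t - 1) i) (frame15 t)) =
      plane (normals15 t (index15 i)) := fun i => by
    rw [std_vecMul_frame15, plane_smul (scale15_ne_zero ht i)]
  change Set.range (fun i => plane (normals15 t i)) = _
  simp_rw [h]
  ext H
  constructor
  · rintro ⟨i, rfl⟩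
    exact ⟨index15Inv i, by simp only [index15_index15Inv]⟩
  · rintro ⟨i, rfl⟩
    exact ⟨index15 i, rfl⟩

theorem IsGood.ne_one_of_two_mul_sub [CharZero K] {t : K} (h : IsGood (2 * t - 1)) : t ≠ 1 := by
  rintro rfl
  exact h.ne_one (by norm_num)

theorem isFreeWithExponents_arr15 [CharZero K] {t : K} (h : IsGood (2 * t - 1)) :
    (arr15 t).IsFreeWithExponents ![1, 7, 7] :=
  isFreeWithExponents_std h (det_frame15_ne_zero h.ne_one_of_two_mul_sub)
    (planes_arr15 h.ne_one_of_two_mul_sub)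

theorem not_isRecursivelyFree_arr15 [CharZero K] {t : K} (h : IsGood (2 * t - 1))
    (hs : ¬ IsSpecial (2 * t - 1)) : ¬ (arr15 t).IsRecursivelyFree :=
  not_isRecursivelyFree_std h hs (det_frame15_ne_zero h.ne_one_of_two_mul_sub)
    (planes_arr15 h.ne_one_of_two_mul_sub)

theorem ncard_planes_ofNormals {m n : ℕ} {w : Fin m → Fin n → K} (hw : ∀ i, w i ≠ 0)
    (h : PairwiseIndep w Finset.univ) : (ofNormals w hw).planes.ncard = m := by
  have hinj : Function.Injective fun i => plane (w i) := by
    intro j k hjk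
    by_contra hne
    obtain ⟨a, ha⟩ := (plane_eq_plane_iff (hw j) (hw k)).mp hjk
    exact h.2 j (Finset.mem_univ j) k (Finset.mem_univ k) hne a ha
  change (Set.range fun i => plane (w i)).ncard = m
  rw [← Set.image_univ, Set.ncard_image_of_injective _ hinj, Set.ncard_univ, Nat.card_fin]

theorem pairwiseIndep_smul {ι : Type v} {w : ι → Fin 3 → K} {s : Finset ι}
    (h : PairwiseIndep w s) {k : ι → K} (hk : ∀ i ∈ s, k i ≠ 0) :
    PairwiseIndep (fun i => k i • w i) s := by
  refine ⟨fun i hi => smul_ne_zero (hk i hi) (h.1 i hi), fun i hi j hj hij a ha => ?_⟩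
  refine h.2 i hi j hj hij ((k j)⁻¹ * (a * k i)) ?_
  rw [← smul_smul, ← smul_smul, ← ha, smul_smul, inv_mul_cancel₀ (hk j hj), one_smul]

theorem normals15_eq [CharZero K] {t : K} (ht : t ≠ 1) (i : Fin 15) : normals15 t i =
    (scale15 t (index15Inv i))⁻¹ • Matrix.vecMul (std (2 * t - 1) (index15Inv i)) (frame15 t) := by
  rw [std_vecMul_frame15, smul_smul, inv_mul_cancel₀ (scale15_ne_zero ht _), one_smul,
    index15_index15Inv]

theorem index15Inv_injective : Function.Injective index15Inv := by decide

theorem pairwiseIndep_normals15 [CharZero K] {t : K} (h : IsGood (2 * t - 1)) :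
    PairwiseIndep (normals15 t) Finset.univ := by
  have ht := h.ne_one_of_two_mul_sub
  have h1 := pairwiseIndep_std h (det_frame15_ne_zero ht)
  have h2 : PairwiseIndep
      (fun i => Matrix.vecMul (std (2 * t - 1) (index15Inv i)) (frame15 t)) Finset.univ :=
    ⟨fun i _ => h1.1 _ (Finset.mem_univ _), fun i _ j _ hij =>
      h1.2 _ (Finset.mem_univ _) _ (Finset.mem_univ _) (index15Inv_injective.ne hij)⟩
  have h3 := pairwiseIndep_smul h2 (k := fun i => (scale15 t (index15Inv i))⁻¹)
    fun i _ => inv_ne_zero (scale15_ne_zero ht _)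
  simp_rw [← normals15_eq ht] at h3
  exact h3

theorem ncard_planes_arr15 [CharZero K] {t : K} (h : IsGood (2 * t - 1)) :
    (arr15 t).planes.ncard = 15 :=
  ncard_planes_ofNormals _ (pairwiseIndep_normals15 h)

theorem ncard_planes_arr15_lt {t : K} {i j : Fin 15} (hij : i ≠ j) {k : K}
    (h : normals15 t j = k • normals15 t i) : (arr15 t).planes.ncard ≠ 15 := by
  have hp : plane (normals15 t i) = plane (normals15 t j) :=
    (plane_eq_plane_iff (normals15_ne_zero t i) (normals15_ne_zero t j)).mpr ⟨k, h⟩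
  have hsub : (arr15 t).planes ⊆
      (fun l => plane (normals15 t l)) '' ((Finset.univ.erase j : Finset (Fin 15)) : Set _) := by
    rintro H ⟨l, rfl⟩
    by_cases hl : l = j
    · exact ⟨i, by simpa using hij, by simp only [hl, hp]⟩
    · exact ⟨l, by simpa using hl, rfl⟩
  have h1 := Set.ncard_le_ncard hsub (Set.toFinite _)
  have h2 := Set.ncard_image_le (f := fun l => plane (normals15 t l))
    (s := ((Finset.univ.erase j : Finset (Fin 15)) : Set _)) (Set.toFinite _)
  rw [Set.ncard_coe_finset, Finset.card_erase_of_mem (Finset.mem_univ j)] at h2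
  simp only [Finset.card_univ, Fintype.card_fin] at h2
  omega

/-- The variable of `ℚ(t)` is not a root of a polynomial that does not vanish at `5`. This makes
nonvanishing a numerical check. -/
theorem exists_ratFunc_hom : ∃ f : Polynomial ℚ →+* RatFunc ℚ, f Polynomial.X = RatFunc.X ∧
    ∀ p : Polynomial ℚ, p.eval 5 ≠ 0 → f p ≠ 0 := by
  refine ⟨algebraMap _ _, RatFunc.algebraMap_X, fun p h h0 => h ?_⟩
  rw [(map_eq_zero_iff _ (RatFunc.algebraMap_injective ℚ)).mp h0, Polynomial.eval_zero]

theorem isGood_ratFunc : IsGood (2 * RatFunc.X - 1 : RatFunc ℚ) := by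
  obtain ⟨f, hX, hf⟩ := exists_ratFunc_hom
  have h2 : f 2 = 2 := map_ofNat f 2
  have h4 : f 4 = 4 := map_ofNat f 4
  rw [← hX]
  constructor
  · have := hf (2 * Polynomial.X - 1) (by norm_num)
    rwa [map_sub, map_mul, map_one, h2] at this
  · have := hf (2 * Polynomial.X - 1 - 1) (by norm_num)
    rwa [map_sub, map_sub, map_mul, map_one, h2, sub_ne_zero] at this
  · have := hf (2 * Polynomial.X - 1 - -1) (by norm_num)
    rwa [map_sub, map_sub, map_mul, map_neg, map_one, h2, sub_ne_zero] at this
  · have := hf ((2 * Polynomial.X - 1) ^ 2 - 4 * (2 * Polynomial.X - 1) - 1) (by norm_num)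
    rwa [map_sub, map_sub, map_pow, map_mul, map_sub, map_mul, map_one, h2, h4] at this
  · have := hf ((2 * Polynomial.X - 1) ^ 2 + 4 * (2 * Polynomial.X - 1) - 1) (by norm_num)
    rwa [map_sub, map_add, map_pow, map_mul, map_sub, map_mul, map_one, h2, h4] at this

theorem not_isSpecial_ratFunc : ¬ IsSpecial (2 * RatFunc.X - 1 : RatFunc ℚ) := by
  obtain ⟨f, hX, hf⟩ := exists_ratFunc_hom
  have h2 : f 2 = 2 := map_ofNat f 2
  have h3 : f 3 = 3 := map_ofNat f 3
  rw [← hX]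
  rintro (h | h | h | h | h)
  · refine hf (2 * Polynomial.X - 1 - 3) (by norm_num) ?_
    rw [map_sub, map_sub, map_mul, map_one, h2, h3, h, sub_self]
  · refine hf (2 * Polynomial.X - 1 - -3) (by norm_num) ?_
    rw [map_sub, map_sub, map_mul, map_neg, map_one, h2, h3, h, sub_self]
  · refine hf (3 * (2 * Polynomial.X - 1) - 1) (by norm_num) ?_
    rw [map_sub, map_mul, map_sub, map_mul, map_one, h2, h3, h, sub_self]
  · refine hf (3 * (2 * Polynomial.X - 1) - -1) (by norm_num) ?_
    rw [map_sub, map_mul, map_sub, map_mul, map_neg, map_one, h2, h3, h, sub_self]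
  · refine hf ((2 * Polynomial.X - 1) ^ 2 - -1) (by norm_num) ?_
    rw [map_sub, map_pow, map_sub, map_mul, map_neg, map_one, h2, h, sub_self]

theorem isGood_iff (l : ℂ) : IsGood (2 * l - 1) ↔ l ∉ excludedParams := by
  have h5 : (((Real.sqrt 5 : ℝ) : ℂ)) ^ 2 = 5 := by
    rw [← Complex.ofReal_pow, Real.sq_sqrt (by norm_num)]; norm_num
  set s : ℂ := ((Real.sqrt 5 : ℝ) : ℂ) with hs
  simp only [excludedParams, Set.mem_insert_iff, Set.mem_singleton_iff, not_or, ← hs]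
  have e1 : (2 * l - 1) ^ 2 - 4 * (2 * l - 1) - 1 = 4 * (l - (3 + s) / 2) * (l - (3 - s) / 2) := by
    linear_combination h5
  have e2 : (2 * l - 1) ^ 2 + 4 * (2 * l - 1) - 1 =
      4 * (l - (-1 + s) / 2) * (l - (-1 - s) / 2) := by
    linear_combination h5
  constructor
  · rintro ⟨h0, h1, h2, h3, h4⟩
    rw [e1] at h3
    rw [e2] at h4
    refine ⟨?_, ?_, ?_, ?_, ?_, ?_, ?_⟩ <;> rintro rfl
    · exact h2 (by norm_num)
    · exact h1 (by norm_num)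
    · exact h0 (by norm_num)
    · exact h3 (by ring)
    · exact h3 (by ring)
    · exact h4 (by ring)
    · exact h4 (by ring)
  · rintro ⟨h0, h1, h2, h3, h4, h5, h6⟩
    refine ⟨fun h => h2 ?_, fun h => h1 ?_, fun h => h0 ?_, ?_, ?_⟩
    · linear_combination h / 2
    · linear_combination h / 2
    · linear_combination h / 2
    · rw [e1]
      exact mul_ne_zero (mul_ne_zero (by norm_num) (sub_ne_zero.mpr h3)) (sub_ne_zero.mpr h4)
    · rw [e2]
      exact mul_ne_zero (mul_ne_zero (by norm_num) (sub_ne_zero.mpr h5)) (sub_ne_zero.mpr h6)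

theorem isSpecial_iff (l : ℂ) : IsSpecial (2 * l - 1) ↔ l ∈ recursivelyFreeParams := by
  simp only [IsSpecial, recursivelyFreeParams, Set.mem_insert_iff, Set.mem_singleton_iff]
  constructor
  · rintro (h | h | h | h | h)
    · exact Or.inr (Or.inr (Or.inl (by linear_combination h / 2)))
    · exact Or.inl (by linear_combination h / 2)
    · exact Or.inr (Or.inr (Or.inr (Or.inr (Or.inr (by linear_combination h / 6)))))
    · exact Or.inr (Or.inl (by linear_combination h / 6))
    · have : (2 * l - 1 - Complex.I) * (2 * l - 1 + Complex.I) = 0 := by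
        linear_combination h - Complex.I_sq
      rcases mul_eq_zero.mp this with h | h
      · exact Or.inr (Or.inr (Or.inr (Or.inl (by linear_combination h / 2))))
      · exact Or.inr (Or.inr (Or.inr (Or.inr (Or.inl (by linear_combination h / 2)))))
  · rintro (rfl | rfl | rfl | rfl | rfl | rfl)
    · exact Or.inr (Or.inl (by norm_num))
    · exact Or.inr (Or.inr (Or.inr (Or.inl (by norm_num))))
    · exact Or.inl (by norm_num)
    · exact Or.inr (Or.inr (Or.inr (Or.inr (by linear_combination Complex.I_sq))))
    · exact Or.inr (Or.inr (Or.inr (Or.inr (by linear_combination Complex.I_sq))))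
    · exact Or.inr (Or.inr (Or.inl (by norm_num)))

theorem ncard_planes_arr15_ne (l : ℂ) (hl : l ∈ ({0, 1, 1 / 2} : Set ℂ)) :
    (arr15 l).planes.ncard ≠ genericArr15.planes.ncard := by
  have hgen : genericArr15.planes.ncard = 15 := ncard_planes_arr15 isGood_ratFunc
  rw [hgen]
  rcases hl with rfl | rfl | rfl
  · refine ncard_planes_arr15_lt (i := 2) (j := 4) (by decide) (k := 1) ?_
    simp [normals15]
  · refine ncard_planes_arr15_lt (i := 3) (j := 4) (by decide) (k := 1) ?_
    simp [normals15]
  · refine ncard_planes_arr15_lt (i := 9) (j := 10) (by decide) (k := 1) ?_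
    simp [normals15]
    norm_num

end Arr15

/-! ### Inductive chains of free arrangements -/

section Chains

variable {K : Type u} [Field K] {ι : Type v} {w : ι → Fin 3 → K}

theorem hasExps_singleton {i : ι} (hi : w i ≠ 0) : HasExps w {i} 0 0 := by
  obtain ⟨p, q, hpq⟩ := exists_det3_ne_zero hi
  set v := w i with hv
  -- the cross products of `v` with `p` and `q` span the kernel of the form of `v`
  let P : (Fin 3 → K) → Fin 3 → MvPolynomial (Fin 3) K := fun p =>
    ![C (v 1 * p 2 - v 2 * p 1), C (v 2 * p 0 - v 0 * p 2), C (v 0 * p 1 - v 1 * p 0)]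
  have hlog : ∀ p, IsLog w {i} (P p) := by
    intro p j hj
    rw [Finset.mem_singleton.mp hj, ← hv]
    have : pairing v (P p) = 0 := by
      simp only [pairing, P, Fin.sum_univ_three, Matrix.cons_val, ← C_mul, ← C_add]
      rw [← C_0]
      congr 1
      ring
    rw [this]
    exact dvd_zero _
  have hhom : ∀ p j, (P p j).IsHomogeneous 0 := by
    intro p j
    fin_cases j <;> exact isHomogeneous_C _ _
  refine ⟨P p, P q, hlog p, hlog q, hhom p, hhom q, ?_, by simp⟩
  have h : det3 X (P p) (P q) = form v * C (det3 p q v) := by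
    simp only [det3, P, form, Fin.sum_univ_three, Matrix.cons_val, map_add, map_sub, map_mul]
    ring
  rw [h]
  exact mul_ne_zero (form_ne_zero hi) (C_ne_zero.mpr hpq)

/-- A boolean table of the dependent triples of a family of forms. -/
def IsDepTable (w : ι → Fin 3 → K) (d : ι → ι → ι → Bool) : Prop :=
  ∀ i j k, det3 (w i) (w j) (w k) = 0 ↔ d i j k = true

/-- The first member of a list that has the same trace on the plane `i` as the plane `j`. -/
def listRep (d : ι → ι → ι → Bool) (i : ι) (s : List ι) (j : ι) : ι :=
  (s.find? fun k => d i j k).getD j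

/-- The number of traces on the plane `i` of the planes in a list. -/
def traceCount [DecidableEq ι] (d : ι → ι → ι → Bool) (i : ι) (s : List ι) : ℕ :=
  (s.map (listRep d i s)).dedup.length

/-- The exponents `(1, a, b)` obtained by adding the planes of a list one after the other,
starting at its end, as long as the addition theorem applies. -/
def chainExps [DecidableEq ι] (d : ι → ι → ι → Bool) : List ι → Option (ℕ × ℕ)
  | [] => none
  | [_] => some (0, 0)
  | i :: s =>
    match chainExps d s with
    | none => none
    | some e =>
      if traceCount d i s == 1 + e.1 then some (e.1, e.2 + 1)
      else if traceCount d i s == 1 + e.2 then some (e.1 + 1, e.2)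
      else none

theorem isTraceChoice_listRep [DecidableEq ι] {d : ι → ι → ι → Bool} (hd : IsDepTable w d) {i : ι}
    {s : List ι} (hw : PairwiseIndep w (insert i s.toFinset)) (his : i ∉ s) :
    IsTraceChoice w s.toFinset (w i) (listRep d i s) := by
  have hrefl : ∀ j, d i j j = true := fun j => (hd i j j).mp (by simp only [det3]; ring)
  have hi : w i ≠ 0 := hw.1 i (Finset.mem_insert_self _ _)
  have hij : ∀ j ∈ s, ∀ k : K, w j ≠ k • w i := fun j hj =>
    hw.2 i (Finset.mem_insert_self _ _) j (Finset.mem_insert_of_mem (List.mem_toFinset.mpr hj))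
      (by rintro rfl; exact his hj)
  have htrans : ∀ j ∈ s, ∀ k l, d i j k = true → d i j l = true → d i k l = true := by
    intro j hj k l hk hl
    rw [← hd] at hk hl ⊢
    obtain ⟨a, b, hab⟩ := exists_eq_add_of_det3_eq_zero hi (hij j hj) hk
    obtain ⟨a', b', hab'⟩ := exists_eq_add_of_det3_eq_zero hi (hij j hj) hl
    rw [hab, hab']
    simp only [det3, Pi.add_apply, Pi.smul_apply, smul_eq_mul]
    ring
  have hsymm : ∀ j k, d i j k = true → d i k j = true := by
    intro j k h
    rw [← hd] at h ⊢
    rw [det3_swap, h, neg_zero]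
  have hrep : ∀ j ∈ s, listRep d i s j ∈ s ∧ d i j (listRep d i s j) = true := by
    intro j hj
    unfold listRep
    cases h : s.find? fun k => d i j k with
    | none => exact absurd (hrefl j) (by simpa using List.find?_eq_none.mp h j hj)
    | some k => exact ⟨List.mem_of_find?_eq_some h, by simpa using List.find?_some h⟩
  have hcongr : ∀ j ∈ s, ∀ k ∈ s, d i j k = true → listRep d i s j = listRep d i s k := by
    intro j hj k hk hjk
    have : ∀ l, d i j l = d i k l := by
      intro l
      rw [Bool.eq_iff_iff]
      exact ⟨fun h => htrans j hj k l hjk h, fun h => htrans k hk j l (hsymm j k hjk) h⟩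
    have hs : (s.find? fun k => d i j k) ≠ none := fun h =>
      absurd (hrefl j) (by simpa using List.find?_eq_none.mp h j hj)
    unfold listRep
    simp_rw [← this]
    cases h : s.find? fun k => d i j k with
    | none => exact absurd h hs
    | some l => rfl
  refine ⟨fun j hj => ?_, fun j hj => ?_, fun j hj => ?_, fun j hj k hk hjk => ?_⟩
  · exact List.mem_toFinset.mpr (hrep j (List.mem_toFinset.mp hj)).1
  · exact (hd _ _ _).mpr (hrep j (List.mem_toFinset.mp hj)).2
  · have := hrep j (List.mem_toFinset.mp hj)
    exact (hcongr j (List.mem_toFinset.mp hj) _ this.1 this.2).symm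
  · intro h
    have hj' := hrep j (List.mem_toFinset.mp hj)
    have hk' := hrep k (List.mem_toFinset.mp hk)
    have h1 := hcongr j (List.mem_toFinset.mp hj) _ hj'.1 hj'.2
    have h2 := hcongr k (List.mem_toFinset.mp hk) _ hk'.1 hk'.2
    exact hjk (h1.trans ((hcongr _ hj'.1 _ hk'.1 ((hd _ _ _).mp h)).trans h2.symm))

theorem hasExps_of_chainExps [DecidableEq ι] {d : ι → ι → ι → Bool} (hd : IsDepTable w d) :
    ∀ (l : List ι) (a b : ℕ), l.Nodup → PairwiseIndep w l.toFinset →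
      chainExps d l = some (a, b) → HasExps w l.toFinset a b
  | [], a, b, _, _, h => by simp [chainExps] at h
  | [i], a, b, _, hw, h => by
    simp only [chainExps, Option.some.injEq, Prod.mk.injEq] at h
    obtain ⟨rfl, rfl⟩ := h
    simpa using hasExps_singleton (hw.1 i (by simp))
  | i :: j :: s, a, b, hl, hw, h => by
    rw [List.nodup_cons] at hl
    rw [chainExps] at h
    swap
    · simp
    set t := j :: s with ht
    cases he : chainExps d t with
    | none => simp [he] at h
    | some e =>
      have hwt : PairwiseIndep w (insert i t.toFinset) := by rwa [List.toFinset_cons] at hw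
      have ih := hasExps_of_chainExps hd t e.1 e.2 hl.2
        (hwt.mono (Finset.subset_insert _ _)) he
      have htr := isTraceChoice_listRep hd hwt hl.1
      have hcount : (t.toFinset.image (listRep d i t)).card = traceCount d i t := by
        rw [traceCount, ← List.card_toFinset]
        congr 1
        ext x
        simp
      have hit : i ∉ t.toFinset := by simpa using hl.1
      rw [List.toFinset_cons]
      simp only [he] at h
      split_ifs at h with h1 h2
      · simp only [Option.some.injEq, Prod.mk.injEq] at h
        obtain ⟨rfl, rfl⟩ := h
        exact ih.insert_plane hit hwt htr (by rw [hcount]; simpa using h1)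
      · simp only [Option.some.injEq, Prod.mk.injEq] at h
        obtain ⟨rfl, rfl⟩ := h
        exact (ih.symm.insert_plane hit hwt htr (by rw [hcount]; simpa using h2)).symm

theorem chainExps_isSome_of_cons [DecidableEq ι] {d : ι → ι → ι → Bool} {i : ι} {s : List ι}
    (hs : s ≠ []) (h : (chainExps d (i :: s)).isSome) : (chainExps d s).isSome := by
  rw [chainExps] at h
  · cases he : chainExps d s with
    | none => simp [he] at h
    | some e => rfl
  · rintro rfl; exact hs rfl

theorem chainExps_isSome_of_suffix [DecidableEq ι] {d : ι → ι → ι → Bool} {s : List ι} :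
    ∀ {l : List ι}, s ≠ [] → s <:+ l → (chainExps d l).isSome → (chainExps d s).isSome
  | [], hs, h, _ => absurd (List.suffix_nil.mp h) hs
  | i :: l, hs, h, hl => by
    rcases List.suffix_cons_iff.mp h with rfl | h
    · exact hl
    · refine chainExps_isSome_of_suffix hs h (chainExps_isSome_of_cons ?_ hl)
      rintro rfl
      exact hs (List.suffix_nil.mp h)

/-- The arrangement of the planes in a list. -/
def listArr (w : ι → Fin 3 → K) (hw : ∀ i, w i ≠ 0) (l : List ι) : Arrangement K 3 where
  planes := (fun i => plane (w i)) '' {i | i ∈ l}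
  finite_planes := (List.finite_toSet l).image _
  isHyperplane := by
    rintro H ⟨i, -, rfl⟩
    exact ⟨w i, hw i, rfl⟩

theorem isFree_of_planes_eq_empty {A : Arrangement K 3} (h : A.planes = ∅) : A.IsFree := by
  refine ⟨0, isFreeWithExponents_of_det_ne_zero (ι := Empty) (w := Empty.elim) (s := ∅) ?_ ?_
    (P := 1) ?_ ?_ ?_ ?_⟩
  · exact ⟨by simp, by simp⟩
  · simp [h]
  · intro k i hi; simp at hi
  · intro k j
    rw [Matrix.one_apply]
    split_ifs
    · exact isHomogeneous_one _ _
    · exact isHomogeneous_zero _ _ _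
  · simp
  · simp

theorem isFree_listArr [DecidableEq ι] {d : ι → ι → ι → Bool} (hd : IsDepTable w d)
    (hw : ∀ i, w i ≠ 0) {l : List ι} (hl : l.Nodup) (hwl : PairwiseIndep w l.toFinset)
    (h : (chainExps d l).isSome) : (listArr w hw l).IsFree := by
  obtain ⟨⟨a, b⟩, he⟩ := Option.isSome_iff_exists.mp h
  refine ⟨_, (hasExps_of_chainExps hd l a b hl hwl he).isFreeWithExponents hwl ?_⟩
  simp [listArr]

/-- If the addition theorem applies along a list, and the planes of the list except for one form
a free arrangement, then this arrangement is recursively free. -/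
theorem isRecursivelyFree_of_chain [DecidableEq ι] {d : ι → ι → ι → Bool} (hd : IsDepTable w d)
    (hw : ∀ i, w i ≠ 0) {l : List ι} (hl : l.Nodup) (hwl : PairwiseIndep w l.toFinset)
    (h : (chainExps d l).isSome) {i : ι} (hi : i ∈ l) {A : Arrangement K 3}
    (hA : A.planes = (fun i => plane (w i)) '' {j | j ∈ l ∧ j ≠ i}) (hfree : A.IsFree) :
    A.IsRecursivelyFree := by
  have hinj : Set.InjOn (fun i => plane (w i)) {j | j ∈ l} := by
    intro j hj k hk hjk
    by_contra hne
    obtain ⟨a, ha⟩ := (plane_eq_plane_iff (hw j) (hw k)).mp hjk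
    exact hwl.2 j (by simpa using hj) k (by simpa using hk) hne a ha
  have hstep : ∀ S T : Set ι, S ⊆ {j | j ∈ l} → ∀ j ∈ l, j ∉ S → T = insert j S →
      (symmDiff ((fun i => plane (w i)) '' S) ((fun i => plane (w i)) '' T)).ncard = 1 := by
    rintro S T hS j hj hjS rfl
    rw [Set.ncard_eq_one]
    refine ⟨plane (w j), ?_⟩
    rw [Set.image_insert_eq, Set.symmDiff_def, Set.sdiff_eq_empty.mpr (Set.subset_insert _ _),
      Set.empty_union, Set.insert_sdiff_of_notMem, Set.sdiff_self, insert_empty_eq]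
    rintro ⟨k, hk, hkj⟩
    exact hjS (hinj (hS hk) hj hkj ▸ hk)
  let n := l.length
  refine ⟨n + 1, fun k => if k ≤ n then listArr w hw (l.drop (n - k)) else A, ?_, ?_, ?_, ?_⟩
  · simp [n, listArr]
  · simp
  · intro k hk
    rcases Nat.lt_succ_iff_lt_or_eq.mp hk with hk | rfl
    · simp only [hk.le, Nat.succ_le_of_lt hk, if_true]
      have hdrop : l.drop (n - (k + 1)) = l[n - (k + 1)] :: l.drop (n - k) := by
        rw [List.drop_eq_getElem_cons (by omega)]
        congr 2
        omega
      have hnd : (l[n - (k + 1)] :: l.drop (n - k)).Nodup :=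
        hdrop ▸ hl.sublist (List.drop_sublist _ _)
      refine hstep _ _ (fun j hj => List.mem_of_mem_drop hj) l[n - (k + 1)]
        (List.getElem_mem _) (List.nodup_cons.mp hnd).1 ?_
      ext j
      simp only [hdrop, Set.mem_ofPred_eq, List.mem_cons, Set.mem_insert_iff]
    · simp only [le_refl, if_true, Nat.sub_self, List.drop_zero, add_le_iff_nonpos_right,
        nonpos_iff_eq_zero, one_ne_zero, if_false]
      rw [symmDiff_comm, hA]
      refine hstep _ _ (fun j hj => hj.1) i hi (fun h => h.2 rfl) ?_
      ext j
      simp only [Set.mem_ofPred_eq, Set.mem_insert_iff]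
      by_cases hj : j = i <;> simp [hj, hi]
  · intro k hk
    simp only
    split_ifs with hkn
    · by_cases hk0 : k = 0
      · apply isFree_of_planes_eq_empty
        simp [listArr, hk0, n]
      · have hsuf : l.drop (n - k) <:+ l := List.drop_suffix _ _
        refine isFree_listArr hd hw (hl.sublist hsuf.sublist) (hwl.mono ?_)
          (chainExps_isSome_of_suffix ?_ hsuf h)
        · intro j hj
          simp only [List.mem_toFinset] at hj ⊢
          exact hsuf.subset hj
        · rw [ne_eq, List.drop_eq_nil_iff]
          omega
    · exact hfree

end Chains

/-! ### The special and the degenerate parameters -/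

section SpecialParams

/-- Elimination of the lowest coefficients, a test for divisibility by `m` up to powers of the
variable and integer factors. The number bounds the steps of the elimination. -/
def zdvd (m : List ℤ) : ℕ → List ℤ → Bool
  | _, [] => true
  | 0, _ => false
  | n + 1, a :: p =>
    bif p.length.blt m.tail.length then false
    else zdvd m n (ztrim (zsub (zsmul (m.headD 0) p) (zsmul a m.tail)))

theorem zeval_eq_zero_of_zdvd {K : Type u} [Field K] [CharZero K] {c : K} (hc : c ≠ 0)
    {m : List ℤ} (hm0 : m.headD 0 ≠ 0) (hm : zeval c m = 0) :
    ∀ (n : ℕ) (p : List ℤ), zdvd m n p = true → zeval c p = 0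
  | _, [], _ => rfl
  | 0, _ :: _, h => by simp [zdvd] at h
  | n + 1, a :: p, h => by
    rw [zdvd] at h
    cases hl : p.length.blt m.tail.length with
    | true =>
      rw [hl, cond_true] at h
      exact absurd h Bool.false_ne_true
    | false =>
      rw [hl, cond_false] at h
      have ih := zeval_eq_zero_of_zdvd hc hm0 hm n _ h
      simp only [zeval_ztrim, zeval_zsub, zeval_zsmul] at ih
      have hm' : zeval c m = m.headD 0 + c * zeval c m.tail := by
        cases m <;> simp [zeval] at hm0 ⊢
      apply (mul_eq_zero.mp (_ : ((m.headD 0 : ℤ) : K) * zeval c (a :: p) = 0)).resolve_left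
        (Int.cast_ne_zero.mpr hm0)
      rw [hm'] at hm
      simp only [zeval]
      linear_combination c * ih + a * hm

/-- The symmetric table with given values at increasing triples, where triples with equal members
are dependent. -/
def sortedTable {n : ℕ} (t : Fin n → Fin n → Fin n → Bool) (i j k : Fin n) : Bool :=
  i == j || j == k || i == k ||
    t (min i (min j k)) (max (min i j) (min (max i j) k)) (max i (max j k))

theorem isDepTable_sortedTable {K : Type u} [Field K] {n : ℕ} {w : Fin n → Fin 3 → K}
    {t : Fin n → Fin n → Fin n → Bool}
    (h : ∀ i j k, i < j → j < k → (det3 (w i) (w j) (w k) = 0 ↔ t i j k = true)) :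
    IsDepTable w (sortedTable t) := by
  have swap1 : ∀ u v w : Fin 3 → K, det3 v u w = -det3 u v w := fun u v w => by
    simp only [det3]; ring
  have step1 : ∀ i j k : Fin n,
      (det3 (w i) (w j) (w k) = 0 ↔ sortedTable t i j k = true) →
      (det3 (w j) (w i) (w k) = 0 ↔ sortedTable t j i k = true) := by
    intro i j k h
    have : sortedTable t j i k = sortedTable t i j k := by
      simp only [sortedTable]
      rw [min_left_comm j i k, max_left_comm j i k, min_comm j i, max_comm j i]
      simp only [Bool.beq_comm (a := j) (b := i)]
      cases i == j <;> cases i == k <;> cases j == k <;> rfl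
    rw [swap1, neg_eq_zero, h, this]
  have step2 : ∀ i j k : Fin n,
      (det3 (w i) (w j) (w k) = 0 ↔ sortedTable t i j k = true) →
      (det3 (w i) (w k) (w j) = 0 ↔ sortedTable t i k j = true) := by
    intro i j k h
    have : sortedTable t i k j = sortedTable t i j k := by
      simp only [sortedTable]
      have hm : max (min i k) (min (max i k) j) = max (min i j) (min (max i j) k) := by
        rcases le_total i j with h1 | h1 <;> rcases le_total j k with h2 | h2 <;>
          rcases le_total i k with h3 | h3 <;> simp [h1, h2, h3] <;> order
      rw [hm, min_comm k j, max_comm k j]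
      simp only [Bool.beq_comm (a := k) (b := j)]
      cases i == j <;> cases i == k <;> cases j == k <;> rfl
    rw [det3_swap, neg_eq_zero, h, this]
  have key : ∀ i j k : Fin n, i < j → j < k →
      (det3 (w i) (w j) (w k) = 0 ↔ sortedTable t i j k = true) := by
    intro i j k hij hjk
    rw [h i j k hij hjk]
    simp [sortedTable, hij.ne, hjk.ne, (hij.trans hjk).ne, hij.le, hjk.le, (hij.trans hjk).le]
  have hdeg : ∀ u v : Fin 3 → K, det3 u u v = 0 ∧ det3 u v u = 0 ∧ det3 v u u = 0 := fun u v => by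
    simp only [det3]; exact ⟨by ring, by ring, by ring⟩
  intro i j k
  rcases lt_trichotomy i j with hij | rfl | hij
  · rcases lt_trichotomy j k with hjk | rfl | hjk
    · exact key i j k hij hjk
    · simp [(hdeg (w j) (w i)).2.2, sortedTable]
    · rcases lt_trichotomy i k with hik | rfl | hik
      · exact step2 _ _ _ (key i k j hik hjk)
      · simp [(hdeg (w i) (w j)).2.1, sortedTable]
      · exact step2 _ _ _ (step1 _ _ _ (key k i j hik hij))
  · simp [(hdeg (w i) (w k)).1, sortedTable]
  · rcases lt_trichotomy i k with hik | rfl | hik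
    · exact step1 _ _ _ (key j i k hij hik)
    · simp [(hdeg (w i) (w j)).2.1, sortedTable]
    · rcases lt_trichotomy j k with hjk | rfl | hjk
      · exact step1 _ _ _ (step2 _ _ _ (key j k i hjk hik))
      · simp [(hdeg (w j) (w i)).2.2, sortedTable]
      · exact step1 _ _ _ (step2 _ _ _ (step1 _ _ _ (key k j i hjk hij)))

variable {n : ℕ}

/-- The increasing triples of members of a family of polynomial vectors whose values at the roots of
the polynomial `m` are dependent. -/
def depAt (W : Fin n → ZVec) (m : List ℤ) (i j k : Fin n) : Bool :=
  zdvd m 20 (ztrim (zdot (zcross (W i) (W j)) (W k)))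

/-- The test that all determinants are either divisible by `m` or prime to `m`. -/
def depAtCheck (W : Fin n → ZVec) (m : List ℤ) : Bool :=
  (m.headD 0 != 0) && (List.finRange n).all fun i => (List.finRange n).all fun j =>
    Nat.ble j.val i.val || (List.finRange n).all fun k =>
      Nat.ble k.val j.val || depAt W m i j k ||
        zcoprime 20 m (ztrim (zdot (zcross (W i) (W j)) (W k)))

theorem isDepTable_depAt {K : Type u} [Field K] [CharZero K] {c : K} (hc : c ≠ 0) {m : List ℤ}
    (hm : zeval c m = 0) {W : Fin n → ZVec} (h : depAtCheck W m = true) :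
    IsDepTable (fun i => zvec c (W i)) (sortedTable (depAt W m)) := by
  simp only [depAtCheck, Bool.and_eq_true, bne_iff_ne, ne_eq] at h
  refine isDepTable_sortedTable fun i j k hij hjk => ?_
  rw [← det3_zvec, ← zeval_ztrim]
  refine ⟨fun h0 => ?_, fun h0 => zeval_eq_zero_of_zdvd hc h.1 hm _ _ h0⟩
  have h := List.all_eq_true.mp (List.all_eq_true.mp h.2 i (List.mem_finRange i)) j
    (List.mem_finRange j)
  rw [Bool.or_eq_true, Nat.ble_eq] at h
  have h := List.all_eq_true.mp (h.resolve_left (not_le.mpr hij)) k (List.mem_finRange k)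
  rw [Bool.or_eq_true, Bool.or_eq_true, Nat.ble_eq, or_assoc] at h
  refine (h.resolve_left (not_le.mpr hjk)).resolve_right fun hz => ?_
  exact not_common_root_of_zcoprime c hc _ _ _ hz hm h0

theorem IsDepTable.vecMul {K : Type u} [Field K] {ι : Type v} {w : ι → Fin 3 → K}
    {d : ι → ι → ι → Bool} (h : IsDepTable w d) {G : Matrix (Fin 3) (Fin 3) K} (hG : G.det ≠ 0) :
    IsDepTable (fun i => Matrix.vecMul (w i) G) d := by
  intro i j k
  rw [det3_vecMul, mul_eq_zero, or_iff_left hG]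
  exact h i j k

/-- The test that a table of dependent triples comes from pairwise independent vectors. -/
def pairCheck (d : Fin n → Fin n → Fin n → Bool) : Bool :=
  (List.finRange n).all fun i => (List.finRange n).all fun j => i == j ||
    (List.finRange n).any fun k => !d i j k

theorem IsDepTable.pairwiseIndep {K : Type u} [Field K] {w : Fin n → Fin 3 → K}
    {d : Fin n → Fin n → Fin n → Bool} (h : IsDepTable w d) (hp : pairCheck d = true)
    (hn : 1 < n) : PairwiseIndep w Finset.univ := by
  have key : ∀ i j : Fin n, i ≠ j → ∃ v, det3 (w i) (w j) v ≠ 0 := by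
    intro i j hij
    have hp := List.all_eq_true.mp (List.all_eq_true.mp hp i (List.mem_finRange i)) j
      (List.mem_finRange j)
    simp only [Bool.or_eq_true, beq_iff_eq, hij, false_or, List.any_eq_true,
      Bool.not_eq_true'] at hp
    obtain ⟨k, -, hk⟩ := hp
    exact ⟨w k, fun h0 => by simp [(h i j k).mp h0] at hk⟩
  refine pairwiseIndep_of_det3 (fun i _ => ?_) fun i _ j _ hij => key i j hij
  have : Nontrivial (Fin n) := Fin.nontrivial_iff_two_le.mpr hn
  obtain ⟨j, hj⟩ := exists_ne i
  obtain ⟨v, hv⟩ := key i j hj.symm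
  exact det3_ne_zero_left hv

/-- The standard normals together with an additional vector, which has the last index. -/
def extendedZ (x : ZVec) : Fin 16 → ZVec := Fin.snoc (α := fun _ => ZVec) stdZ x

/-- The test that the addition theorem leads along the list `l` to the standard arrangement with
the additional plane `x`, for the parameters that are roots of `m`. -/
def specialCheck (m : List ℤ) (x : ZVec) (l : List (Fin 16)) : Bool :=
  depAtCheck (extendedZ x) m && pairCheck (sortedTable (depAt (extendedZ x) m)) &&
    (chainExps (sortedTable (depAt (extendedZ x) m)) l).isSome && decide l.Nodup &&
    decide (∀ i, i ∈ l)

variable {K : Type u} [Field K] [CharZero K] {c : K} {G : Matrix (Fin 3) (Fin 3) K}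

theorem isRecursivelyFree_of_specialCheck (hc : IsGood c) (hG : G.det ≠ 0) {A : Arrangement K 3}
    (hA : A.planes = Set.range fun i => plane (Matrix.vecMul (std c i) G)) {m : List ℤ}
    (hm : zeval c m = 0) {x : ZVec} {l : List (Fin 16)} (h : specialCheck m x l = true) :
    A.IsRecursivelyFree := by
  simp only [specialCheck, Bool.and_eq_true, decide_eq_true_eq] at h
  obtain ⟨⟨⟨⟨h1, h2⟩, h3⟩, h4⟩, h5⟩ := h
  have hd := (isDepTable_depAt hc.ne_zero hm h1).vecMul hG
  have hw := hd.pairwiseIndep h2 (by norm_num)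
  refine isRecursivelyFree_of_chain hd (fun i => hw.1 i (Finset.mem_univ i)) h4
    (hw.mono (Finset.subset_univ _)) h3 (h5 (Fin.last 15)) ?_
    ⟨_, isFreeWithExponents_std hc hG hA⟩
  have hcast : ∀ i : Fin 15, zvec c (extendedZ x i.castSucc) = std c i := fun i => by
    rw [extendedZ, Fin.snoc_castSucc, zvec_stdZ]
  rw [hA]
  ext H
  constructor
  · rintro ⟨i, rfl⟩
    exact ⟨i.castSucc, ⟨h5 _, (Fin.castSucc_lt_last i).ne⟩, by simp only [hcast]⟩
  · rintro ⟨i, ⟨-, hi⟩, rfl⟩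
    obtain ⟨j, rfl⟩ := Fin.exists_castSucc_eq.mpr hi
    exact ⟨j, by simp only [hcast]⟩

/-! The additional plane has the normal `(0, 1, -1)` for `c = ±3`, `(1, 0, -1)` for `c = ±1/3`, and
`(0, 1, -c)` for `c² = -1`. -/

set_option maxRecDepth 100000 in
theorem specialCheck_three :
    specialCheck [-3, 1] ([], [1], [-1]) [3, 6, 4, 5, 0, 11, 1, 7, 8, 2, 9, 12, 10, 13, 14, 15] =
      true := by decide +kernel

set_option maxRecDepth 100000 in
theorem specialCheck_neg_three :
    specialCheck [3, 1] ([], [1], [-1]) [3, 6, 4, 5, 0, 12, 1, 7, 8, 2, 9, 11, 10, 13, 14, 15] =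
      true := by decide +kernel

set_option maxRecDepth 100000 in
theorem specialCheck_third :
    specialCheck [-1, 3] ([1], [], [-1]) [3, 5, 4, 6, 0, 7, 1, 8, 9, 11, 2, 10, 12, 13, 14, 15] =
      true := by decide +kernel

set_option maxRecDepth 100000 in
theorem specialCheck_neg_third :
    specialCheck [1, 3] ([1], [], [-1]) [3, 5, 4, 6, 0, 8, 1, 7, 10, 11, 2, 9, 12, 13, 14, 15] =
      true := by decide +kernel

set_option maxRecDepth 100000 in
theorem specialCheck_I :
    specialCheck [1, 0, 1] ([], [1], [0, -1])
      [11, 14, 12, 13, 1, 2, 3, 6, 7, 0, 5, 8, 9, 10, 4, 15] = true := by decide +kernel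

/-- For special parameters, the standard arrangement and one additional plane form an inductively
free arrangement. -/
theorem isRecursivelyFree_std (hc : IsGood c) (hs : IsSpecial c) (hG : G.det ≠ 0)
    {A : Arrangement K 3}
    (hA : A.planes = Set.range fun i => plane (Matrix.vecMul (std c i) G)) :
    A.IsRecursivelyFree := by
  rcases hs with h | h | h | h | h
  · exact isRecursivelyFree_of_specialCheck hc hG hA
      (by simp only [zeval]; push_cast; linear_combination h) specialCheck_three
  · exact isRecursivelyFree_of_specialCheck hc hG hA
      (by simp only [zeval]; push_cast; linear_combination h) specialCheck_neg_three
  · exact isRecursivelyFree_of_specialCheck hc hG hA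
      (by simp only [zeval]; push_cast; linear_combination h) specialCheck_third
  · exact isRecursivelyFree_of_specialCheck hc hG hA
      (by simp only [zeval]; push_cast; linear_combination h) specialCheck_neg_third
  · exact isRecursivelyFree_of_specialCheck hc hG hA
      (by simp only [zeval]; push_cast; linear_combination h) specialCheck_I

theorem isGood_of_isSpecial (hs : IsSpecial c) : IsGood c := by
  rcases hs with h | h | h | h | h
  · subst h; constructor <;> norm_num
  · subst h; constructor <;> norm_num
  · have : c = 1 / 3 := by linear_combination h / 3
    subst this; constructor <;> norm_num
  · have : c = -1 / 3 := by linear_combination h / 3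
    subst this; constructor <;> norm_num
  · have h0 : c ≠ 0 := by rintro rfl; norm_num at h
    refine ⟨h0, ?_, ?_, ?_, ?_⟩
    · rintro rfl; norm_num at h
    · rintro rfl; norm_num at h
    · intro h'
      have h2 : c = -1 / 2 := by linear_combination (h - h') / 4
      subst h2; norm_num at h
    · intro h'
      have h2 : c = 1 / 2 := by linear_combination (h' - h) / 4
      subst h2; norm_num at h

theorem isRecursivelyFree_arr15 {t : K} (hs : IsSpecial (2 * t - 1)) :
    (arr15 t).IsRecursivelyFree := by
  have h := isGood_of_isSpecial hs
  exact isRecursivelyFree_std h hs (det_frame15_ne_zero h.ne_one_of_two_mul_sub)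
    (planes_arr15 h.ne_one_of_two_mul_sub)

end SpecialParams

/-! ### The icosahedral normals -/

section Icosahedral

/-- The icosahedral normals as vectors of polynomials in the golden ratio `τ`, with
`τ⁻¹ = τ - 1`. -/
def icosahedralZ : Fin 15 → ZVec :=
  ![([1], [], []), ([], [1], []), ([], [], [1]),
    ([1], [0, 1], [-1, 1]), ([1], [0, 1], [1, -1]), ([1], [0, -1], [-1, 1]),
    ([1], [0, -1], [1, -1]),
    ([-1, 1], [1], [0, 1]), ([1, -1], [1], [0, 1]), ([-1, 1], [1], [0, -1]),
    ([1, -1], [1], [0, -1]),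
    ([0, 1], [-1, 1], [1]), ([0, 1], [1, -1], [1]), ([0, -1], [-1, 1], [1]),
    ([0, -1], [1, -1], [1])]

theorem zvec_icosahedralZ (i : Fin 15) :
    zvec Real.goldenRatio (icosahedralZ i) = icosahedralNormals i := by
  have h : Real.goldenRatio⁻¹ = Real.goldenRatio - 1 := by
    rw [inv_eq_iff_eq_inv, eq_comm]
    apply inv_eq_of_mul_eq_one_left
    linear_combination Real.goldenRatio_sq
  fin_cases i <;> ext j <;> fin_cases j <;>
    simp [zvec, icosahedralZ, icosahedralNormals, zeval, h] <;> ring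

/-- The dependent triples of the icosahedral normals. -/
def icosahedralTable : Fin 15 → Fin 15 → Fin 15 → Bool :=
  sortedTable (depAt icosahedralZ [-1, -1, 1])

set_option maxRecDepth 100000 in
theorem depAtCheck_icosahedralZ : depAtCheck icosahedralZ [-1, -1, 1] = true := by decide +kernel

theorem isDepTable_icosahedral : IsDepTable icosahedralNormals icosahedralTable := by
  have h := isDepTable_depAt (c := Real.goldenRatio) Real.goldenRatio_ne_zero
    (by simp only [zeval]; push_cast; linear_combination Real.goldenRatio_sq)
    depAtCheck_icosahedralZ
  simp_rw [zvec_icosahedralZ] at h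
  exact h

/-- The dependent triples of the standard normals at the roots of a polynomial. -/
def degenerateTable (m : List ℤ) : Fin 15 → Fin 15 → Fin 15 → Bool := sortedTable (depAt stdZ m)

/-- The test that the standard arrangement at the roots of `m` is inductively free with exponents
`(1, 5, 9)`, and that `p` carries its dependent triples to those of the icosahedral normals. -/
def degenerateCheck (m : List ℤ) (l : List (Fin 15)) (p : Fin 15 → Fin 15) : Bool :=
  depAtCheck stdZ m && pairCheck (degenerateTable m) &&
    decide (chainExps (degenerateTable m) l = some (5, 9)) && decide l.Nodup &&
    decide (∀ i, i ∈ l) && decide (Function.Bijective p) &&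
    (List.finRange 15).all fun i => (List.finRange 15).all fun j => Nat.ble j.val i.val ||
      (List.finRange 15).all fun k => Nat.ble k.val j.val ||
        degenerateTable m i j k == icosahedralTable (p i) (p j) (p k)

set_option maxRecDepth 100000 in
theorem degenerateCheck_pos : degenerateCheck [-1, -4, 1]
    [0, 3, 4, 5, 6, 1, 7, 8, 9, 10, 11, 2, 12, 13, 14]
    ![0, 1, 2, 11, 14, 12, 13, 8, 10, 9, 7, 5, 6, 3, 4] = true := by
  decide +kernel

set_option maxRecDepth 100000 in
theorem degenerateCheck_neg : degenerateCheck [-1, 4, 1]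
    [0, 3, 4, 5, 6, 1, 7, 8, 9, 10, 11, 2, 12, 13, 14]
    ![0, 1, 2, 11, 14, 12, 13, 7, 9, 10, 8, 3, 4, 5, 6] = true := by
  decide +kernel

variable {K : Type u} [Field K] [CharZero K] {c : K}

/-- At the roots of `m`, the standard arrangement has the intersection pattern of the icosahedral
arrangement and is free with exponents `(1, 5, 9)`. -/
theorem exists_table_of_degenerateCheck (hc : c ≠ 0) {m : List ℤ} (hm : zeval c m = 0)
    {l : List (Fin 15)} {p : Fin 15 → Fin 15} (h : degenerateCheck m l p = true) :
    PairwiseIndep (std c) Finset.univ ∧ HasExps (std c) Finset.univ 5 9 ∧ Function.Bijective p ∧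
      PairwiseIndep (fun i => icosahedralNormals (p i)) Finset.univ ∧
      ∃ d, IsDepTable (std c) d ∧ IsDepTable (fun i => icosahedralNormals (p i)) d := by
  simp only [degenerateCheck, Bool.and_eq_true, decide_eq_true_eq] at h
  obtain ⟨⟨⟨⟨⟨⟨h1, h2⟩, h3⟩, h4⟩, h5⟩, h6⟩, h7⟩ := h
  have hd : IsDepTable (std c) (degenerateTable m) := by
    have := isDepTable_depAt hc hm h1
    simp_rw [zvec_stdZ] at this
    exact this
  have hw := hd.pairwiseIndep h2 (by norm_num)
  have hl : l.toFinset = Finset.univ := by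
    ext i; simp [h5 i]
  have key : ∀ i j k : Fin 15, i < j → j < k →
      degenerateTable m i j k = icosahedralTable (p i) (p j) (p k) := by
    intro i j k hij hjk
    have h := List.all_eq_true.mp (List.all_eq_true.mp h7 i (List.mem_finRange i)) j
      (List.mem_finRange j)
    rw [Bool.or_eq_true, Nat.ble_eq] at h
    have h := List.all_eq_true.mp (h.resolve_left (not_le.mpr hij)) k (List.mem_finRange k)
    rw [Bool.or_eq_true, Nat.ble_eq, beq_iff_eq] at h
    exact h.resolve_left (not_le.mpr hjk)
  have hp : IsDepTable (fun i => icosahedralNormals (p i))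
      (sortedTable fun i j k => icosahedralTable (p i) (p j) (p k)) :=
    isDepTable_sortedTable fun i j k _ _ => isDepTable_icosahedral _ _ _
  have hd' : IsDepTable (std c) (sortedTable fun i j k => icosahedralTable (p i) (p j) (p k)) :=
    isDepTable_sortedTable fun i j k hij hjk => by rw [hd i j k, key i j k hij hjk]
  have hp' : IsDepTable (fun i => icosahedralNormals (p i)) (degenerateTable m) := fun i j k => by
    rw [hp i j k, ← hd' i j k, hd i j k]
  refine ⟨hw, ?_, h6, hp'.pairwiseIndep h2 (by norm_num), degenerateTable m, hd, hp'⟩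
  rw [← hl]
  exact hasExps_of_chainExps hd l 5 9 h4 (hl ▸ hw) h3

end Icosahedral

/-! ### Intersection lattices -/

section Lattices

variable {K : Type u} [Field K] {n : ℕ}

/-- A plane of an arrangement as an element of the intersection lattice. -/
def atomOf (A : Arrangement K n) (H : Submodule K (Fin n → K)) (hH : H ∈ A.planes) : A.Lattice :=
  ⟨OrderDual.toDual H, {H}, by simpa using hH, by simp⟩

theorem eq_of_le_of_mem_planes {A : Arrangement K n} {H H' : Submodule K (Fin n → K)}
    (hH : H ∈ A.planes) (hH' : H' ∈ A.planes) (h : H ≤ H') : H = H' := by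
  obtain ⟨v, hv, rfl⟩ := A.isHyperplane H hH
  obtain ⟨v', hv', rfl⟩ := A.isHyperplane H' hH'
  exact (plane_eq_plane_iff hv hv').mpr ((plane_le_plane_iff hv).mp h)

theorem ne_top_of_mem_planes {A : Arrangement K n} {H : Submodule K (Fin n → K)}
    (hH : H ∈ A.planes) : H ≠ ⊤ := by
  obtain ⟨v, hv, rfl⟩ := A.isHyperplane H hH
  exact plane_ne_top hv

theorem isAtom_iff (A : Arrangement K n) (X : A.Lattice) :
    IsAtom X ↔ OrderDual.ofDual X.1 ∈ A.planes := by
  constructor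
  · rintro ⟨hX, hmin⟩
    obtain ⟨B, hB, hXB⟩ := X.2
    have hne : B.Nonempty := by
      rw [Set.nonempty_iff_ne_empty]
      rintro rfl
      apply hX
      apply Subtype.ext
      apply OrderDual.ofDual.injective
      rw [hXB, sInf_empty]
      rfl
    obtain ⟨H, hH⟩ := hne
    have hle : atomOf A H (hB hH) ≤ X := by
      change OrderDual.ofDual X.1 ≤ H
      rw [hXB]
      exact sInf_le hH
    rcases hle.lt_or_eq with h | h
    · have := hmin _ h
      have h' : H = ⊤ := congrArg (fun Y : A.Lattice => OrderDual.ofDual Y.1) this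
      exact absurd h' (ne_top_of_mem_planes (hB hH))
    · rw [← h]
      exact hB hH
  · intro hX
    refine ⟨fun h => ne_top_of_mem_planes hX
      (congrArg (fun Y : A.Lattice => OrderDual.ofDual Y.1) h), fun Y hY => ?_⟩
    obtain ⟨B, hB, hYB⟩ := Y.2
    have hle : OrderDual.ofDual X.1 ≤ OrderDual.ofDual Y.1 := hY.le
    have hall : ∀ H ∈ B, H = OrderDual.ofDual X.1 := fun H hH =>
      (eq_of_le_of_mem_planes hX (hB hH) (hle.trans (hYB ▸ sInf_le hH))).symm
    rcases B.eq_empty_or_nonempty with rfl | ⟨H, hH⟩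
    · apply Subtype.ext
      apply OrderDual.ofDual.injective
      rw [hYB, sInf_empty]
      rfl
    · exfalso
      refine hY.ne (Subtype.ext (OrderDual.ofDual.injective ?_))
      refine le_antisymm ?_ hle
      rw [hYB, ← hall H hH]
      exact sInf_le hH

theorem mem_realizations_iff {L : Type v} [PartialOrder L] [OrderBot L] (A : Arrangement K n) :
    A ∈ Realizations K L n ↔
      A.planes.ncard = {x : L | IsAtom x}.ncard ∧ Nonempty (A.Lattice ≃o L) := by
  refine ⟨fun ⟨h, φ, _⟩ => ⟨h, ⟨φ⟩⟩, fun ⟨h, ⟨φ⟩⟩ => ⟨h, φ, ?_⟩⟩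
  ext x
  constructor
  · rintro ⟨X, hX, rfl⟩
    exact (φ.isAtom_iff X).mpr ((isAtom_iff A X).mpr hX)
  · intro hx
    exact ⟨φ.symm x, (isAtom_iff A _).mp ((φ.symm.isAtom_iff x).mpr hx), φ.apply_symm_apply x⟩

theorem ncard_atoms (A : Arrangement K n) :
    {X : A.Lattice | IsAtom X}.ncard = A.planes.ncard := by
  simp_rw [isAtom_iff]
  refine Set.ncard_congr (fun X _ => OrderDual.ofDual X.1) (fun X hX => hX) ?_ ?_
  · intro X Y _ _ h
    exact Subtype.ext (OrderDual.ofDual.injective h)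
  · intro H hH
    exact ⟨atomOf A H hH, hH, rfl⟩

/-! ### The lattice of flats -/

variable {ι : Type*} {w : ι → Fin 3 → K} {d : ι → ι → ι → Bool}

/-- The closure of a set of planes under dependence, in terms of the dependent triples: the planes
of the set, those through the intersection of two of them, and all planes if the set contains three
independent ones. -/
def depClosure (d : ι → ι → ι → Bool) (S : Set ι) : Set ι :=
  {k | k ∈ S ∨ (∃ i ∈ S, ∃ j ∈ S, i ≠ j ∧ d i j k = true) ∨
    ∃ i ∈ S, ∃ j ∈ S, ∃ l ∈ S, d i j l = false}

/-- The vector product, as a vector that spans the intersection of two planes. -/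
def wedge (u v : Fin 3 → K) : Fin 3 → K :=
  ![u 1 * v 2 - u 2 * v 1, u 2 * v 0 - u 0 * v 2, u 0 * v 1 - u 1 * v 0]

theorem wedge_mem_plane_iff (u v w : Fin 3 → K) : wedge u v ∈ plane w ↔ det3 u v w = 0 := by
  rw [mem_plane]
  have : ∑ i, w i * wedge u v i = det3 u v w := by
    simp only [wedge, det3, Fin.sum_univ_three, Matrix.cons_val]
    ring
  rw [this]

theorem plane_inf_le_iff {u v x : Fin 3 → K} (hu : u ≠ 0) (huv : ∀ k : K, v ≠ k • u) :
    plane u ⊓ plane v ≤ plane x ↔ det3 u v x = 0 := by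
  constructor
  · intro h
    rw [← wedge_mem_plane_iff]
    refine h ⟨(wedge_mem_plane_iff u v u).mpr ?_, (wedge_mem_plane_iff u v v).mpr ?_⟩ <;>
    · simp only [det3]; ring
  · intro h y hy
    obtain ⟨a, b, rfl⟩ := exists_eq_add_of_det3_eq_zero hu huv h
    obtain ⟨h1, h2⟩ := Submodule.mem_inf.mp hy
    rw [mem_plane] at h1 h2 ⊢
    simp only [Fin.sum_univ_three, Pi.add_apply, Pi.smul_apply, smul_eq_mul] at h1 h2 ⊢
    linear_combination a * h1 + b * h2

theorem eq_zero_of_mem_planes {u v x y : Fin 3 → K} (h : det3 u v x ≠ 0) (hu : y ∈ plane u)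
    (hv : y ∈ plane v) (hx : y ∈ plane x) : y = 0 := by
  by_contra hy
  rw [mem_plane] at hu hv hx
  refine h (det3_eq_zero_of_dot hy ?_ ?_ ?_)
  · rw [← hu]; exact Finset.sum_congr rfl fun _ _ => mul_comm _ _
  · rw [← hv]; exact Finset.sum_congr rfl fun _ _ => mul_comm _ _
  · rw [← hx]; exact Finset.sum_congr rfl fun _ _ => mul_comm _ _

/-- The vectors of a family are nonzero and pairwise independent. -/
def AllIndep (w : ι → Fin 3 → K) : Prop :=
  (∀ i, w i ≠ 0) ∧ ∀ i j, i ≠ j → ∀ k : K, w j ≠ k • w i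

theorem PairwiseIndep.allIndep [Fintype ι] (h : PairwiseIndep w Finset.univ) : AllIndep w :=
  ⟨fun i => h.1 i (Finset.mem_univ i), fun i j => h.2 i (Finset.mem_univ i) j (Finset.mem_univ j)⟩

theorem iInf_plane_le_iff (hd : IsDepTable w d) (hw : AllIndep w) (S : Set ι) (k : ι) :
    ⨅ i ∈ S, plane (w i) ≤ plane (w k) ↔ k ∈ depClosure d S := by
  constructor
  · intro h
    by_contra hk
    simp only [depClosure, Set.mem_ofPred_eq, not_or, not_exists, not_and] at hk
    obtain ⟨h1, h2, h3⟩ := hk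
    by_cases hS : ∃ i ∈ S, ∃ j ∈ S, i ≠ j
    · obtain ⟨i, hi, j, hj, hij⟩ := hS
      have hle : plane (w i) ⊓ plane (w j) ≤ ⨅ i ∈ S, plane (w i) := by
        refine le_iInf₂ fun l hl => ?_
        rw [plane_inf_le_iff (hw.1 i) (hw.2 i j hij), hd]
        simpa using h3 i hi j hj l hl
      have := hle.trans h
      rw [plane_inf_le_iff (hw.1 i) (hw.2 i j hij), hd] at this
      exact h2 i hi j hj hij this
    · push Not at hS
      rcases S.eq_empty_or_nonempty with rfl | ⟨i, hi⟩
      · simp only [Set.mem_empty_iff_false, iInf_false, iInf_top, top_le_iff] at h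
        exact plane_ne_top (hw.1 k) h
      · have hle : plane (w i) ≤ ⨅ i ∈ S, plane (w i) :=
          le_iInf₂ fun l hl => by rw [hS i hi l hl]
        obtain ⟨a, ha⟩ := (plane_le_plane_iff (hw.1 i)).mp (hle.trans h)
        refine hw.2 i k ?_ a ha
        rintro rfl
        exact h1 hi
  · rintro (hk | ⟨i, hi, j, hj, hij, h⟩ | ⟨i, hi, j, hj, l, hl, h⟩)
    · exact iInf₂_le k hk
    · refine (le_inf (iInf₂_le i hi) (iInf₂_le j hj)).trans ?_
      rw [plane_inf_le_iff (hw.1 i) (hw.2 i j hij), hd]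
      exact h
    · intro y hy
      have hy : ∀ i ∈ S, y ∈ plane (w i) := by simpa using hy
      have : y = 0 := eq_zero_of_mem_planes (fun h0 => by simp [(hd i j l).mp h0] at h)
        (hy i hi) (hy j hj) (hy l hl)
      rw [this]
      exact Submodule.zero_mem _

/-- The planes that contain a flat. -/
def planesAbove (w : ι → Fin 3 → K) (X : Submodule K (Fin 3 → K)) : Set ι :=
  {i | X ≤ plane (w i)}

theorem plane_mem_planes {A : Arrangement K 3}
    (hA : A.planes = Set.range fun i => plane (w i)) (i : ι) : plane (w i) ∈ A.planes := by
  rw [hA]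
  exact Set.mem_range_self i

theorem exists_eq_plane_of_mem {A : Arrangement K 3}
    (hA : A.planes = Set.range fun i => plane (w i)) {H : Submodule K (Fin 3 → K)}
    (hH : H ∈ A.planes) : ∃ i, plane (w i) = H := by
  rw [hA] at hH
  exact hH

theorem iInf_planesAbove_eq {A : Arrangement K 3}
    (hA : A.planes = Set.range fun i => plane (w i)) (X : A.Lattice) :
    ⨅ i ∈ planesAbove w (OrderDual.ofDual X.1), plane (w i) = OrderDual.ofDual X.1 := by
  obtain ⟨B, hB, hXB⟩ := X.2
  refine le_antisymm ?_ (le_iInf₂ fun i hi => hi)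
  refine le_of_le_of_eq (le_sInf fun H hH => ?_) hXB.symm
  obtain ⟨i, rfl⟩ := exists_eq_plane_of_mem hA (hB hH)
  refine iInf₂_le (f := fun i _ => plane (w i)) i ?_
  exact le_of_eq_of_le hXB (sInf_le hH)

theorem planesAbove_iInf (hd : IsDepTable w d) (hw : AllIndep w) (S : Set ι) :
    planesAbove w (⨅ i ∈ S, plane (w i)) = depClosure d S := by
  ext k
  exact iInf_plane_le_iff hd hw S k

theorem depClosure_planesAbove_subset (hd : IsDepTable w d) (hw : AllIndep w)
    (X : Submodule K (Fin 3 → K)) :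
    depClosure d (planesAbove w X) ⊆ planesAbove w X := by
  rw [← planesAbove_iInf hd hw]
  exact fun k hk => (le_iInf₂ fun i hi => hi : X ≤ ⨅ i ∈ planesAbove w X, plane (w i)).trans hk

/-- The flat of the lattice that a set of planes spans. -/
def flatOf (A : Arrangement K 3) (hA : A.planes = Set.range fun i => plane (w i)) (S : Set ι) :
    A.Lattice :=
  ⟨OrderDual.toDual (⨅ i ∈ S, plane (w i)), (fun i => plane (w i)) '' S, by
    rw [hA]
    exact Set.image_subset_range _ _, by
    rw [sInf_image, OrderDual.ofDual_toDual]⟩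

theorem flatOf_planesAbove (A : Arrangement K 3)
    (hA : A.planes = Set.range fun i => plane (w i)) (X : A.Lattice) :
    flatOf A hA (planesAbove w (OrderDual.ofDual X.1)) = X :=
  Subtype.ext (congrArg OrderDual.toDual (iInf_planesAbove_eq hA X))

theorem planesAbove_flatOf (hd : IsDepTable w d) (hw : AllIndep w) (A : Arrangement K 3)
    (hA : A.planes = Set.range fun i => plane (w i)) {F : Set ι} (hF : depClosure d F ⊆ F) :
    planesAbove w (OrderDual.ofDual (flatOf A hA F).1) = F :=
  (planesAbove_iInf hd hw F).trans (hF.antisymm fun _ h => Or.inl h)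

theorem planesAbove_subset_iff (A : Arrangement K 3)
    (hA : A.planes = Set.range fun i => plane (w i)) (X Y : A.Lattice) :
    planesAbove w (OrderDual.ofDual X.1) ⊆ planesAbove w (OrderDual.ofDual Y.1) ↔ X ≤ Y := by
  constructor
  · intro h
    change OrderDual.ofDual Y.1 ≤ OrderDual.ofDual X.1
    rw [← iInf_planesAbove_eq hA X, ← iInf_planesAbove_eq hA Y]
    exact biInf_mono h
  · intro h i hi
    exact le_trans (show OrderDual.ofDual Y.1 ≤ OrderDual.ofDual X.1 from h) hi

/-- The intersection lattice is the lattice of the sets of planes that are closed under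
dependence. -/
def flatIso (hd : IsDepTable w d) (hw : AllIndep w) (A : Arrangement K 3)
    (hA : A.planes = Set.range fun i => plane (w i)) :
    A.Lattice ≃o {F : Set ι // depClosure d F ⊆ F} where
  toFun X := ⟨planesAbove w (OrderDual.ofDual X.1), depClosure_planesAbove_subset hd hw _⟩
  invFun F := flatOf A hA F.1
  left_inv X := flatOf_planesAbove A hA X
  right_inv F := Subtype.ext (planesAbove_flatOf hd hw A hA F.2)
  map_rel_iff' := fun {X Y} => planesAbove_subset_iff A hA X Y

/-- Families with the same dependent triples have isomorphic intersection lattices. -/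
theorem nonempty_latticeIso {K' : Type*} [Field K'] {w' : ι → Fin 3 → K'}
    (hd : IsDepTable w d) (hw : AllIndep w) (hd' : IsDepTable w' d) (hw' : AllIndep w')
    (A : Arrangement K 3) (hA : A.planes = Set.range fun i => plane (w i))
    (A' : Arrangement K' 3) (hA' : A'.planes = Set.range fun i => plane (w' i)) :
    Nonempty (A.Lattice ≃o A'.Lattice) :=
  ⟨(flatIso hd hw A hA).trans (flatIso hd' hw' A' hA').symm⟩

/-- The plane with index `i`, as an element of the lattice. -/
def atomAt (A : Arrangement K 3) (hA : A.planes = Set.range fun i => plane (w i)) (i : ι) :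
    A.Lattice :=
  atomOf A (plane (w i)) (plane_mem_planes hA i)

theorem isAtom_atomAt (A : Arrangement K 3) (hA : A.planes = Set.range fun i => plane (w i))
    (i : ι) : IsAtom (atomAt A hA i) := by
  exact (isAtom_iff A _).mpr (plane_mem_planes hA i)

/-- Dependence of planes in terms of the order of the lattice. -/
theorem det3_eq_zero_iff_forall_le (hw : AllIndep w) (A : Arrangement K 3)
    (hA : A.planes = Set.range fun i => plane (w i)) {i j : ι} (hij : i ≠ j) (k : ι) :
    det3 (w i) (w j) (w k) = 0 ↔
      ∀ Y : A.Lattice, atomAt A hA i ≤ Y → atomAt A hA j ≤ Y → atomAt A hA k ≤ Y := by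
  rw [← plane_inf_le_iff (hw.1 i) (hw.2 i j hij)]
  constructor
  · intro h Y hi hj
    have hi : OrderDual.ofDual Y.1 ≤ plane (w i) := hi
    have hj : OrderDual.ofDual Y.1 ≤ plane (w j) := hj
    exact (le_inf hi hj).trans h
  · intro h
    refine h ⟨OrderDual.toDual (plane (w i) ⊓ plane (w j)), {plane (w i), plane (w j)}, ?_, ?_⟩
      (show plane (w i) ⊓ plane (w j) ≤ _ from inf_le_left)
      (show plane (w i) ⊓ plane (w j) ≤ _ from inf_le_right)
    · rw [hA]
      rintro H (rfl | rfl) <;> exact Set.mem_range_self _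
    · simp [sInf_insert]

theorem atomAt_injective (hw : AllIndep w) (A : Arrangement K 3)
    (hA : A.planes = Set.range fun i => plane (w i)) : Function.Injective (atomAt A hA) := by
  intro i j h
  by_contra hij
  have h' : plane (w i) = plane (w j) := congrArg (fun Y : A.Lattice => OrderDual.ofDual Y.1) h
  obtain ⟨a, ha⟩ := (plane_eq_plane_iff (hw.1 i) (hw.1 j)).mp h'
  exact hw.2 i j hij a ha

theorem exists_atomAt_eq {A : Arrangement K 3}
    (hA : A.planes = Set.range fun i => plane (w i)) {X : A.Lattice} (hX : IsAtom X) :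
    ∃ i, atomAt A hA i = X := by
  obtain ⟨i, hi⟩ := exists_eq_plane_of_mem hA ((isAtom_iff A X).mp hX)
  exact ⟨i, Subtype.ext (OrderDual.ofDual.injective hi)⟩

/-- A realization of the lattice of an arrangement has normals with the same dependent triples. -/
theorem exists_normals_of_latticeIso {K' : Type*} [Field K'] {w' : ι → Fin 3 → K'}
    (hd' : IsDepTable w' d) (hw' : AllIndep w') (A' : Arrangement K' 3)
    (hA' : A'.planes = Set.range fun i => plane (w' i)) (A : Arrangement K 3)
    (φ : A'.Lattice ≃o A.Lattice) :
    ∃ w : ι → Fin 3 → K, AllIndep w ∧ IsDepTable w d ∧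
      A.planes = Set.range fun i => plane (w i) := by
  have hat : ∀ i, IsAtom (φ (atomAt A' hA' i)) := fun i =>
    (φ.isAtom_iff _).mpr (isAtom_atomAt A' hA' i)
  choose w hw0 hw using fun i => A.isHyperplane _ ((isAtom_iff _ _).mp (hat i))
  have hind : AllIndep w := by
    refine ⟨hw0, fun i j hij k hk => hij (atomAt_injective hw' A' hA' (φ.injective ?_))⟩
    apply Subtype.ext
    apply OrderDual.ofDual.injective
    rw [hw i, hw j]
    exact (plane_eq_plane_iff (hw0 i) (hw0 j)).mpr ⟨k, hk⟩
  have hA : A.planes = Set.range fun i => plane (w i) := by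
    ext H
    constructor
    · intro hH
      obtain ⟨i, hi⟩ := exists_atomAt_eq hA' ((φ.symm.isAtom_iff (atomOf A H hH)).mpr
        ((isAtom_iff _ _).mpr hH))
      refine ⟨i, ?_⟩
      have : φ (atomAt A' hA' i) = atomOf A H hH := by rw [hi, φ.apply_symm_apply]
      simp only
      rw [← hw i, this]
      rfl
    · rintro ⟨i, rfl⟩
      simp only
      rw [← hw i]
      exact (isAtom_iff _ _).mp (hat i)
  have hφ : ∀ i, φ (atomAt A' hA' i) = atomAt A hA i := fun i =>
    Subtype.ext (OrderDual.ofDual.injective (hw i))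
  refine ⟨w, hind, fun i j k => ?_, hA⟩
  rw [← hd' i j k]
  by_cases hij : i = j
  · subst hij
    simp only [det3]
    exact iff_of_true (by ring) (by ring)
  · rw [det3_eq_zero_iff_forall_le hind A hA hij, det3_eq_zero_iff_forall_le hw' A' hA' hij]
    simp_rw [← hφ]
    constructor
    · intro h Y hi hj
      exact φ.le_iff_le.mp (h (φ Y) (φ.le_iff_le.mpr hi) (φ.le_iff_le.mpr hj))
    · intro h Y hi hj
      have := h (φ.symm Y) (φ.le_symm_apply.mpr hi) (φ.le_symm_apply.mpr hj)
      exact φ.le_symm_apply.mp this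

end Lattices

/-! ### The golden parameters -/

section Degenerate

variable {K : Type u} [Field K] {ι : Type*} {w : ι → Fin 3 → K}

theorem vecMul_ne_zero {G : Matrix (Fin 3) (Fin 3) K} (hG : G.det ≠ 0) {v : Fin 3 → K}
    (hv : v ≠ 0) : Matrix.vecMul v G ≠ 0 := by
  intro h
  apply hv
  have := congrArg (fun x => Matrix.vecMul x G⁻¹) h
  simpa [Matrix.vecMul_vecMul, Matrix.mul_nonsing_inv _ hG.isUnit] using this

theorem AllIndep.vecMul (h : AllIndep w) {G : Matrix (Fin 3) (Fin 3) K} (hG : G.det ≠ 0) :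
    AllIndep fun i => Matrix.vecMul (w i) G := by
  refine ⟨fun i => vecMul_ne_zero hG (h.1 i), fun i j hij k hk => ?_⟩
  refine vecMul_ne_zero hG (v := w j - k • w i) (sub_ne_zero.mpr (h.2 i j hij k)) ?_
  rw [Matrix.sub_vecMul, Matrix.smul_vecMul,
    show Matrix.vecMul (w j) G = k • Matrix.vecMul (w i) G from hk, sub_self]

theorem AllIndep.pairwiseIndep [Fintype ι] (h : AllIndep w) : PairwiseIndep w Finset.univ :=
  ⟨fun i _ => h.1 i, fun i _ j _ => h.2 i j⟩

theorem AllIndep.injective_plane (h : AllIndep w) : Function.Injective fun i => plane (w i) := by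
  intro j k hjk
  by_contra hne
  obtain ⟨a, ha⟩ := (plane_eq_plane_iff (h.1 j) (h.1 k)).mp hjk
  exact h.2 j k hne a ha

theorem AllIndep.ncard_planes (h : AllIndep w) {A : Arrangement K 3}
    (hA : A.planes = Set.range fun i => plane (w i)) : A.planes.ncard = Nat.card ι := by
  rw [hA, ← Set.image_univ, Set.ncard_image_of_injective _ h.injective_plane, Set.ncard_univ]

theorem planes_icosahedralArr {p : Fin 15 → Fin 15} (hp : Function.Bijective p) :
    icosahedralArr.planes = Set.range fun i => plane (icosahedralNormals (p i)) :=
  (hp.surjective.range_comp fun i => plane (icosahedralNormals i)).symm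

variable [CharZero K]

theorem arr15_of_degenerateCheck {t : K} (ht : t ≠ 1) (hc : 2 * t - 1 ≠ 0) {m : List ℤ}
    (hm : zeval (2 * t - 1) m = 0) {l : List (Fin 15)} {p : Fin 15 → Fin 15}
    (h : degenerateCheck m l p = true) :
    (arr15 t).planes.ncard = 15 ∧ Nonempty ((arr15 t).Lattice ≃o icosahedralArr.Lattice) ∧
      (arr15 t).IsFreeWithExponents ![1, 5, 9] := by
  obtain ⟨hw, he, hp, hp', d, hd, hd'⟩ := exists_table_of_degenerateCheck hc hm h
  have hG := det_frame15_ne_zero ht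
  have hw' := hw.allIndep.vecMul hG
  refine ⟨by simpa using hw'.ncard_planes (planes_arr15 ht), ?_, ?_⟩
  · exact nonempty_latticeIso (hd.vecMul hG) hw' hd' hp'.allIndep _ (planes_arr15 ht) _
      (planes_icosahedralArr hp)
  · exact (he.vecMul hG).isFreeWithExponents hw'.pairwiseIndep (by simp [planes_arr15 ht])

theorem arr15_of_golden {l : ℂ}
    (hl : l ∈ ({(3 + ((Real.sqrt 5 : ℝ) : ℂ)) / 2, (3 - ((Real.sqrt 5 : ℝ) : ℂ)) / 2,
      (-1 + ((Real.sqrt 5 : ℝ) : ℂ)) / 2, (-1 - ((Real.sqrt 5 : ℝ) : ℂ)) / 2} : Set ℂ)) :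
    (arr15 l).planes.ncard = 15 ∧ Nonempty ((arr15 l).Lattice ≃o icosahedralArr.Lattice) ∧
      (arr15 l).IsFreeWithExponents ![1, 5, 9] := by
  have h5 : ((Real.sqrt 5 : ℝ) : ℂ) ^ 2 = 5 := by
    rw [← Complex.ofReal_pow, Real.sq_sqrt (by norm_num)]
    norm_num
  simp only [Set.mem_insert_iff, Set.mem_singleton_iff] at hl
  have h : (2 * l - 1) ^ 2 - 4 * (2 * l - 1) - 1 = 0 ∨
      (2 * l - 1) ^ 2 + 4 * (2 * l - 1) - 1 = 0 := by
    rcases hl with rfl | rfl | rfl | rfl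
    · left; linear_combination h5
    · left; linear_combination h5
    · right; linear_combination h5
    · right; linear_combination h5
  have hc : 2 * l - 1 ≠ 0 := by
    intro h0
    rw [h0] at h
    norm_num at h
  have ht : l ≠ 1 := by
    rintro rfl
    norm_num at h
  rcases h with h | h
  · refine arr15_of_degenerateCheck ht hc ?_ degenerateCheck_pos
    simp only [zeval]
    push_cast
    linear_combination h
  · refine arr15_of_degenerateCheck ht hc ?_ degenerateCheck_neg
    simp only [zeval]
    push_cast
    linear_combination h

end Degenerate

/-! ### The realization space -/

section Realization

variable {K : Type u} [Field K]

theorem det3_smul_smul_eq_zero {a b : K} (ha : a ≠ 0) (hb : b ≠ 0) {p q v u w : Fin 3 → K}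
    (hu : u = a • p) (hw : w = b • q) (h : det3 u w v = 0) : det3 p q v = 0 := by
  have : a * b * det3 p q v = 0 := by
    rw [← h, hu, hw]
    simp only [det3, Pi.smul_apply, smul_eq_mul]
    ring
  exact (mul_eq_zero.mp this).resolve_left (mul_ne_zero ha hb)

theorem exists_smul_of_apply {x s : Fin 3 → K} {e : K} (hx : x ≠ 0) (h0 : x 0 = e * s 0)
    (h1 : x 1 = e * s 1) (h2 : x 2 = e * s 2) : ∃ k : K, k ≠ 0 ∧ x = k • s := by
  have h : x = e • s := by
    ext i
    fin_cases i
    exacts [h0, h1, h2]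
  refine ⟨e, ?_, h⟩
  rintro rfl
  exact hx (by simpa using h)

variable {x : Fin 15 → Fin 3 → K}

/-- The planes `(1, ±1, ±1)` are determined by the coordinate planes and `(1, 1, 1)`. -/
theorem exists_smul_std_of_lt_seven (hd : IsDepTable x dep) (hx : ∀ i, x i ≠ 0)
    (h0 : x 0 = ![1, 0, 0]) (h1 : x 1 = ![0, 1, 0]) (h2 : x 2 = ![0, 0, 1]) (h3 : x 3 = ![1, 1, 1])
    (c : K) : ∀ i : Fin 15, i < 7 → ∃ k : K, k ≠ 0 ∧ x i = k • std c i := by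
  have e4 : x 4 0 = x 4 1 := by
    have := (hd 2 3 4).mpr (by decide)
    simp only [det3, h2, h3, Matrix.cons_val] at this
    linear_combination -this
  have e5 : x 5 0 = x 5 2 := by
    have := (hd 1 3 5).mpr (by decide)
    simp only [det3, h1, h3, Matrix.cons_val] at this
    linear_combination this
  have e6 : x 6 1 = x 6 2 := by
    have := (hd 0 3 6).mpr (by decide)
    simp only [det3, h0, h3, Matrix.cons_val] at this
    linear_combination -this
  have e45 : x 4 1 * x 5 2 = x 4 2 * x 5 1 := by
    have := (hd 0 4 5).mpr (by decide)
    simp only [det3, h0, Matrix.cons_val] at this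
    linear_combination this
  have e46 : x 4 0 * x 6 2 = x 4 2 * x 6 0 := by
    have := (hd 1 4 6).mpr (by decide)
    simp only [det3, h1, Matrix.cons_val] at this
    linear_combination -this
  have e56 : x 5 0 * x 6 1 = x 5 1 * x 6 0 := by
    have := (hd 2 5 6).mpr (by decide)
    simp only [det3, h2, Matrix.cons_val] at this
    linear_combination this
  have n5 : x 5 2 ≠ 0 := by
    intro h
    have := (hd 0 1 5).mp (by simp [det3, h0, h1, h])
    simp [show dep 0 1 5 = false by decide] at this
  have n6 : x 6 2 ≠ 0 := by
    intro h
    have := (hd 0 1 6).mp (by simp [det3, h0, h1, h])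
    simp [show dep 0 1 6 = false by decide] at this
  have n4 : x 4 1 - x 4 2 ≠ 0 := by
    intro h
    have := (hd 0 3 4).mp (by simp [det3, h0, h3]; linear_combination -h)
    simp [show dep 0 3 4 = false by decide] at this
  have f4 : x 4 2 = -x 4 1 := by
    have : (x 4 1 - x 4 2) * (x 5 2 * x 6 2 * (x 4 1 + x 4 2)) = 0 := by
      rw [e5, e6] at e56
      rw [e4] at e46
      linear_combination x 4 1 * x 6 2 * e45 + x 4 2 * x 5 1 * e46 - x 4 2 ^ 2 * e56
    have := ((mul_eq_zero.mp this).resolve_left n4)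
    have := (mul_eq_zero.mp this).resolve_left (mul_ne_zero n5 n6)
    linear_combination this
  have n42 : x 4 2 ≠ 0 := by
    intro h
    have := (hd 0 1 4).mp (by simp [det3, h0, h1, h])
    simp [show dep 0 1 4 = false by decide] at this
  have f5 : x 5 1 = -x 5 2 := mul_left_cancel₀ n42 (by rw [← e45, f4]; ring)
  have f6 : x 6 0 = -x 6 2 := mul_left_cancel₀ n42 (by rw [← e46, e4, f4]; ring)
  intro i hi
  have hi' : i = 0 ∨ i = 1 ∨ i = 2 ∨ i = 3 ∨ i = 4 ∨ i = 5 ∨ i = 6 := by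
    revert i; decide
  rcases hi' with rfl | rfl | rfl | rfl | rfl | rfl | rfl
  · exact ⟨1, one_ne_zero, by simp [h0, std]⟩
  · exact ⟨1, one_ne_zero, by simp [h1, std]⟩
  · exact ⟨1, one_ne_zero, by simp [h2, std]⟩
  · exact ⟨1, one_ne_zero, by simp [h3, std]⟩
  · exact exists_smul_of_apply (e := x 4 1) (hx 4) (by simp [std, e4]) (by simp [std])
      (by simp [std, f4])
  · exact exists_smul_of_apply (e := x 5 2) (hx 5) (by simp [std, e5]) (by simp [std, f5])
      (by simp [std])
  · exact exists_smul_of_apply (e := -x 6 2) (hx 6) (by simp [std, f6]) (by simp [std, e6])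
      (by simp [std])

/-- The plane `i` is determined by two dependent triples `p, q, i` and `r, s, i` whose other planes
are in standard position. The hypothesis `hsol` is the solution of the two linear equations for the
normal of the plane `i`, with the factor `e` of proportionality. -/
theorem exists_smul_std_of_lines (hd : IsDepTable x dep) (hx : ∀ i, x i ≠ 0) {c : K}
    {i p q r s : Fin 15} {e : K} (hp : ∃ k : K, k ≠ 0 ∧ x p = k • std c p)
    (hq : ∃ k : K, k ≠ 0 ∧ x q = k • std c q) (hr : ∃ k : K, k ≠ 0 ∧ x r = k • std c r)
    (hs : ∃ k : K, k ≠ 0 ∧ x s = k • std c s) (h : dep p q i = true) (h' : dep r s i = true)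
    (hsol : det3 (std c p) (std c q) (x i) = 0 → det3 (std c r) (std c s) (x i) = 0 →
      x i 0 = e * std c i 0 ∧ x i 1 = e * std c i 1 ∧ x i 2 = e * std c i 2) :
    ∃ k : K, k ≠ 0 ∧ x i = k • std c i := by
  obtain ⟨kp, hkp, hp⟩ := hp
  obtain ⟨kq, hkq, hq⟩ := hq
  obtain ⟨kr, hkr, hr⟩ := hr
  obtain ⟨ks, hks, hs⟩ := hs
  obtain ⟨h0, h1, h2⟩ := hsol (det3_smul_smul_eq_zero hkp hkq hp hq ((hd p q i).mpr h))
    (det3_smul_smul_eq_zero hkr hks hr hs ((hd r s i).mpr h'))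
  exact exists_smul_of_apply (hx i) h0 h1 h2

/-- In coordinates where four of the planes are `(1, 0, 0)`, `(0, 1, 0)`, `(0, 0, 1)`, `(1, 1, 1)`,
the dependent triples determine the others up to one parameter. -/
theorem exists_smul_std (hd : IsDepTable x dep) (hx : ∀ i, x i ≠ 0)
    (h0 : x 0 = ![1, 0, 0]) (h1 : x 1 = ![0, 1, 0]) (h2 : x 2 = ![0, 0, 1])
    (h3 : x 3 = ![1, 1, 1]) :
    ∃ c : K, ∀ i, ∃ k : K, k ≠ 0 ∧ x i = k • std c i := by
  have n7 : x 7 1 ≠ 0 := by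
    intro h
    have := (hd 0 2 7).mp (by simp [det3, h0, h2, h])
    simp [show dep 0 2 7 = false by decide] at this
  have e7 : x 7 2 = x 7 1 := by
    have := (hd 0 3 7).mpr (by decide)
    simp only [det3, h0, h3, Matrix.cons_val] at this
    linear_combination this
  refine ⟨x 7 0 / x 7 1, ?_⟩
  set c := x 7 0 / x 7 1 with hc
  have hlow := exists_smul_std_of_lt_seven hd hx h0 h1 h2 h3 c
  have q0 := hlow 0 (by decide)
  have q1 := hlow 1 (by decide)
  have q2 := hlow 2 (by decide)
  have q3 := hlow 3 (by decide)
  have q4 := hlow 4 (by decide)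
  have q5 := hlow 5 (by decide)
  have q6 := hlow 6 (by decide)
  have q7 : ∃ k : K, k ≠ 0 ∧ x 7 = k • std c 7 :=
    exists_smul_of_apply (e := x 7 1) (hx 7) (by simp [std, hc, mul_div_cancel₀ _ n7])
      (by simp [std]) (by simp [std, e7])
  have q8 : ∃ k : K, k ≠ 0 ∧ x 8 = k • std c 8 := by
    refine exists_smul_std_of_lines hd hx (e := x 8 1) q2 q7 q0 q4 (by decide) (by decide) ?_
    intro ha hb
    simp only [det3, std, Matrix.cons_val] at ha hb ⊢
    exact ⟨by linear_combination -ha, by ring, by linear_combination hb⟩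
  have q9 : ∃ k : K, k ≠ 0 ∧ x 9 = k • std c 9 := by
    refine exists_smul_std_of_lines hd hx (e := x 9 2) q1 q7 q0 q4 (by decide) (by decide) ?_
    intro ha hb
    simp only [det3, std, Matrix.cons_val] at ha hb ⊢
    exact ⟨by linear_combination ha, by linear_combination hb, by ring⟩
  have q10 : ∃ k : K, k ≠ 0 ∧ x 10 = k • std c 10 := by
    refine exists_smul_std_of_lines hd hx (e := -x 10 2) q1 q8 q0 q3 (by decide) (by decide) ?_
    intro ha hb
    simp only [det3, std, Matrix.cons_val] at ha hb ⊢
    exact ⟨by linear_combination -ha, by linear_combination -hb, by ring⟩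
  have q11 : ∃ k : K, k ≠ 0 ∧ x 11 = k • std c 11 := by
    refine exists_smul_std_of_lines hd hx (e := x 11 1) q2 q7 q1 q3 (by decide) (by decide) ?_
    intro ha hb
    simp only [det3, std, Matrix.cons_val] at ha hb ⊢
    exact ⟨by linear_combination -ha, by ring, by linear_combination -hb - ha⟩
  have q12 : ∃ k : K, k ≠ 0 ∧ x 12 = k • std c 12 := by
    refine exists_smul_std_of_lines hd hx (e := x 12 1) q2 q7 q1 q4 (by decide) (by decide) ?_
    intro ha hb
    simp only [det3, std, Matrix.cons_val] at ha hb ⊢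
    exact ⟨by linear_combination -ha, by ring, by linear_combination -hb + ha⟩
  have q13 : ∃ k : K, k ≠ 0 ∧ x 13 = k • std c 13 := by
    refine exists_smul_std_of_lines hd hx (e := -x 13 1) q2 q9 q1 q3 (by decide) (by decide) ?_
    intro ha hb
    simp only [det3, std, Matrix.cons_val] at ha hb ⊢
    exact ⟨by linear_combination ha, by ring, by linear_combination -hb + ha⟩
  have q14 : ∃ k : K, k ≠ 0 ∧ x 14 = k • std c 14 := by
    refine exists_smul_std_of_lines hd hx (e := -x 14 1) q2 q9 q1 q4 (by decide) (by decide) ?_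
    intro ha hb
    simp only [det3, std, Matrix.cons_val] at ha hb ⊢
    exact ⟨by linear_combination ha, by ring, by linear_combination -hb - ha⟩
  intro i
  fin_cases i
  exacts [q0, q1, q2, q3, q4, q5, q6, q7, q8, q9, q10, q11, q12, q13, q14]

theorem isGood_of_isDepTable {c : K} (h : IsDepTable (std c) dep) : IsGood c where
  ne_zero hc := by
    have := (h 1 2 7).mp (by simp [det3, std, hc])
    simp [show dep 1 2 7 = false by decide] at this
  ne_one hc := by
    have := (h 3 7 1).mp (by simp [det3, std, hc])
    simp [show dep 3 7 1 = false by decide] at this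
  ne_neg_one hc := by
    have := (h 6 7 1).mp (by simp [det3, std, hc])
    simp [show dep 6 7 1 = false by decide] at this
  quad hc := by
    have := (h 3 8 14).mp (by simp [det3, std]; linear_combination hc)
    simp [show dep 3 8 14 = false by decide] at this
  quad' hc := by
    have := (h 3 9 12).mp (by simp [det3, std]; linear_combination hc)
    simp [show dep 3 9 12 = false by decide] at this

/-- Every family of vectors with the dependent triples of the generic arrangement is projectively
equivalent to a standard arrangement. -/
theorem exists_std_of_isDepTable {w : Fin 15 → Fin 3 → K} (hd : IsDepTable w dep)
    (hw : ∀ i, w i ≠ 0) : ∃ (c : K) (G : Matrix (Fin 3) (Fin 3) K), IsGood c ∧ G.det ≠ 0 ∧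
      ∀ i, ∃ k : K, k ≠ 0 ∧ w i = k • Matrix.vecMul (std c i) G := by
  have h012 : det3 (w 0) (w 1) (w 2) ≠ 0 := fun h => by
    simpa [show dep 0 1 2 = false by decide] using (hd 0 1 2).mp h
  -- The coordinates of `w 3` in the basis `w 0, w 1, w 2` are nonzero; they scale the basis so
  -- that `w 3` becomes `(1, 1, 1)`.
  set M : Matrix (Fin 3) (Fin 3) K := Matrix.of ![w 0, w 1, w 2] with hM
  have hMdet : M.det ≠ 0 := by rw [det_of_fin_three]; exact h012
  set y := Matrix.vecMul (w 3) M⁻¹ with hy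
  have hyM : Matrix.vecMul y M = w 3 := by
    rw [hy, Matrix.vecMul_vecMul, Matrix.nonsing_inv_mul _ hMdet.isUnit, Matrix.vecMul_one]
  have hy3 : w 3 = y 0 • w 0 + y 1 • w 1 + y 2 • w 2 := by
    rw [← hyM]
    ext j
    simp [Matrix.vecMul, dotProduct, Fin.sum_univ_three, hM]
  have hy0 : y 0 ≠ 0 := fun h => by
    have := (hd 1 2 3).mp (by
      rw [hy3, h]; simp only [det3, Pi.add_apply, Pi.smul_apply, smul_eq_mul]; ring)
    simp [show dep 1 2 3 = false by decide] at this
  have hy1 : y 1 ≠ 0 := fun h => by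
    have := (hd 0 2 3).mp (by
      rw [hy3, h]; simp only [det3, Pi.add_apply, Pi.smul_apply, smul_eq_mul]; ring)
    simp [show dep 0 2 3 = false by decide] at this
  have hy2 : y 2 ≠ 0 := fun h => by
    have := (hd 0 1 3).mp (by
      rw [hy3, h]; simp only [det3, Pi.add_apply, Pi.smul_apply, smul_eq_mul]; ring)
    simp [show dep 0 1 3 = false by decide] at this
  set G : Matrix (Fin 3) (Fin 3) K := Matrix.of ![y 0 • w 0, y 1 • w 1, y 2 • w 2] with hG
  have hGdet : G.det ≠ 0 := by
    rw [det_of_fin_three]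
    have : det3 (G 0) (G 1) (G 2) = y 0 * y 1 * y 2 * det3 (w 0) (w 1) (w 2) := by
      simp [det3, hG]; ring
    rw [this]
    exact mul_ne_zero (mul_ne_zero (mul_ne_zero hy0 hy1) hy2) h012
  have hGG : ∀ v, Matrix.vecMul (Matrix.vecMul v G) G⁻¹ = v := fun v => by
    rw [Matrix.vecMul_vecMul, Matrix.mul_nonsing_inv _ hGdet.isUnit, Matrix.vecMul_one]
  have hGG' : ∀ v, Matrix.vecMul (Matrix.vecMul v G⁻¹) G = v := fun v => by
    rw [Matrix.vecMul_vecMul, Matrix.nonsing_inv_mul _ hGdet.isUnit, Matrix.vecMul_one]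
  have hGi : G⁻¹.det ≠ 0 := (Matrix.isUnit_nonsing_inv_det _ hGdet.isUnit).ne_zero
  let s : Fin 15 → K := fun i => if i = 0 then y 0 else if i = 1 then y 1 else
    if i = 2 then y 2 else 1
  have hs : ∀ i, s i ≠ 0 := by
    intro i
    simp only [s]
    split_ifs <;> first | assumption | exact one_ne_zero
  let x : Fin 15 → Fin 3 → K := fun i => s i • Matrix.vecMul (w i) G⁻¹
  have hxd : IsDepTable x dep := by
    intro i j k
    rw [← hd.vecMul hGi i j k]
    have : det3 (x i) (x j) (x k) = s i * s j * s k * det3 (Matrix.vecMul (w i) G⁻¹)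
        (Matrix.vecMul (w j) G⁻¹) (Matrix.vecMul (w k) G⁻¹) := by
      simp only [x, det3, Pi.smul_apply, smul_eq_mul]; ring
    rw [this, mul_eq_zero, or_iff_right (mul_ne_zero (mul_ne_zero (hs i) (hs j)) (hs k))]
  have hx : ∀ i, x i ≠ 0 := fun i => smul_ne_zero (hs i) (vecMul_ne_zero hGi (hw i))
  have hG0 : ∀ u : Fin 3 → K, Matrix.vecMul u G =
      u 0 • y 0 • w 0 + u 1 • y 1 • w 1 + u 2 • y 2 • w 2 := by
    intro u
    ext j
    simp [Matrix.vecMul, dotProduct, Fin.sum_univ_three, hG]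
  obtain ⟨c, hc⟩ := exists_smul_std hxd hx
    (by
      rw [← hGG ![1, 0, 0], hG0]
      simp [x, s, Matrix.smul_vecMul])
    (by
      rw [← hGG ![0, 1, 0], hG0]
      simp [x, s, Matrix.smul_vecMul])
    (by
      rw [← hGG ![0, 0, 1], hG0]
      simp [x, s, Matrix.smul_vecMul])
    (by
      rw [← hGG ![1, 1, 1], hG0]
      simp only [x, s, hy3]
      simp [Fin.ext_iff])
  refine ⟨c, G, isGood_of_isDepTable fun i j k => ?_, hGdet, fun i => ?_⟩
  · rw [← hxd i j k]
    obtain ⟨a, ha, hi⟩ := hc i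
    obtain ⟨b, hb, hj⟩ := hc j
    obtain ⟨e, he, hk⟩ := hc k
    have : det3 (x i) (x j) (x k) = a * b * e * det3 (std c i) (std c j) (std c k) := by
      rw [hi, hj, hk]
      simp only [det3, Pi.smul_apply, smul_eq_mul]; ring
    rw [this, mul_eq_zero, or_iff_right (mul_ne_zero (mul_ne_zero ha hb) he)]
  · obtain ⟨k, hk, hi⟩ := hc i
    refine ⟨(s i)⁻¹ * k, mul_ne_zero (inv_ne_zero (hs i)) hk, ?_⟩
    rw [mul_smul, ← Matrix.smul_vecMul, ← hi]
    simp only [x]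
    rw [Matrix.smul_vecMul, smul_smul, inv_mul_cancel₀ (hs i), one_smul, hGG']

end Realization

/-! ### Projective classes -/

section Classes

variable {K : Type u} [Field K] {c : K}

theorem map_plane (g : (Fin 3 → K) ≃ₗ[K] (Fin 3 → K)) (v : Fin 3 → K) :
    (plane v).map (g : (Fin 3 → K) →ₗ[K] (Fin 3 → K)) =
      plane (Matrix.vecMul v (LinearMap.toMatrix' (g.symm : (Fin 3 → K) →ₗ[K] (Fin 3 → K)))) := by
  ext y
  rw [Submodule.map_equiv_eq_comap_symm, Submodule.mem_comap, mem_plane, mem_plane]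
  change v ⬝ᵥ (g.symm : (Fin 3 → K) →ₗ[K] (Fin 3 → K)) y = 0 ↔ Matrix.vecMul v _ ⬝ᵥ y = 0
  rw [← Matrix.dotProduct_mulVec, LinearMap.toMatrix'_mulVec]

/-- `A` is projectively equivalent to the standard arrangement with parameter `c`. -/
def IsStd (A : Arrangement K 3) (c : K) : Prop :=
  ∃ G : Matrix (Fin 3) (Fin 3) K, G.det ≠ 0 ∧
    A.planes = Set.range fun i => plane (Matrix.vecMul (std c i) G)

theorem IsStd.map {A B : Arrangement K 3} (h : IsStd A c) (g : (Fin 3 → K) ≃ₗ[K] (Fin 3 → K))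
    (hB : B.planes = Submodule.map (g : (Fin 3 → K) →ₗ[K] (Fin 3 → K)) '' A.planes) :
    IsStd B c := by
  obtain ⟨G, hG, hA⟩ := h
  refine ⟨G * LinearMap.toMatrix' (g.symm : (Fin 3 → K) →ₗ[K] (Fin 3 → K)), ?_, ?_⟩
  · rw [Matrix.det_mul, LinearMap.det_toMatrix']
    exact mul_ne_zero hG (LinearEquiv.isUnit_det' g.symm).ne_zero
  · rw [hB, hA, ← Set.range_comp]
    congr 1
    funext i
    rw [Function.comp_apply, map_plane, Matrix.vecMul_vecMul]

theorem IsStd.exists_map {A B : Arrangement K 3} (hA : IsStd A c) (hB : IsStd B c) :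
    ∃ g : (Fin 3 → K) ≃ₗ[K] (Fin 3 → K),
      B.planes = Submodule.map (g : (Fin 3 → K) →ₗ[K] (Fin 3 → K)) '' A.planes := by
  obtain ⟨G, hG, hA⟩ := hA
  obtain ⟨H, hH, hB⟩ := hB
  have h1 : G⁻¹ * H * (H⁻¹ * G) = 1 := by
    rw [Matrix.mul_assoc, ← Matrix.mul_assoc H, Matrix.mul_nonsing_inv _ hH.isUnit,
      Matrix.one_mul, Matrix.nonsing_inv_mul _ hG.isUnit]
  have h2 : H⁻¹ * G * (G⁻¹ * H) = 1 := by
    rw [Matrix.mul_assoc, ← Matrix.mul_assoc G, Matrix.mul_nonsing_inv _ hG.isUnit,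
      Matrix.one_mul, Matrix.nonsing_inv_mul _ hH.isUnit]
  refine ⟨Matrix.toLin'OfInv h1 h2, ?_⟩
  rw [hB, hA, ← Set.range_comp]
  congr 1
  funext i
  rw [Function.comp_apply, map_plane]
  have : ((Matrix.toLin'OfInv h1 h2).symm : (Fin 3 → K) →ₗ[K] (Fin 3 → K)) =
    Matrix.toLin' (G⁻¹ * H) := rfl
  rw [this, LinearMap.toMatrix'_toLin', Matrix.vecMul_vecMul, ← Matrix.mul_assoc,
    Matrix.mul_nonsing_inv _ hG.isUnit, Matrix.one_mul]

/-- An equation in the normals that determines the parameter: it compares the parameter with a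
cross ratio of four of the planes through a line. -/
def crossEq {R : Type*} [CommRing R] (c : R) (w : Fin 15 → Fin 3 → R) : R :=
  (c + 1) * (det3 (w 3) (w 7) (w 2) * det3 (w 6) (w 0) (w 2)) -
    (c - 1) * (det3 (w 6) (w 7) (w 2) * det3 (w 3) (w 0) (w 2))

theorem crossEq_eq_zero_iff [CharZero K] {w : Fin 15 → Fin 3 → K} {G : Matrix (Fin 3) (Fin 3) K}
    (hG : G.det ≠ 0) {k : Fin 15 → K} (hk : ∀ i, k i ≠ 0)
    (hw : ∀ i, w i = k i • Matrix.vecMul (std c i) G) (c' : K) : crossEq c' w = 0 ↔ c' = c := by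
  have hdet : ∀ i j l, det3 (w i) (w j) (w l) =
      k i * k j * k l * (det3 (std c i) (std c j) (std c l) * G.det) := by
    intro i j l
    rw [← det3_vecMul, hw, hw, hw]
    simp only [det3, Pi.smul_apply, smul_eq_mul]
    ring
  have : crossEq c' w = 2 * (k 3 * k 7 * k 2 * k 6 * k 0 * k 2 * G.det ^ 2) * (c' - c) := by
    simp only [crossEq, hdet]
    simp only [det3, std, Matrix.cons_val]
    ring
  rw [this, mul_eq_zero, or_iff_right, sub_eq_zero]
  exact mul_ne_zero two_ne_zero (mul_ne_zero (mul_ne_zero (mul_ne_zero (mul_ne_zero (mul_ne_zero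
    (mul_ne_zero (hk 3) (hk 7)) (hk 2)) (hk 6)) (hk 0)) (hk 2)) (pow_ne_zero 2 hG))

/-- The normals of an arrangement that is equivalent to a standard arrangement, up to order and
scalars. -/
theorem IsStd.exists_perm [CharZero K] (hc : IsGood c) {w : Fin 15 → Fin 3 → K}
    (hw : ∀ i, w i ≠ 0) (h : IsStd (ofNormals w hw) c) :
    ∃ (σ : Equiv.Perm (Fin 15)) (G : Matrix (Fin 3) (Fin 3) K) (k : Fin 15 → K), G.det ≠ 0 ∧
      (∀ i, k i ≠ 0) ∧ ∀ i, w (σ i) = k i • Matrix.vecMul (std c i) G := by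
  obtain ⟨G, hG, hA⟩ := h
  have hstd := (pairwiseIndep_std hc hG).allIndep
  have hσ : ∀ i, ∃ j, plane (w j) = plane (Matrix.vecMul (std c i) G) := by
    intro i
    have : plane (Matrix.vecMul (std c i) G) ∈ (ofNormals w hw).planes := plane_mem_planes hA i
    exact this
  choose σ hσ using hσ
  have hinj : Function.Injective σ := fun i j hij =>
    hstd.injective_plane (by simp only [← hσ, hij])
  have hk : ∀ i, ∃ k : K, w (σ i) = k • Matrix.vecMul (std c i) G := fun i =>
    (plane_eq_plane_iff (hstd.1 i) (hw _)).mp (hσ i).symm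
  choose k hk using hk
  refine ⟨Equiv.ofBijective σ (Finite.injective_iff_bijective.mp hinj), G, k, hG, fun i h0 => ?_,
    hk⟩
  have := hk i
  rw [h0, zero_smul] at this
  exact hw _ this

theorem isStd_of_perm {w : Fin 15 → Fin 3 → K} (hw : ∀ i, w i ≠ 0) (σ : Equiv.Perm (Fin 15))
    {G : Matrix (Fin 3) (Fin 3) K} (hG : G.det ≠ 0)
    (h : ∀ i, ∃ k : K, k ≠ 0 ∧ w (σ i) = k • Matrix.vecMul (std c i) G) :
    IsStd (ofNormals w hw) c := by
  refine ⟨G, hG, ?_⟩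
  change Set.range (fun i => plane (w i)) = _
  rw [← σ.surjective.range_comp]
  congr 1
  funext i
  obtain ⟨k, hk, hi⟩ := h i
  rw [Function.comp_apply, hi, plane_smul hk]

/-- A permutation that preserves dependence also reflects it, because it has finite order. -/
theorem dep_perm_iff {σ : Equiv.Perm (Fin 15)}
    (h : ∀ i j k, dep i j k = true → dep (σ i) (σ j) (σ k) = true) (i j k : Fin 15) :
    dep (σ i) (σ j) (σ k) = true ↔ dep i j k = true := by
  refine ⟨fun hd => ?_, h i j k⟩
  have hpow : ∀ (n : ℕ) (i j k : Fin 15), dep i j k = true →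
      dep ((σ ^ n) i) ((σ ^ n) j) ((σ ^ n) k) = true := by
    intro n
    induction n with
    | zero => exact fun i j k h => h
    | succ n ih =>
      intro i j k hd
      rw [pow_succ']
      exact h _ _ _ (ih i j k hd)
  have hinv : σ ^ (orderOf σ - 1) * σ = 1 := by
    rw [← pow_succ, Nat.sub_add_cancel (orderOf_pos σ), pow_orderOf_eq_one]
  have := hpow (orderOf σ - 1) _ _ _ hd
  simpa only [← Equiv.Perm.mul_apply, hinv, Equiv.Perm.one_apply] using this

/-- The polynomial equations for the arrangements that are equivalent to the standard arrangement
with parameter `c`, within those that are equivalent to some standard arrangement. -/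
theorem isStd_iff_exists_perm [CharZero K] {c' : K} (hc' : IsGood c') (hc : IsGood c)
    {w : Fin 15 → Fin 3 → K} (hw : ∀ i, w i ≠ 0) (h : IsStd (ofNormals w hw) c') :
    IsStd (ofNormals w hw) c ↔ ∃ σ : Equiv.Perm (Fin 15),
      (∀ i j k, dep i j k = true → det3 (w (σ i)) (w (σ j)) (w (σ k)) = 0) ∧
        crossEq c (fun i => w (σ i)) = 0 := by
  have htable : ∀ {c : K}, IsGood c → ∀ {σ : Equiv.Perm (Fin 15)}
      {G : Matrix (Fin 3) (Fin 3) K} {k : Fin 15 → K}, G.det ≠ 0 → (∀ i, k i ≠ 0) →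
      (∀ i, w (σ i) = k i • Matrix.vecMul (std c i) G) → IsDepTable (fun i => w (σ i)) dep := by
    intro c hc σ G k hG hk hwk i j l
    have : det3 (w (σ i)) (w (σ j)) (w (σ l)) = k i * k j * k l * det3
        (Matrix.vecMul (std c i) G) (Matrix.vecMul (std c j) G) (Matrix.vecMul (std c l) G) := by
      rw [hwk, hwk, hwk]
      simp only [det3, Pi.smul_apply, smul_eq_mul]
      ring
    rw [this, mul_eq_zero, or_iff_right (mul_ne_zero (mul_ne_zero (hk i) (hk j)) (hk l))]
    exact det3_std_vecMul_eq_zero_iff hc hG i j l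
  constructor
  · intro h
    obtain ⟨σ, G, k, hG, hk, hwk⟩ := h.exists_perm hc hw
    exact ⟨σ, fun i j l hd => (htable hc hG hk hwk i j l).mpr hd,
      (crossEq_eq_zero_iff hG hk hwk c).mpr rfl⟩
  · rintro ⟨σ, hσ, hcr⟩
    obtain ⟨σ₀, G₀, k₀, hG₀, hk₀, hwk₀⟩ := h.exists_perm hc' hw
    have h₀ := htable hc' hG₀ hk₀ hwk₀
    set τ : Equiv.Perm (Fin 15) := σ.trans σ₀.symm with hτ
    have hστ : ∀ i, σ i = σ₀ (τ i) := fun i => by simp [hτ]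
    have hτd := dep_perm_iff (σ := τ) fun i j l hd => (h₀ _ _ _).mp (by
      simp only [← hστ]
      exact hσ i j l hd)
    have hdt : IsDepTable (fun i => w (σ i)) dep := by
      intro i j l
      simp only [hστ]
      exact (h₀ _ _ _).trans (hτd i j l)
    obtain ⟨c₁, G, hc₁, hG, hwk⟩ := exists_std_of_isDepTable hdt fun i => hw _
    have hk := hwk
    choose k hk0 hk using hk
    obtain rfl := (crossEq_eq_zero_iff hG hk0 hk c).mp hcr
    exact isStd_of_perm hw σ hG hwk

/-- An arrangement is equivalent to only finitely many standard arrangements. -/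
theorem finite_isStd [CharZero K] {c' : K} (hc' : IsGood c') {A : Arrangement K 3}
    (hA : IsStd A c') : {c : K | IsGood c ∧ IsStd A c}.Finite := by
  obtain ⟨G', hG', hAG⟩ := hA
  set w : Fin 15 → Fin 3 → K := fun i => Matrix.vecMul (std c' i) G'
  have hw : ∀ i, w i ≠ 0 := (pairwiseIndep_std hc' hG').allIndep.1
  have hAw : A = ofNormals w hw := Arrangement.ext hAG
  have hex : ∀ c : {c : K | IsGood c ∧ IsStd A c}, ∃ (σ : Equiv.Perm (Fin 15))
      (G : Matrix (Fin 3) (Fin 3) K) (k : Fin 15 → K), G.det ≠ 0 ∧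
      (∀ i, k i ≠ 0) ∧ ∀ i, w (σ i) = k i • Matrix.vecMul (std c.1 i) G :=
    fun c => IsStd.exists_perm c.2.1 hw (hAw ▸ c.2.2)
  choose σ G k hG hk hwk using hex
  refine Set.finite_coe_iff.mp (Finite.of_injective σ fun a b hab => ?_)
  apply Subtype.ext
  refine (crossEq_eq_zero_iff (hG b) (hk b) (hwk b) a.1).mp ?_
  rw [← hab]
  exact (crossEq_eq_zero_iff (hG a) (hk a) (hwk a) a.1).mpr rfl

end Classes

/-! ### The Zariski topology of the moduli space -/

section Topology

/-- An infinite space whose closed sets are the finite sets and the whole space is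
one-dimensional. -/
theorem topologicalKrullDim_eq_one {X : Type*} [TopologicalSpace X] [Infinite X]
    (hpt : ∀ x : X, IsClosed {x}) (hfin : ∀ C : Set X, IsClosed C → C ≠ Set.univ → C.Finite) :
    topologicalKrullDim X = 1 := by
  have hunion : ∀ C D : Set X, IsClosed C → IsClosed D → C ∪ D = Set.univ →
      C = Set.univ ∨ D = Set.univ := by
    intro C D hC hD h
    by_contra hne
    rw [not_or] at hne
    exact Set.infinite_univ (h ▸ (hfin C hC hne.1).union (hfin D hD hne.2))
  have huniv : IsIrreducible (Set.univ : Set X) := by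
    refine ⟨Set.univ_nonempty, isPreirreducible_iff_isClosed_union_isClosed.mpr ?_⟩
    intro C D hC hD h
    rw [Set.univ_subset_iff] at h
    rw [Set.univ_subset_iff, Set.univ_subset_iff]
    exact hunion C D hC hD h
  apply le_antisymm
  · refine Order.krullDim_le_one_iff.mpr fun C => ?_
    by_cases hC : (C : Set X) = Set.univ
    · exact Or.inr fun D _ => (hC ▸ Set.subset_univ (D : Set X) : (D : Set X) ⊆ C)
    · left
      intro D hD
      have hsub : (C : Set X).Subsingleton := by
        have hCf := hfin C C.isClosed' hC
        intro x hx y hy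
        by_contra hxy
        have := isPreirreducible_iff_isClosed_union_isClosed.mp C.isIrreducible'.2 {x}
          ((C : Set X) \ {x}) (hpt x) ?_ (by
            change (C : Set X) ⊆ _
            intro z hz
            by_cases hzx : z = x
            · exact Or.inl hzx
            · exact Or.inr ⟨hz, hzx⟩)
        · rcases this with h | h
          · exact hxy (h hy).symm
          · exact (h hx).2 rfl
        · rw [← Set.biUnion_of_singleton ((C : Set X) \ {x})]
          exact (hCf.subset Set.sdiff_subset).isClosed_biUnion fun z _ => hpt z
      obtain ⟨y, hy⟩ := D.isIrreducible'.1
      intro z hz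
      have : z = y := hsub hz (hD hy)
      rw [this]
      exact hy
  · rw [WithBot.one_le_iff_pos]
    refine Order.krullDim_pos_iff.mpr ?_
    obtain ⟨x⟩ : Nonempty X := inferInstance
    refine ⟨⟨{x}, isIrreducible_singleton, hpt x⟩, ⟨Set.univ, huniv, isClosed_univ⟩, ?_⟩
    refine lt_of_le_of_ne (Set.subset_univ _) fun h => ?_
    have h' : ({x} : Set X) = Set.univ := congrArg SetLike.coe h
    exact Set.infinite_univ (h' ▸ Set.finite_singleton x)

variable {K : Type u} [Field K] {σ : Type v}

/-- The closed sets of the Zariski topology on an affine space. -/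
theorem isClosed_zariski_iff (Z : Set (σ → K)) :
    @IsClosed _ (zariski K σ) Z ↔
      ∃ S : Set (MvPolynomial σ K), Z = {x | ∀ f ∈ S, aeval x f = 0} := by
  have key : ∀ S : Set (MvPolynomial σ K),
      pointToPoint (k := K) (K := K) ⁻¹' PrimeSpectrum.zeroLocus S =
        {x | ∀ f ∈ S, aeval x f = 0} := by
    intro S
    ext x
    rw [Set.mem_preimage, PrimeSpectrum.mem_zeroLocus]
    exact forall₂_congr fun f _ => mem_vanishingIdeal_singleton_iff x f
  rw [isClosed_induced_iff]
  constructor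
  · rintro ⟨t, ht, rfl⟩
    obtain ⟨S, rfl⟩ := (PrimeSpectrum.isClosed_iff_zeroLocus t).mp ht
    exact ⟨S, key S⟩
  · rintro ⟨S, rfl⟩
    exact ⟨_, PrimeSpectrum.isClosed_zeroLocus S, key S⟩

theorem map_std {R S : Type*} [CommRing R] [CommRing S] (φ : R →+* S) (c : R) (i : Fin 15)
    (j : Fin 3) : φ (std c i j) = std (φ c) i j := by
  fin_cases i <;> fin_cases j <;> simp [std]

theorem isDepTable_genericArr15 : IsDepTable
    (fun i => Matrix.vecMul (std (2 * RatFunc.X - 1 : RatFunc ℚ) i) (frame15 RatFunc.X)) dep :=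
  det3_std_vecMul_eq_zero_iff isGood_ratFunc
    (det_frame15_ne_zero isGood_ratFunc.ne_one_of_two_mul_sub)

theorem allIndep_genericArr15 : AllIndep
    (fun i => Matrix.vecMul (std (2 * RatFunc.X - 1 : RatFunc ℚ) i) (frame15 RatFunc.X)) :=
  (pairwiseIndep_std isGood_ratFunc
    (det_frame15_ne_zero isGood_ratFunc.ne_one_of_two_mul_sub)).allIndep

theorem planes_genericArr15 : genericArr15.planes = Set.range fun i => plane
    (Matrix.vecMul (std (2 * RatFunc.X - 1 : RatFunc ℚ) i) (frame15 RatFunc.X)) :=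
  planes_arr15 isGood_ratFunc.ne_one_of_two_mul_sub

theorem ncard_atoms_genericArr15 : {X : genericArr15.Lattice | IsAtom X}.ncard = 15 := by
  rw [ncard_atoms]
  exact ncard_planes_arr15 isGood_ratFunc

theorem moduli_mk_eq_iff {A B : Arrangement K 3}
    (hA : A ∈ Realizations K genericArr15.Lattice 3)
    (hB : B ∈ Realizations K genericArr15.Lattice 3) {c : K} (hAc : IsStd A c) :
    Moduli.mk A hA = Moduli.mk B hB ↔ IsStd B c := by
  constructor
  · intro h
    obtain ⟨g, hg⟩ := Quotient.exact h
    exact hAc.map g hg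
  · intro h
    exact Quotient.sound (hAc.exists_map h)

/-- The quotient map from the tuples of linear forms to the moduli space. -/
def classOf (M : FormTuples K genericArr15.Lattice 3) : Moduli K genericArr15.Lattice 3 :=
  Moduli.mk (ofNormals _ M.2.choose) M.2.choose_spec

/-- The closed sets of the moduli space, in terms of the tuples of linear forms. -/
theorem isClosed_moduli_iff (C : Set (Moduli K genericArr15.Lattice 3)) :
    IsClosed C ↔ ∃ Z, @IsClosed _ (zariski K _) Z ∧
      ∀ M : FormTuples K genericArr15.Lattice 3, classOf M ∈ C ↔ M.1 ∈ Z := by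
  have h1 : IsClosed C ↔ @IsClosed _ (TopologicalSpace.induced Subtype.val (zariski K _))
      (classOf (K := K) ⁻¹' C) := isClosed_coinduced
  rw [h1]
  exact (@isClosed_induced_iff _ _ (zariski K _) _ _).trans <| exists_congr fun Z =>
    and_congr_right fun _ =>
      ⟨fun h M => (Set.ext_iff.mp h M).symm, fun h => Set.ext fun M => (h M).symm⟩

theorem range_cast (w : Fin 15 → Fin 3 → K) :
    (Set.range fun i : Fin {X : genericArr15.Lattice | IsAtom X}.ncard =>
      plane (w (Fin.cast ncard_atoms_genericArr15 i))) = Set.range fun i => plane (w i) :=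
  (finCongr ncard_atoms_genericArr15).surjective.range_comp fun i => plane (w i)

theorem IsStd.of_planes_eq {A : Arrangement K 3} {c : K}
    (h : A.planes = Set.range fun i => plane (std c i)) : IsStd A c :=
  ⟨1, by simp, by simpa only [Matrix.vecMul_one] using h⟩

theorem isStd_ofNormals_std (c : K) (h : ∀ i, std c i ≠ 0) : IsStd (ofNormals (std c) h) c :=
  IsStd.of_planes_eq rfl

variable [CharZero K]

/-- The realizations of the lattice are the arrangements that are equivalent to a standard
arrangement. -/
theorem mem_realizations_genericArr15_iff (A : Arrangement K 3) :
    A ∈ Realizations K genericArr15.Lattice 3 ↔ ∃ c, IsGood c ∧ IsStd A c := by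
  rw [mem_realizations_iff]
  constructor
  · rintro ⟨-, ⟨φ⟩⟩
    obtain ⟨w, hw, hd, hA⟩ := exists_normals_of_latticeIso isDepTable_genericArr15
      allIndep_genericArr15 _ planes_genericArr15 A φ.symm
    obtain ⟨c, G, hc, hG, hwk⟩ := exists_std_of_isDepTable hd hw.1
    refine ⟨c, hc, G, hG, hA.trans ?_⟩
    congr 1
    funext i
    obtain ⟨k, hk, hi⟩ := hwk i
    rw [hi, plane_smul hk]
  · rintro ⟨c, hc, G, hG, hA⟩
    have hind := (pairwiseIndep_std hc hG).allIndep
    refine ⟨?_, nonempty_latticeIso (det3_std_vecMul_eq_zero_iff hc hG) hind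
      isDepTable_genericArr15 allIndep_genericArr15 A hA _ planes_genericArr15⟩
    rw [ncard_atoms_genericArr15, hind.ncard_planes hA, Nat.card_fin]

/-- The class of the standard arrangement with parameter `c`. -/
def stdClass (c : {c : K // IsGood c}) : Moduli K genericArr15.Lattice 3 :=
  Moduli.mk (ofNormals (std c.1) (std_ne_zero c.2))
    ((mem_realizations_genericArr15_iff _).mpr ⟨c.1, c.2, isStd_ofNormals_std _ _⟩)

theorem stdClass_eq_mk_iff (c : {c : K // IsGood c}) {A : Arrangement K 3}
    (hA : A ∈ Realizations K genericArr15.Lattice 3) :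
    stdClass c = Moduli.mk A hA ↔ IsStd A c.1 :=
  moduli_mk_eq_iff _ _ (isStd_ofNormals_std _ _)

theorem stdClass_surjective : Function.Surjective (stdClass (K := K)) := by
  intro x
  obtain ⟨⟨A, hA⟩, rfl⟩ := Quotient.exists_rep x
  obtain ⟨c, hc, h⟩ := (mem_realizations_genericArr15_iff A).mp hA
  exact ⟨⟨c, hc⟩, (stdClass_eq_mk_iff _ _).mpr h⟩

theorem finite_stdClass_preimage (x : Moduli K genericArr15.Lattice 3) :
    (stdClass ⁻¹' {x}).Finite := by
  obtain ⟨c₀, rfl⟩ := stdClass_surjective x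
  have := finite_isStd c₀.2 (isStd_ofNormals_std c₀.1 (std_ne_zero c₀.2))
  refine (this.preimage (f := Subtype.val) Subtype.val_injective.injOn).subset fun c hc => ?_
  exact ⟨c.2, (stdClass_eq_mk_iff c _).mp hc⟩

theorem isStd_arr15 {l : K} (h : IsGood (2 * l - 1)) : IsStd (arr15 l) (2 * l - 1) :=
  ⟨frame15 l, det_frame15_ne_zero h.ne_one_of_two_mul_sub, planes_arr15 h.ne_one_of_two_mul_sub⟩

/-- The tuple of standard forms. -/
def stdTuple (c : {c : K // IsGood c}) : FormTuples K genericArr15.Lattice 3 :=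
  ⟨fun ij => std c.1 (Fin.cast ncard_atoms_genericArr15 ij.1) ij.2,
    fun i => std_ne_zero c.2 (Fin.cast ncard_atoms_genericArr15 i),
    (mem_realizations_genericArr15_iff _).mpr
      ⟨c.1, c.2, IsStd.of_planes_eq (range_cast (std c.1))⟩⟩

theorem classOf_stdTuple (c : {c : K // IsGood c}) : classOf (stdTuple c) = stdClass c :=
  ((stdClass_eq_mk_iff c _).mpr (IsStd.of_planes_eq (range_cast (std c.1)))).symm

/-- A proper closed set pulls back to a set of parameters where a nonzero polynomial in one variable
vanishes. -/
theorem finite_of_isClosed {C : Set (Moduli K genericArr15.Lattice 3)} (hC : IsClosed C)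
    (hne : C ≠ Set.univ) : C.Finite := by
  obtain ⟨Z, hZ, hCZ⟩ := (isClosed_moduli_iff C).mp hC
  obtain ⟨S, rfl⟩ := (isClosed_zariski_iff Z).mp hZ
  obtain ⟨x, hx⟩ := (Set.ne_univ_iff_exists_notMem C).mp hne
  obtain ⟨c₀, rfl⟩ := stdClass_surjective x
  rw [← classOf_stdTuple, hCZ, Set.mem_ofPred_eq] at hx
  push Not at hx
  obtain ⟨f, hf, hf0⟩ := hx
  set p : Polynomial K := aeval (fun ij : _ × Fin 3 =>
    std (Polynomial.X : Polynomial K) (Fin.cast ncard_atoms_genericArr15 ij.1) ij.2) f with hp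
  have hpe : ∀ c : {c : K // IsGood c}, Polynomial.aeval c.1 p = aeval (stdTuple c).1 f := by
    intro c
    have h : (stdTuple c).1 = fun ij : _ × Fin 3 => Polynomial.aeval c.1
        (std (Polynomial.X : Polynomial K) (Fin.cast ncard_atoms_genericArr15 ij.1) ij.2) := by
      funext ij
      have := map_std (Polynomial.aeval c.1 : Polynomial K →ₐ[K] K).toRingHom Polynomial.X
        (Fin.cast ncard_atoms_genericArr15 ij.1) ij.2
      simp only [AlgHom.toRingHom_eq_coe, RingHom.coe_coe, Polynomial.aeval_X] at this
      exact this.symm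
    rw [h, hp, ← AlgHom.comp_apply, comp_aeval]
  have hp0 : p ≠ 0 := by
    intro h
    exact hf0 (by rw [← hpe, h, map_zero])
  have hfin : {c : {c : K // IsGood c} | p.IsRoot c.1}.Finite :=
    (Polynomial.finite_setOfPred_isRoot hp0).preimage Subtype.val_injective.injOn
  refine (hfin.image stdClass).subset fun x hx => ?_
  obtain ⟨c, rfl⟩ := stdClass_surjective x
  rw [← classOf_stdTuple, hCZ] at hx
  refine ⟨c, ?_, rfl⟩
  change p.IsRoot c.1
  rw [Polynomial.IsRoot, ← Polynomial.coe_aeval_eq_eval, hpe]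
  exact hx f hf

/-- The vectors of a tuple of forms, labelled by the planes of the standard arrangement. -/
def labelled {R : Type*} (x : Fin {X : genericArr15.Lattice | IsAtom X}.ncard × Fin 3 → R)
    (i : Fin 15) (j : Fin 3) : R :=
  x (Fin.cast ncard_atoms_genericArr15.symm i, j)

/-- The points of the moduli space are closed. -/
theorem isClosed_singleton_moduli (x : Moduli K genericArr15.Lattice 3) : IsClosed {x} := by
  obtain ⟨c, rfl⟩ := stdClass_surjective x
  let Z : Equiv.Perm (Fin 15) → Set (Fin {X : genericArr15.Lattice | IsAtom X}.ncard × Fin 3 → K) :=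
    fun σ => {x | (∀ i j k, dep i j k = true →
      det3 (labelled x (σ i)) (labelled x (σ j)) (labelled x (σ k)) = 0) ∧
        crossEq c.1 (fun i => labelled x (σ i)) = 0}
  have hZ : ∀ σ, @IsClosed _ (zariski K _) (Z σ) := by
    intro σ
    let W := labelled
      (R := MvPolynomial (Fin {X : genericArr15.Lattice | IsAtom X}.ncard × Fin 3) K) X
    have hW : ∀ (x : Fin {X : genericArr15.Lattice | IsAtom X}.ncard × Fin 3 → K) i j,
        aeval x (W i j) = labelled x i j := fun x i j => aeval_X x _
    have hdet : ∀ (x : Fin {X : genericArr15.Lattice | IsAtom X}.ncard × Fin 3 → K) i j k,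
        aeval x (det3 (W i) (W j) (W k)) = det3 (labelled x i) (labelled x j) (labelled x k) := by
      intro x i j k
      simp only [det3, map_add, map_sub, map_mul, hW]
    have hcr : ∀ x : Fin {X : genericArr15.Lattice | IsAtom X}.ncard × Fin 3 → K,
        aeval x (crossEq (C c.1) fun i => W (σ i)) = crossEq c.1 fun i => labelled x (σ i) := by
      intro x
      simp only [crossEq, map_add, map_sub, map_mul, map_one, hdet, algHom_C,
        Algebra.algebraMap_self, RingHom.id_apply]
    rw [isClosed_zariski_iff]
    refine ⟨{f | (∃ i j k, dep i j k = true ∧ f = det3 (W (σ i)) (W (σ j)) (W (σ k))) ∨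
      f = crossEq (C c.1) fun i => W (σ i)}, ?_⟩
    ext x
    constructor
    · rintro ⟨h1, h2⟩ f (⟨i, j, k, hd, rfl⟩ | rfl)
      · rw [hdet]
        exact h1 i j k hd
      · rw [hcr]
        exact h2
    · intro h
      refine ⟨fun i j k hd => ?_, ?_⟩
      · rw [← hdet]
        exact h _ (Or.inl ⟨i, j, k, hd, rfl⟩)
      · rw [← hcr]
        exact h _ (Or.inr rfl)
  refine (isClosed_moduli_iff _).mpr ⟨⋃ σ, Z σ, ?_, fun M => ?_⟩
  · exact @isClosed_iUnion_of_finite _ _ (zariski K _) _ _ hZ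
  · have hM0 : ∀ i, labelled M.1 i ≠ 0 := fun i =>
      M.2.choose (Fin.cast ncard_atoms_genericArr15.symm i)
    have hMA : (ofNormals _ M.2.choose : Arrangement K 3) = ofNormals (labelled M.1) hM0 :=
      Arrangement.ext (range_cast (labelled M.1))
    obtain ⟨c', hc', hstd⟩ := (mem_realizations_genericArr15_iff _).mp M.2.choose_spec
    rw [Set.mem_iUnion, Set.mem_singleton_iff, eq_comm, classOf, stdClass_eq_mk_iff, hMA]
    rw [hMA] at hstd
    exact isStd_iff_exists_perm hc' c.2 hM0 hstd

end Topology

/-! ### The moduli space over the complex numbers -/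

theorem infinite_moduli : Infinite (Moduli ℂ genericArr15.Lattice 3) := by
  by_contra h
  rw [not_infinite_iff_finite] at h
  have h1 : (Set.univ : Set {c : ℂ // IsGood c}).Finite := by
    have := (Set.finite_univ (α := Moduli ℂ genericArr15.Lattice 3)).preimage'
      (f := stdClass) fun x _ => finite_stdClass_preimage x
    simpa using this
  have h2 : ((fun l : ℂ => 2 * l - 1) ⁻¹' {c : ℂ | IsGood c}).Finite := by
    refine Set.Finite.preimage (fun a _ b _ hab => ?_) (Set.finite_coe_iff.mp
      (Set.finite_univ_iff.mp h1))
    have hab : 2 * a - 1 = 2 * b - 1 := hab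
    linear_combination hab / 2
  have h3 : ((fun l : ℂ => 2 * l - 1) ⁻¹' {c : ℂ | IsGood c}) = excludedParamsᶜ :=
    Set.ext fun l => isGood_iff l
  rw [h3] at h2
  have h4 : excludedParams.Finite := by
    simp [excludedParams]
  exact Set.infinite_univ (α := ℂ) (by
    rw [← Set.union_compl_self excludedParams]
    exact h4.union h2)

theorem topologicalKrullDim_moduli :
    topologicalKrullDim (Moduli ℂ genericArr15.Lattice 3) = 1 :=
  have := infinite_moduli
  topologicalKrullDim_eq_one isClosed_singleton_moduli fun _ => finite_of_isClosed

theorem arr15_mem_realizations {l : ℂ} (hl : l ∉ excludedParams) :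
    arr15 l ∈ Realizations ℂ genericArr15.Lattice 3 :=
  (mem_realizations_genericArr15_iff _).mpr
    ⟨2 * l - 1, (isGood_iff l).mpr hl, isStd_arr15 ((isGood_iff l).mpr hl)⟩

theorem exists_eq_mk_arr15 (x : Moduli ℂ genericArr15.Lattice 3) :
    ∃ (l : ℂ) (hl : l ∉ excludedParams), x = Moduli.mk (arr15 l) (arr15_mem_realizations hl) := by
  obtain ⟨⟨c, hc⟩, rfl⟩ := stdClass_surjective x
  have hl : c = 2 * ((c + 1) / 2) - 1 := by ring
  have hl' : (c + 1) / 2 ∉ excludedParams := (isGood_iff _).mp (hl ▸ hc)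
  refine ⟨(c + 1) / 2, hl', (stdClass_eq_mk_iff _ _).mpr ?_⟩
  have := isStd_arr15 ((isGood_iff _).mpr hl')
  rw [← hl] at this
  exact this

/-! ### Automorphisms of the intersection lattice -/

section Automorphisms

variable {K : Type u} [Field K] {ι : Type*} {w : ι → Fin 3 → K} {d : ι → ι → ι → Bool}

/-- The planes of an arrangement as the atoms of the lattice. -/
def atomEquiv (hw : AllIndep w) (A : Arrangement K 3)
    (hA : A.planes = Set.range fun i => plane (w i)) : ι ≃ {X : A.Lattice // IsAtom X} :=
  Equiv.ofBijective (fun i => ⟨atomAt A hA i, isAtom_atomAt A hA i⟩)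
    ⟨fun _ _ h => atomAt_injective hw A hA (congrArg Subtype.val h), fun X => by
      obtain ⟨i, hi⟩ := exists_atomAt_eq hA X.2
      exact ⟨i, Subtype.ext hi⟩⟩

/-- The permutation of the planes that a lattice automorphism induces. -/
def atomPerm (hw : AllIndep w) (A : Arrangement K 3)
    (hA : A.planes = Set.range fun i => plane (w i)) :
    (A.Lattice ≃o A.Lattice) →* Equiv.Perm ι where
  toFun φ := (atomEquiv hw A hA).symm.permCongr
    (φ.toEquiv.subtypeEquiv fun X => (φ.isAtom_iff X).symm)
  map_one' := by
    ext i
    simp [Equiv.permCongr_apply, Equiv.subtypeEquiv]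
  map_mul' φ ψ := by
    ext i
    simp [Equiv.permCongr_apply, Equiv.subtypeEquiv]

theorem atomAt_atomPerm (hw : AllIndep w) (A : Arrangement K 3)
    (hA : A.planes = Set.range fun i => plane (w i)) (φ : A.Lattice ≃o A.Lattice) (i : ι) :
    atomAt A hA (atomPerm hw A hA φ i) = φ (atomAt A hA i) := by
  have h : atomEquiv hw A hA (atomPerm hw A hA φ i) =
      ⟨φ (atomAt A hA i), (φ.isAtom_iff _).mpr (isAtom_atomAt A hA i)⟩ :=
    (atomEquiv hw A hA).apply_symm_apply _
  exact congrArg Subtype.val h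

theorem mem_planesAbove_iff (A : Arrangement K 3)
    (hA : A.planes = Set.range fun i => plane (w i)) (X : A.Lattice) (i : ι) :
    i ∈ planesAbove w (OrderDual.ofDual X.1) ↔ atomAt A hA i ≤ X :=
  Iff.rfl

theorem atomPerm_injective (hw : AllIndep w) (A : Arrangement K 3)
    (hA : A.planes = Set.range fun i => plane (w i)) :
    Function.Injective (atomPerm hw A hA) := by
  intro φ ψ h
  refine DFunLike.ext _ _ fun X => ?_
  have key : ∀ θ : A.Lattice ≃o A.Lattice, planesAbove w (OrderDual.ofDual (θ X).1) =
      atomPerm hw A hA θ '' planesAbove w (OrderDual.ofDual X.1) := by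
    intro θ
    ext i
    rw [Set.mem_image, mem_planesAbove_iff A hA]
    constructor
    · intro hi
      refine ⟨(atomPerm hw A hA θ).symm i, ?_, Equiv.apply_symm_apply _ _⟩
      rw [mem_planesAbove_iff A hA, ← θ.le_iff_le, ← atomAt_atomPerm hw A hA,
        Equiv.apply_symm_apply]
      exact hi
    · rintro ⟨j, hj, rfl⟩
      rw [atomAt_atomPerm, θ.le_iff_le]
      exact hj
  rw [← flatOf_planesAbove A hA (φ X), ← flatOf_planesAbove A hA (ψ X), key φ, key ψ, h]

/-- The permutations that preserve the dependent triples. -/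
def depAut (d : ι → ι → ι → Bool) : Subgroup (Equiv.Perm ι) where
  carrier := {σ | ∀ i j k, d (σ i) (σ j) (σ k) = d i j k}
  one_mem' := fun _ _ _ => rfl
  mul_mem' := fun {σ τ} hσ hτ i j k => (hσ (τ i) (τ j) (τ k)).trans (hτ i j k)
  inv_mem' := fun {σ} hσ i j k => by
    rw [← hσ]
    exact congr (congr (congrArg d (σ.apply_symm_apply i)) (σ.apply_symm_apply j))
      (σ.apply_symm_apply k)

theorem range_atomPerm (hd : IsDepTable w d) (hw : AllIndep w) (A : Arrangement K 3)
    (hA : A.planes = Set.range fun i => plane (w i)) : (atomPerm hw A hA).range = depAut d := by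
  ext σ
  constructor
  · rintro ⟨φ, rfl⟩ i j k
    rw [Bool.eq_iff_iff, ← hd, ← hd]
    by_cases hij : i = j
    · subst hij
      simp only [det3]
      exact iff_of_true (by ring) (by ring)
    · rw [det3_eq_zero_iff_forall_le hw A hA hij,
        det3_eq_zero_iff_forall_le hw A hA ((atomPerm hw A hA φ).injective.ne hij)]
      simp_rw [atomAt_atomPerm]
      constructor
      · intro h Y hi hj
        exact φ.le_iff_le.mp (h (φ Y) (φ.le_iff_le.mpr hi) (φ.le_iff_le.mpr hj))
      · intro h Y hi hj
        have := h (φ.symm Y) (φ.le_symm_apply.mpr hi) (φ.le_symm_apply.mpr hj)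
        exact φ.le_symm_apply.mp this
  · intro hσ
    -- The relabelled family has the same flats, which gives an automorphism.
    have hd' : IsDepTable (fun i => w (σ i)) d := fun i j k => by
      rw [hd, hσ i j k]
    have hw' : AllIndep fun i => w (σ i) :=
      ⟨fun i => hw.1 _, fun i j hij => hw.2 _ _ (σ.injective.ne hij)⟩
    have hA' : A.planes = Set.range fun i => plane (w (σ i)) :=
      hA.trans (σ.surjective.range_comp fun i => plane (w i)).symm
    set φ := (flatIso hd hw A hA).trans (flatIso hd' hw' A hA').symm with hφ
    refine ⟨φ, Equiv.ext fun i => atomAt_injective hw A hA ?_⟩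
    rw [atomAt_atomPerm, hφ, OrderIso.trans_apply, OrderIso.symm_apply_eq]
    apply Subtype.ext
    ext k
    change plane (w i) ≤ plane (w k) ↔ plane (w (σ i)) ≤ plane (w (σ k))
    rw [plane_le_plane_iff (hw.1 _), plane_le_plane_iff (hw.1 _)]
    by_cases hik : i = k
    · subst hik
      exact iff_of_true ⟨1, (one_smul _ _).symm⟩ ⟨1, (one_smul _ _).symm⟩
    · exact iff_of_false (fun ⟨a, ha⟩ => hw.2 i k hik a ha) fun ⟨a, ha⟩ => hw'.2 i k hik a ha

/-- The automorphism group of the intersection lattice. -/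
def latticeAutEquiv (hd : IsDepTable w d) (hw : AllIndep w) (A : Arrangement K 3)
    (hA : A.planes = Set.range fun i => plane (w i)) : (A.Lattice ≃o A.Lattice) ≃* depAut d :=
  (MonoidHom.ofInjective (atomPerm_injective hw A hA)).trans
    (MulEquiv.subgroupCongr (range_atomPerm hd hw A hA))

end Automorphisms

/-! ### The action of the wreath product on the lines -/

section SignedPermutations

/-- The six points on five lines come in three pairs: the points `(a, 0)` and `(a, 1)` are on the
line `a`, where `a < 3`. -/
abbrev PairPoint : Type := Fin 3 × ZMod 2

/-- The two points on five lines that are on a given line of the projective plane. -/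
def linePoints : Fin 15 → PairPoint × PairPoint :=
  ![((0, 0), (0, 1)), ((1, 0), (1, 1)), ((2, 0), (2, 1)), ((0, 1), (1, 1)), ((0, 0), (1, 0)),
    ((0, 0), (1, 1)), ((0, 1), (1, 0)), ((0, 1), (2, 1)), ((0, 0), (2, 1)), ((0, 0), (2, 0)),
    ((0, 1), (2, 0)), ((1, 1), (2, 1)), ((1, 0), (2, 1)), ((1, 1), (2, 0)), ((1, 0), (2, 0))]

/-- Incidence of a point on five lines with a line. -/
def onLine (p : PairPoint) (i : Fin 15) : Bool :=
  p == (linePoints i).1 || p == (linePoints i).2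

/-- The line through two points on five lines. -/
def lineThrough (p q : PairPoint) : Fin 15 :=
  ((List.finRange 15).find? fun i => onLine p i && onLine q i).getD 0

theorem onLine_lineThrough : ∀ p q, onLine p (lineThrough p q) = true ∧
    onLine q (lineThrough p q) = true := by decide +kernel

theorem eq_of_onLine : ∀ p q, p ≠ q → ∀ i j, onLine p i = true → onLine q i = true →
    onLine p j = true → onLine q j = true → i = j := by decide +kernel

theorem eq_of_forall_onLine : ∀ p q : PairPoint, (∀ i, onLine p i = true → onLine q i = true) →
    p = q := by decide +kernel

theorem linePoints_ne : ∀ i, (linePoints i).1 ≠ (linePoints i).2 := by decide +kernel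

theorem onLine_iff (p : PairPoint) (i : Fin 15) :
    onLine p i = true ↔ p = (linePoints i).1 ∨ p = (linePoints i).2 := by
  simp [onLine]

/-- The map of the lines that a permutation of the six points induces. -/
def lineMap (τ : Equiv.Perm PairPoint) (i : Fin 15) : Fin 15 :=
  lineThrough (τ (linePoints i).1) (τ (linePoints i).2)

theorem onLine_lineMap (τ : Equiv.Perm PairPoint) {p : PairPoint} {i : Fin 15}
    (h : onLine p i = true) : onLine (τ p) (lineMap τ i) = true := by
  rcases (onLine_iff p i).mp h with rfl | rfl
  · exact (onLine_lineThrough _ _).1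
  · exact (onLine_lineThrough _ _).2

/-- A map of the lines is determined by its compatibility with a permutation of the points. -/
theorem eq_lineMap (τ : Equiv.Perm PairPoint) {i j : Fin 15}
    (h : ∀ p, onLine p i = true → onLine (τ p) j = true) : j = lineMap τ i := by
  have h1 : onLine (linePoints i).1 i = true := (onLine_iff _ _).mpr (Or.inl rfl)
  have h2 : onLine (linePoints i).2 i = true := (onLine_iff _ _).mpr (Or.inr rfl)
  exact eq_of_onLine _ _ (τ.injective.ne (linePoints_ne i)) _ _ (h _ h1) (h _ h2)
    (onLine_lineMap τ h1) (onLine_lineMap τ h2)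

theorem lineMap_mul (τ ρ : Equiv.Perm PairPoint) (i : Fin 15) :
    lineMap (τ * ρ) i = lineMap τ (lineMap ρ i) :=
  (eq_lineMap (τ * ρ) (j := lineMap τ (lineMap ρ i)) fun _ h =>
    onLine_lineMap τ (onLine_lineMap ρ h)).symm

theorem lineMap_one (i : Fin 15) : lineMap 1 i = i :=
  (eq_lineMap 1 fun _ h => h).symm

/-- The permutation of the lines that a permutation of the six points induces. -/
def linePerm : Equiv.Perm PairPoint →* Equiv.Perm (Fin 15) where
  toFun τ := ⟨lineMap τ, lineMap τ⁻¹,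
    fun i => by rw [← lineMap_mul, inv_mul_cancel, lineMap_one],
    fun i => by rw [← lineMap_mul, mul_inv_cancel, lineMap_one]⟩
  map_one' := Equiv.ext lineMap_one
  map_mul' τ ρ := Equiv.ext (lineMap_mul τ ρ)

theorem linePerm_apply (τ : Equiv.Perm PairPoint) (i : Fin 15) : linePerm τ i = lineMap τ i := rfl

/-- The action of the wreath product on the six points. -/
def pairPerm : WreathZ2S3 →* Equiv.Perm PairPoint where
  toFun g := {
    toFun := fun p => (g.right p.1, Multiplicative.toAdd (g.left (g.right p.1)) + p.2)
    invFun := fun p => (g.right.symm p.1, -Multiplicative.toAdd (g.left p.1) + p.2)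
    left_inv := fun p => by simp [← add_assoc, CharTwo.add_self_eq_zero]
    right_inv := fun p => by simp [← add_assoc, CharTwo.add_self_eq_zero] }
  map_one' := by
    ext1 p
    simp
  map_mul' g h := by
    ext1 p
    simp only [SemidirectProduct.mul_left, SemidirectProduct.mul_right, Equiv.Perm.mul_apply,
      Pi.mul_apply, toAdd_mul, Equiv.coe_fn_mk, add_assoc]
    have : mulAutArrow g.right h.left (g.right (h.right p.1)) = h.left (h.right p.1) :=
      congrArg h.left (g.right.symm_apply_apply _)
    rw [this]

theorem pairPerm_apply (g : WreathZ2S3) (p : PairPoint) :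
    pairPerm g p = (g.right p.1, Multiplicative.toAdd (g.left (g.right p.1)) + p.2) := rfl

theorem pairPerm_injective : Function.Injective pairPerm := by
  intro g h hgh
  have h1 : ∀ p : PairPoint, (g.right p.1, Multiplicative.toAdd (g.left (g.right p.1)) + p.2) =
      (h.right p.1, Multiplicative.toAdd (h.left (h.right p.1)) + p.2) := fun p =>
    congrArg (fun τ : Equiv.Perm PairPoint => τ p) hgh
  have hr : g.right = h.right := Equiv.ext fun a => congrArg Prod.fst (h1 (a, 0))
  refine SemidirectProduct.ext (funext fun a => ?_) hr
  have h2 := congrArg Prod.snd (h1 (g.right.symm a, 0))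
  simpa [← hr] using h2

theorem linePerm_injective : Function.Injective linePerm := by
  intro τ ρ h
  ext1 p
  have hinc : ∀ i, onLine p i = true → onLine (ρ⁻¹ (τ p)) i = true := by
    intro i hi
    have h1 := onLine_lineMap τ hi
    rw [← linePerm_apply, h, linePerm_apply] at h1
    have h2 := onLine_lineMap ρ⁻¹ h1
    rwa [← lineMap_mul, inv_mul_cancel, lineMap_one] at h2
  have := eq_of_forall_onLine _ _ hinc
  have h3 : ρ p = ρ (ρ⁻¹ (τ p)) := congrArg ρ this
  rw [← Equiv.Perm.mul_apply, mul_inv_cancel] at h3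
  exact h3.symm

/-- The sign change in one place. -/
def signChange (a : Fin 3) : WreathZ2S3 :=
  SemidirectProduct.inl (Pi.mulSingle a (Multiplicative.ofAdd 1))

/-- The transposition of two places. -/
def transposition (a b : Fin 3) : WreathZ2S3 := SemidirectProduct.inr (Equiv.swap a b)

/-- A subgroup of the wreath product that contains the sign changes and the transpositions is the
whole group. -/
theorem wreath_eq_top {S : Subgroup WreathZ2S3}
    (h1 : ∀ a, signChange a ∈ S) (h2 : ∀ a b, a ≠ b → transposition a b ∈ S) : S = ⊤ := by
  rw [Subgroup.eq_top_iff']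
  intro g
  rw [← SemidirectProduct.inl_left_mul_inr_right g]
  refine S.mul_mem ?_ ?_
  · have h : ∀ a (z : Multiplicative (ZMod 2)),
        (SemidirectProduct.inl (Pi.mulSingle a z) : WreathZ2S3) ∈ S := by
      intro a z
      have hz : z = 1 ∨ z = Multiplicative.ofAdd 1 := by revert z; decide
      rcases hz with rfl | rfl
      · rw [Pi.mulSingle_one, map_one]
        exact S.one_mem
      · exact h1 a
    rw [← Finset.univ_prod_mulSingle g.left]
    exact (S.comap SemidirectProduct.inl).prod_mem fun a _ => h a _
  · refine Equiv.Perm.swap_induction_on g.right ?_ ?_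
    · rw [map_one]
      exact S.one_mem
    · intro f a b hab hf
      rw [map_mul]
      exact S.mul_mem (h2 a b hab) hf

/-- A map of the lines that carries the lines through each intersection point of at least three
lines to lines through such a point preserves dependence. -/
theorem dep_of_forall_stdPoints {σ : Fin 15 → Fin 15}
    (hσ : ∀ P ∈ stdPoints, ∃ Q ∈ stdPoints, ∀ i ∈ P.1, σ i ∈ Q.1) (i j k : Fin 15)
    (h : dep i j k = true) : dep (σ i) (σ j) (σ k) = true := by
  simp only [dep, Bool.or_eq_true, beq_iff_eq, List.any_eq_true, Bool.and_eq_true,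
    List.contains_iff_mem] at h ⊢
  rcases h with ((rfl | rfl) | rfl) | ⟨P, hP, ⟨hi, hj⟩, hk⟩
  · simp
  · simp
  · simp
  · obtain ⟨Q, hQ, h⟩ := hσ P hP
    exact Or.inr ⟨Q, hQ, ⟨h i hi, h j hj⟩, h k hk⟩

/-- The test that a permutation of the six points preserves the points of intersection. -/
def pointsCheck (τ : Equiv.Perm PairPoint) : Bool :=
  stdPoints.all fun P => stdPoints.any fun Q => P.1.all fun i => Q.1.contains (lineMap τ i)

theorem pointsCheck_flip : ∀ a : Fin 3, pointsCheck (pairPerm (signChange a)) = true := by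
  decide +kernel

theorem pointsCheck_swap : ∀ a b : Fin 3, pointsCheck (pairPerm (transposition a b)) = true := by
  decide +kernel

theorem linePerm_mem_depAut {τ : Equiv.Perm PairPoint} (h : pointsCheck τ = true) :
    linePerm τ ∈ depAut dep := by
  intro i j k
  rw [Bool.eq_iff_iff]
  refine dep_perm_iff (dep_of_forall_stdPoints fun P hP => ?_) i j k
  simp only [pointsCheck, List.all_eq_true, List.any_eq_true, List.contains_iff_mem] at h
  exact h P hP

theorem linePerm_pairPerm_mem (g : WreathZ2S3) : linePerm (pairPerm g) ∈ depAut dep := by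
  have : (depAut dep).comap (linePerm.comp pairPerm) = ⊤ :=
    wreath_eq_top (fun a => linePerm_mem_depAut (pointsCheck_flip a))
      fun a b _ => linePerm_mem_depAut (pointsCheck_swap a b)
  exact (Subgroup.eq_top_iff' _).mp this g

end SignedPermutations

/-! ### Permutations that preserve dependence -/

section DepAut

/-- The number of the planes through the intersection of two planes. -/
def thirdCount (i j : Fin 15) : ℕ := (Finset.univ.filter fun k => dep i j k = true).card

/-- The number of the pairs that are dependent with a given plane. -/
def pairCount (i : Fin 15) : ℕ :=
  (Finset.univ.filter fun p : Fin 15 × Fin 15 => dep i p.1 p.2 = true).card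

theorem exists_of_thirdCount : ∀ i j, i ≠ j → thirdCount i j = 5 →
    ∃ q, ∀ k, dep i j k = true → onLine q k = true := by decide +kernel

theorem exists_thirdCount : ∀ p, ∃ i j, i ≠ j ∧ thirdCount i j = 5 ∧
    ∀ k, onLine p k = true → dep i j k = true := by decide +kernel

/-- The lines that join the points of a pair are distinguished by a count: they have two points on
five lines and two on three lines, which gives `2 * 12 + 2 * 2` pairs, and there are `43` pairs with
a repetition. -/
theorem pairCount_iff : ∀ i, pairCount i = 71 ↔ i < 3 := by decide +kernel

theorem fst_eq_of_onLine : ∀ i : Fin 15, i < 3 → ∀ p q, onLine p i = true → onLine q i = true →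
    p.1 = q.1 := by decide +kernel

theorem exists_onLine_pair : ∀ a, ∃ i : Fin 15, i < 3 ∧ onLine (a, 0) i = true ∧
    onLine (a, 1) i = true := by decide +kernel

variable {σ : Equiv.Perm (Fin 15)}

theorem thirdCount_perm (hσ : σ ∈ depAut dep) (i j : Fin 15) :
    thirdCount (σ i) (σ j) = thirdCount i j :=
  (Finset.card_equiv σ fun k => by simp [hσ i j k]).symm

theorem pairCount_perm (hσ : σ ∈ depAut dep) (i : Fin 15) : pairCount (σ i) = pairCount i :=
  (Finset.card_equiv (σ.prodCongr σ) fun p => by simp [hσ i p.1 p.2]).symm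

theorem exists_onLine_perm (hσ : σ ∈ depAut dep) (p : PairPoint) :
    ∃ q, ∀ i, onLine p i = true → onLine q (σ i) = true := by
  obtain ⟨i, j, hij, h5, hp⟩ := exists_thirdCount p
  obtain ⟨q, hq⟩ := exists_of_thirdCount (σ i) (σ j) (σ.injective.ne hij)
    ((thirdCount_perm hσ i j).trans h5)
  exact ⟨q, fun k hk => hq _ ((hσ i j k).trans (hp k hk))⟩

/-- A permutation that preserves dependence permutes the six points on five planes. -/
theorem exists_pointPerm (hσ : σ ∈ depAut dep) :
    ∃ τ : Equiv.Perm PairPoint, ∀ p i, onLine p i = true → onLine (τ p) (σ i) = true := by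
  choose τ hτ using exists_onLine_perm hσ
  choose ρ hρ using exists_onLine_perm ((depAut dep).inv_mem hσ)
  refine ⟨⟨τ, ρ, fun p => ?_, fun p => ?_⟩, hτ⟩
  · refine (eq_of_forall_onLine _ _ fun i hi => ?_).symm
    have := hρ _ _ (hτ p i hi)
    rwa [← Equiv.Perm.mul_apply, inv_mul_cancel] at this
  · refine (eq_of_forall_onLine _ _ fun i hi => ?_).symm
    have := hτ _ _ (hρ p i hi)
    rwa [← Equiv.Perm.mul_apply, mul_inv_cancel] at this

/-- A permutation of the six points that preserves the three pairs is in the wreath product. -/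
theorem exists_pairPerm_eq (τ : Equiv.Perm PairPoint) (h : ∀ a, (τ (a, 0)).1 = (τ (a, 1)).1) :
    ∃ g, pairPerm g = τ := by
  have h1 : ∀ p : PairPoint, τ p = ((τ (p.1, 0)).1, (τ (p.1, 0)).2 + p.2) := by
    rintro ⟨a, s⟩
    have hs : s = 0 ∨ s = 1 := by revert s; decide
    rcases hs with rfl | rfl
    · simp
    · refine Prod.ext (h a).symm ?_
      have hne : (τ (a, 1)).2 ≠ (τ (a, 0)).2 := fun h2 => by
        have := τ.injective (Prod.ext (h a).symm h2)
        simp at this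
      have : ∀ x y : ZMod 2, x ≠ y → x = y + 1 := by decide
      exact this _ _ hne
  have hinj : Function.Injective fun a => (τ (a, 0)).1 := by
    intro a b hab
    have : τ (a, 0) = τ (b, (τ (a, 0)).2 - (τ (b, 0)).2) := by
      rw [h1 (b, _)]
      exact Prod.ext hab (by simp)
    exact congrArg Prod.fst (τ.injective this)
  set π := Equiv.ofBijective _ (Finite.injective_iff_bijective.mp hinj) with hπ
  refine ⟨⟨fun b => Multiplicative.ofAdd (τ (π.symm b, 0)).2, π⟩, ?_⟩
  ext1 p
  rw [pairPerm_apply, h1 p]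
  simp only [Equiv.symm_apply_apply, toAdd_ofAdd]
  rfl

theorem exists_linePerm_eq (hσ : σ ∈ depAut dep) : ∃ g, linePerm (pairPerm g) = σ := by
  obtain ⟨τ, hτ⟩ := exists_pointPerm hσ
  obtain ⟨g, rfl⟩ := exists_pairPerm_eq τ fun a => by
    obtain ⟨i, hi, h0, h1⟩ := exists_onLine_pair a
    refine fst_eq_of_onLine (σ i) ?_ _ _ (hτ _ _ h0) (hτ _ _ h1)
    rw [← pairCount_iff, pairCount_perm hσ, pairCount_iff]
    exact hi
  exact ⟨g, Equiv.ext fun i => (eq_lineMap _ fun p hp => hτ p i hp).symm⟩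

/-- The permutations of the planes that preserve dependence form the wreath product. -/
def depAutEquiv : WreathZ2S3 ≃* depAut dep :=
  MulEquiv.ofBijective ((linePerm.comp pairPerm).codRestrict _ linePerm_pairPerm_mem)
    ⟨fun _ _ h => pairPerm_injective (linePerm_injective (congrArg Subtype.val h)), fun σ => by
      obtain ⟨g, hg⟩ := exists_linePerm_eq σ.2
      exact ⟨g, Subtype.ext hg⟩⟩

end DepAut

/-! ### The reflection group of type `B₃` -/

section ReflectionGroup

/-- The sign of an element of the group of order two. -/
def signOf (z : Multiplicative (ZMod 2)) : ℝ := if z = 1 then 1 else -1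

theorem eq_one_or_eq_ofAdd_one (z : Multiplicative (ZMod 2)) :
    z = 1 ∨ z = Multiplicative.ofAdd 1 := by
  revert z
  decide

theorem signOf_mul (z z' : Multiplicative (ZMod 2)) : signOf (z * z') = signOf z * signOf z' := by
  have h : (Multiplicative.ofAdd 1 : Multiplicative (ZMod 2)) * Multiplicative.ofAdd 1 = 1 := by
    decide
  rcases eq_one_or_eq_ofAdd_one z with rfl | rfl <;>
  rcases eq_one_or_eq_ofAdd_one z' with rfl | rfl <;>
  simp [signOf, h]

theorem signOf_injective : Function.Injective signOf := by
  intro z z' h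
  rcases eq_one_or_eq_ofAdd_one z with rfl | rfl <;>
  rcases eq_one_or_eq_ofAdd_one z' with rfl | rfl <;>
  first | rfl | (exfalso; simp [signOf] at h; linarith)

/-- The isometry that permutes the coordinates and changes their signs. -/
def signedIsometry (g : WreathZ2S3) :
    EuclideanSpace ℝ (Fin 3) ≃ₗᵢ[ℝ] EuclideanSpace ℝ (Fin 3) :=
  (LinearIsometryEquiv.piLpCongrLeft 2 ℝ ℝ g.right).trans
    (LinearIsometryEquiv.piLpCongrRight 2 fun a =>
      if g.left a = 1 then LinearIsometryEquiv.refl ℝ ℝ else LinearIsometryEquiv.neg ℝ)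

theorem signedIsometry_apply (g : WreathZ2S3) (x : EuclideanSpace ℝ (Fin 3)) (b : Fin 3) :
    signedIsometry g x b = signOf (g.left b) * x (g.right.symm b) := by
  have : signedIsometry g x b = (if g.left b = 1 then LinearIsometryEquiv.refl ℝ ℝ else
      LinearIsometryEquiv.neg ℝ) (x (g.right.symm b)) := rfl
  rw [this, signOf]
  split_ifs <;> simp

/-- The representation of the wreath product by signed permutations. -/
def signedIsometryHom :
    WreathZ2S3 →* (EuclideanSpace ℝ (Fin 3) ≃ₗᵢ[ℝ] EuclideanSpace ℝ (Fin 3)) where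
  toFun := signedIsometry
  map_one' := by
    ext x b
    rw [signedIsometry_apply]
    change signOf 1 * x b = x b
    simp [signOf]
  map_mul' g h := by
    ext x b
    change signedIsometry (g * h) x b = signedIsometry g (signedIsometry h x) b
    simp only [signedIsometry_apply, SemidirectProduct.mul_left, SemidirectProduct.mul_right,
      Pi.mul_apply, signOf_mul, mul_assoc]
    rfl

theorem signedIsometryHom_apply (g : WreathZ2S3) (x : EuclideanSpace ℝ (Fin 3)) (b : Fin 3) :
    signedIsometryHom g x b = signOf (g.left b) * x (g.right.symm b) :=
  signedIsometry_apply g x b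

theorem signedIsometryHom_injective : Function.Injective signedIsometryHom := by
  intro g h hgh
  have key : ∀ a b, signOf (g.left b) * (EuclideanSpace.single a 1 : EuclideanSpace ℝ (Fin 3))
      (g.right.symm b) = signOf (h.left b) *
        (EuclideanSpace.single a 1 : EuclideanSpace ℝ (Fin 3)) (h.right.symm b) := by
    intro a b
    rw [← signedIsometryHom_apply, hgh, signedIsometryHom_apply]
  have hne : ∀ z, signOf z ≠ 0 := by
    intro z
    rw [signOf]
    split_ifs <;> norm_num
  have hr : ∀ b, h.right.symm b = g.right.symm b := by
    intro b
    by_contra hb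
    have := key (g.right.symm b) b
    simp [hb, hne] at this
  refine SemidirectProduct.ext (funext fun b => signOf_injective ?_)
    (Equiv.symm_bijective.injective (Equiv.ext fun b => (hr b).symm))
  have := key (g.right.symm b) b
  simpa [hr b] using this

theorem reflection_apply_coord (v x : EuclideanSpace ℝ (Fin 3)) (b : Fin 3) :
    (ℝ ∙ v)ᗮ.reflection x b = x b - 2 * (inner ℝ v x / inner ℝ v v) * v b := by
  rw [Submodule.reflection_orthogonal_apply, Submodule.reflection_singleton_apply,
    real_inner_self_eq_norm_sq]
  simp
  ring

theorem signedIsometryHom_signChange (a : Fin 3) :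
    signedIsometryHom (signChange a) = (ℝ ∙ (EuclideanSpace.single a 1 :
      EuclideanSpace ℝ (Fin 3)))ᗮ.reflection := by
  ext x b
  rw [signedIsometryHom_apply, reflection_apply_coord]
  have h1 : (signChange a).right.symm b = b := rfl
  have h2 : (signChange a).left b =
    (Pi.mulSingle a (Multiplicative.ofAdd 1) : Fin 3 → Multiplicative (ZMod 2)) b := rfl
  rw [h1, h2, EuclideanSpace.inner_single_left, EuclideanSpace.inner_single_left]
  by_cases hab : b = a
  · subst hab
    simp [signOf]
    ring
  · simp [signOf, hab]

theorem signedIsometryHom_transposition {a b : Fin 3} (hab : a ≠ b) :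
    signedIsometryHom (transposition a b) = (ℝ ∙ (EuclideanSpace.single a 1 -
      EuclideanSpace.single b 1 : EuclideanSpace ℝ (Fin 3)))ᗮ.reflection := by
  ext x i
  rw [signedIsometryHom_apply, reflection_apply_coord]
  have h1 : (transposition a b).left i = 1 := rfl
  have h2 : (transposition a b).right.symm i = Equiv.swap a b i := rfl
  rw [h1, h2]
  simp only [signOf, if_true, one_mul, inner_sub_left, inner_sub_right,
    EuclideanSpace.inner_single_left, map_one]
  by_cases hia : i = a
  · subst hia
    simp [hab, hab.symm]
    ring
  · by_cases hib : i = b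
    · subst hib
      simp [hab, hab.symm]
      ring
    · simp [hia, hib, Equiv.swap_apply_of_ne_of_ne hia hib]

theorem signedIsometryHom_add {a b : Fin 3} (hab : a ≠ b) :
    signedIsometryHom (signChange a * signChange b * transposition a b) =
      (ℝ ∙ (EuclideanSpace.single a 1 +
        EuclideanSpace.single b 1 : EuclideanSpace ℝ (Fin 3)))ᗮ.reflection := by
  ext x i
  rw [reflection_apply_coord, map_mul, map_mul]
  change signedIsometryHom (signChange a) (signedIsometryHom (signChange b)
    (signedIsometryHom (transposition a b) x)) i = _
  rw [signedIsometryHom_apply, signedIsometryHom_apply, signedIsometryHom_apply]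
  have h1 : ∀ j, (transposition a b).left j = 1 := fun _ => rfl
  have h2 : ∀ j, (transposition a b).right.symm j = Equiv.swap a b j := fun _ => rfl
  have h3 : ∀ a j, (signChange a).right.symm j = j := fun _ _ => rfl
  have h4 : ∀ a j, (signChange a).left j =
    (Pi.mulSingle a (Multiplicative.ofAdd 1) : Fin 3 → Multiplicative (ZMod 2)) j := fun _ _ => rfl
  simp only [h1, h2, h3, h4]
  simp only [inner_add_left, inner_add_right, EuclideanSpace.inner_single_left, map_one]
  by_cases hia : i = a
  · subst hia
    simp [hab, hab.symm, signOf]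
    ring
  · by_cases hib : i = b
    · subst hib
      simp [hab, hab.symm, signOf]
      ring
    · simp [hia, hib, Equiv.swap_apply_of_ne_of_ne hia hib, signOf]

theorem range_signedIsometryHom : signedIsometryHom.range = reflectionGroupB3 := by
  apply le_antisymm
  · have h : reflectionGroupB3.comap signedIsometryHom = ⊤ := by
      refine wreath_eq_top (fun a => ?_) fun a b hab => ?_
      · exact Subgroup.subset_closure ⟨_, Or.inl ⟨a, rfl⟩, signedIsometryHom_signChange a⟩
      · exact Subgroup.subset_closure ⟨_, Or.inr ⟨a, b, hab, Or.inr rfl⟩,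
          signedIsometryHom_transposition hab⟩
    rintro _ ⟨g, rfl⟩
    exact (Subgroup.eq_top_iff' _).mp h g
  · refine (Subgroup.closure_le _).mpr ?_
    rintro g ⟨x, ⟨a, rfl⟩ | ⟨a, b, hab, rfl | rfl⟩, rfl⟩
    · exact ⟨_, signedIsometryHom_signChange a⟩
    · exact ⟨_, signedIsometryHom_add hab⟩
    · exact ⟨_, signedIsometryHom_transposition hab⟩

/-- The wreath product is the reflection group of type `B₃`. -/
def wreathEquivReflectionGroup : WreathZ2S3 ≃* reflectionGroupB3 :=
  (MonoidHom.ofInjective signedIsometryHom_injective).trans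
    (MulEquiv.subgroupCongr range_signedIsometryHom)

end ReflectionGroup

/-- The automorphism group of the lattice of the generic arrangement. -/
def genericLatticeAutEquiv :
    (genericArr15.Lattice ≃o genericArr15.Lattice) ≃* WreathZ2S3 :=
  (latticeAutEquiv isDepTable_genericArr15 allIndep_genericArr15 _ planes_genericArr15).trans
    depAutEquiv.symm

end HypArr

end

open HypArr in
theorem mainTheorem8 :
    -- (1) the moduli space is one-dimensional, and it consists of the classes of the `A_l`, `l ∉ Z`
    (topologicalKrullDim (Moduli ℂ genericArr15.Lattice 3) = 1 ∧
      ∃ h : ∀ l : ℂ, l ∉ excludedParams → arr15 l ∈ Realizations ℂ genericArr15.Lattice 3,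
        (Set.univ : Set (Moduli ℂ genericArr15.Lattice 3)) =
          {x | ∃ (l : ℂ) (hl : l ∉ excludedParams), x = Moduli.mk (arr15 l) (h l hl)}) ∧
    -- (2) the parameters at which planes collapse
    (∀ l ∈ ({0, 1, 1 / 2} : Set ℂ),
      (arr15 l).planes.ncard ≠ genericArr15.planes.ncard) ∧
    -- (3) the parameters at which the lattice degenerates to that of the icosahedral arrangement
    (∀ l ∈ ({(3 + ((Real.sqrt 5 : ℝ) : ℂ)) / 2, (3 - ((Real.sqrt 5 : ℝ) : ℂ)) / 2,
        (-1 + ((Real.sqrt 5 : ℝ) : ℂ)) / 2, (-1 - ((Real.sqrt 5 : ℝ) : ℂ)) / 2} : Set ℂ),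
      (arr15 l).planes.ncard = genericArr15.planes.ncard ∧
      Nonempty ((arr15 l).Lattice ≃o icosahedralArr.Lattice) ∧
      (arr15 l).IsFreeWithExponents ![1, 5, 9]) ∧
    -- (4) the generic arrangement
    (genericArr15.IsFreeWithExponents ![1, 7, 7] ∧ ¬ genericArr15.IsRecursivelyFree) ∧
    -- (5) the specializations
    ((∀ l ∈ recursivelyFreeParams, (arr15 l).IsRecursivelyFree) ∧
      ∀ l : ℂ, l ∉ excludedParams → l ∉ recursivelyFreeParams →
        (arr15 l).IsFree ∧ ¬ (arr15 l).IsRecursivelyFree) ∧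
    -- (6) the symmetry group of the lattice
    (Nonempty ((genericArr15.Lattice ≃o genericArr15.Lattice) ≃* WreathZ2S3) ∧
      Nonempty ((genericArr15.Lattice ≃o genericArr15.Lattice) ≃* reflectionGroupB3)) := by
  have hcard : genericArr15.planes.ncard = 15 := ncard_planes_arr15 isGood_ratFunc
  refine ⟨⟨topologicalKrullDim_moduli, fun l hl => arr15_mem_realizations hl, ?_⟩, fun l hl => ?_,
    fun l hl => ?_, ⟨isFreeWithExponents_arr15 isGood_ratFunc,
      not_isRecursivelyFree_arr15 isGood_ratFunc not_isSpecial_ratFunc⟩,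
    ⟨fun l hl => isRecursivelyFree_arr15 ((isSpecial_iff l).mpr hl), fun l hl hs => ?_⟩,
    ⟨⟨genericLatticeAutEquiv⟩, ⟨genericLatticeAutEquiv.trans wreathEquivReflectionGroup⟩⟩⟩
  · exact (Set.eq_univ_of_forall exists_eq_mk_arr15).symm
  · exact ncard_planes_arr15_ne l hl
  · rw [hcard]
    exact arr15_of_golden hl
  · have hc := (isGood_iff l).mpr hl
    exact ⟨⟨_, isFreeWithExponents_arr15 hc⟩,
      not_isRecursivelyFree_arr15 hc fun h => hs ((isSpecial_iff l).mp h)⟩
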